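/- There is a universal constant $C>0$ such that the following holds. Let $d,m\ge 1$ be integers, $L_0,R>0$, let $\mathcal X\subseteq\mathbb R^d$ be compact and convex, let $x^*\in\mathcal X$ satisfy $\tfrac12\|x^*\|_2^2\le R^2$ and $\|x-x^*\|_2\le R$ for all $x\in\mathcal X$, and let $\varphi:\mathcal X\to\mathbb R$ be convex and lower semicontinuous. Put $\psi(x)=\tfrac12\|x\|_2^2$, $u=Rd^{1/4}$ and $D=\mathcal X+B_2(0,u)$, where $B_2(0,r)$ is the closed Euclidean ball of radius $r$. Let $P$ be a probability distribution on a space $\Xi$, let $F(\cdot\,;\xi)$, $\xi\in\Xi$, be real functions on $D$ such that $F(x;\cdot)$ is $P$-integrable for every $x\in D$ and $F(\cdot\,;\xi)$ is $L_0$-Lipschitz on $D$ with respect to $\|\cdot\|_2$ for $P$-almost every $\xi$, and assume that $f(x)=\mathbb E_{\xi\sim P}[F(x;\xi)]$ is convex on $D$. Let $\theta_0=1$ and $\theta_{t}=2/(1+\sqrt{1+4/\theta_{t-1}^2})$ for $t\ge1$, and for $t\ge 0$ let $u_t=u\theta_t$, $L_t=L_0\sqrt d/u_t$ and $\eta_t=L_0\sqrt{t+1}/(R\sqrt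 m)$. Let $Z_{i,t}$ (uniform on $B_2(0,1)$) and $\xi_{i,t}\sim P$, $1\le i\le m$, $t\ge0$, be independent. Starting from deterministic points $x_0,z_0\in\mathcal X$, generate for $t=0,1,2,\dots$ $$y_t=(1-\theta_t)x_t+\theta_tz_t,\qquad g_{i,t}\in\partial F(y_t+u_tZ_{i,t};\xi_{i,t})\ \text{ (almost surely)},\qquad g_t=\frac1m\sum_{i=1}^m g_{i,t},$$ $$z_{t+1}=\operatorname*{argmin}_{x\in\mathcal X}\Big\{\sum_{\tau=0}^t\frac1{\theta_\tau}\langle g_\tau,x\rangle+\sum_{\tau=0}^t\frac1{\theta_\tau}\varphi(x)+L_{t+1}\psi(x)+\frac{\eta_{t+1}}{\theta_{t+1}}\psi(x)\Big\},\qquad x_{t+1}=(1-\theta_t)x_t+\theta_tz_{t+1},$$ where the $g_{i,t}$ are random vectors and $g\in\partial F(p;\xi)$ means $F(q;\xi)\ge F(p;\xi)+\langle g,q-p\rangle$ for all $q\in D$. Then for every integer $T\ge4$ and every $\delta\in(0,1)$, with probability at least $1-\delta$, $$f(x_T)+\varphi(x_T)-f(x^*)-\varphi(x^*)\le C\left(\frac{L_0Rd^{1/4}}{T}+\frac{L_0R}{\sqrt{Tm}}+\frac{L_0R\sqrt{\log\frac1\delta}}{\sqrt{Tm}}+\frac{L_0R\max\{\log\frac1\delta,\log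 T\}}{T\sqrt m}\right).$$ -/

import Mathlib

open MeasureTheory ProbabilityTheory
open scoped Pointwise

namespace RandomizedSmoothing

/-- The objective `f(x) = E[F(x; ξ)]`, where `ξ` has law `P`. -/
noncomputable def expectedObjective {E Ξ : Type*} [MeasurableSpace Ξ]
    (P : Measure Ξ) (F : E → Ξ → ℝ) (x : E) : ℝ :=
  ∫ s, F x s ∂P

/-- `g` is a subgradient at `p` of the function `h` with domain `D`. -/
def IsSubgradientOn {E : Type*} [NormedAddCommGroup E] [InnerProductSpace ℝ E]
    (h : E → ℝ) (D : Set E) (p g : E) : Prop :=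
  p ∈ D ∧ ∀ q ∈ D, h p + inner ℝ g (q - p) ≤ h q

/-- The scalars `θ_t`: `θ_0 = 1` and `θ_t = 2 / (1 + √(1 + 4 / θ_{t-1}²))`, so that
`(1 - θ_t) / θ_t² = 1 / θ_{t-1}²`. -/
noncomputable def theta : ℕ → ℝ
  | 0 => 1
  | t + 1 => 2 / (1 + √(1 + 4 / theta t ^ 2))

/-- The uniform distribution on the closed Euclidean unit ball of `ℝ^d`. -/
noncomputable def uniformBall (d : ℕ) : Measure (EuclideanSpace ℝ (Fin d)) :=
  cond volume (Metric.closedBall 0 1)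

/-- The minibatch average `g_t = (1/m) ∑ i, g_{i,t}`. -/
noncomputable def batchMean {E Ω : Type*} [NormedAddCommGroup E] [InnerProductSpace ℝ E]
    {m : ℕ} (g : ℕ → Fin m → Ω → E) (t : ℕ) (ω : Ω) : E :=
  (m : ℝ)⁻¹ • ∑ i, g t i ω

/-- The function minimized over the feasible set in order to obtain `z_{t+1}`:
`∑_{τ ≤ t} ⟨g_τ, v⟩ / θ_τ + ∑_{τ ≤ t} φ(v) / θ_τ + L_{t+1} ψ(v) + (η_{t+1} / θ_{t+1}) ψ(v)`,
where `G τ` stands for `g_τ`. -/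
noncomputable def dualAveragingObjective {E : Type*}
    [NormedAddCommGroup E] [InnerProductSpace ℝ E]
    (φ ψ : E → ℝ) (L η : ℕ → ℝ) (G : ℕ → E) (t : ℕ) (v : E) : ℝ :=
  ∑ τ ∈ Finset.range (t + 1), 1 / theta τ * inner ℝ (G τ) v
    + ∑ τ ∈ Finset.range (t + 1), 1 / theta τ * φ v
    + L (t + 1) * ψ v + η (t + 1) / theta (t + 1) * ψ v

/-- The random inputs of the algorithm: the pairs `(Z_{i,t}, ξ_{i,t})` are independent over all
`(t, i)`, and each consists of independent `Z_{i,t} ∼ μ` and `ξ_{i,t} ∼ P`. -/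
structure IsSampling {E Ξ Ω : Type*} [MeasurableSpace E] [MeasurableSpace Ξ] [MeasurableSpace Ω]
    (Pr : Measure Ω) (μ : Measure E) (P : Measure Ξ) {m : ℕ}
    (Z : ℕ → Fin m → Ω → E) (ξ : ℕ → Fin m → Ω → Ξ) : Prop where
  measurable_Z : ∀ t i, Measurable (Z t i)
  measurable_ξ : ∀ t i, Measurable (ξ t i)
  law : ∀ t i, HasLaw (fun ω => (Z t i ω, ξ t i ω)) (μ.prod P) Pr
  indep : iIndepFun (fun (p : ℕ × Fin m) ω => (Z p.1 p.2 ω, ξ p.1 p.2 ω)) Pr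

/-- `(x_t, y_t, z_t)` is a run of the smoothed accelerated dual averaging method on the feasible
set `X`, started at the deterministic points `x₀, z₀ ∈ X`, for functions `F(·; s)` with domain
`D`, regularizer `φ`, proximal function `ψ`, smoothing parameters `u_t`, Lipschitz estimates `L_t`,
damping parameters `η_t`, and oracle answers `g_{i,t} ∈ ∂F(y_t + u_t Z_{i,t}; ξ_{i,t})`. -/
structure IsRun {E Ξ Ω : Type*} [NormedAddCommGroup E] [InnerProductSpace ℝ E]
    [MeasurableSpace E] [MeasurableSpace Ω] (Pr : Measure Ω)
    (X D : Set E) (F : E → Ξ → ℝ) (φ ψ : E → ℝ) (u L η : ℕ → ℝ) {m : ℕ}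
    (Z : ℕ → Fin m → Ω → E) (ξ : ℕ → Fin m → Ω → Ξ) (g : ℕ → Fin m → Ω → E)
    (x₀ z₀ : E) (x y z : ℕ → Ω → E) : Prop where
  x₀_mem : x₀ ∈ X
  z₀_mem : z₀ ∈ X
  x_zero : ∀ ω, x 0 ω = x₀
  z_zero : ∀ ω, z 0 ω = z₀
  y_update : ∀ t ω, y t ω = (1 - theta t) • x t ω + theta t • z t ω
  measurable_g : ∀ t i, Measurable (g t i)
  oracle : ∀ t i, ∀ᵐ ω ∂Pr,
    IsSubgradientOn (fun p => F p (ξ t i ω)) D (y t ω + u t • Z t i ω) (g t i ω)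
  z_mem : ∀ t ω, z (t + 1) ω ∈ X
  z_update : ∀ t ω,
    IsMinOn (dualAveragingObjective φ ψ L η (fun τ => batchMean g τ ω) t) X (z (t + 1) ω)
  x_update : ∀ t ω, x (t + 1) ω = (1 - theta t) • x t ω + theta t • z (t + 1) ω

end RandomizedSmoothing

/-! Let `f_u(x)` be the mean of `f` over the ball of radius `u` around `x`. For a convex
`L₀`-Lipschitz `f`, the function `f_u` is convex, lies between `f` and `f + L₀ u`, decreases when
`u` decreases, and has an `L₀ √d / u`-Lipschitz gradient. The method is therefore accelerated dual
averaging on smooth functions `f_{u_t}` that decrease with `t`, run with noisy gradients.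

The factor `√d`, rather than `d`, comes from integrating by parts against a radial cutoff of the
unit ball. The gradient of the cutoff has size `1/ε` on an annulus of relative volume at most `ε d`,
and a random direction has mean absolute component at most `1/√d` along a fixed unit vector
(`integral_abs_lineDeriv_cutoff_le`, `abs_integral_lineDeriv_le`, `smoothed_add_le`).

Deterministic part (`accelerated_gap_le`, `trajectory_gap_le`): put `a_t = 1/θ_t` and let `e_t` be
the gradient error. Strong convexity of the dual averaging objective pays for the curvature `L_t`
and for the pairing of `e_t` with `z_{t+1} - z_t`. What remains is the prox terms at `x*`, the bias
`∑ a_t L₀ u_t = L₀ u T`, and the two sums `∑ a_t ⟨e_t, x* - z_t⟩` and `∑ a_t ‖e_t‖² / (2 η_t)`. All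
of it is divided by `a_{T-1}² ≥ T²/4`.

Probabilistic part: `z_t` depends on the past only, and `e_t` is a mean of `m` conditionally
independent centred vectors of norm at most `2 L₀`. The first sum is a martingale, controlled by
Hoeffding's lemma and Chernoff's bound (`IsAEGradient.measure_sum_inner_ge_le`). The second is
controlled by a dimension-free exponential moment of squared norms
(`IsAEGradient.measure_sum_norm_sq_ge_le`). Each event costs `δ/2`.

The oracle may select its subgradients arbitrarily, so adaptedness has to be proved. Since `Z` has a
density and is independent of `y_t`, the point `y_t + u_t Z` is almost surely a point of
differentiability (Rademacher), where the subgradient is forced. It then equals a fixed jointly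
measurable field `G`, built from a Lipschitz extension of `F` off `D` (`exists_isAEGradient`,
`IsRun.adapted`). -/

namespace RandomizedSmoothing

/-! ### The scalars `θ_t` -/

theorem theta_pos (t : ℕ) : 0 < theta t := by
  cases t with
  | zero => simp [theta]
  | succ t => rw [theta]; positivity

theorem theta_le_one (t : ℕ) : theta t ≤ 1 := by
  cases t with
  | zero => simp [theta]
  | succ t =>
    rw [theta, div_le_one (by positivity)]
    have : 1 ≤ √(1 + 4 / theta t ^ 2) := by
      rw [Real.one_le_sqrt]
      have := theta_pos t
      have : 0 < 4 / theta t ^ 2 := by positivity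
      linarith
    linarith

theorem inv_theta_succ (t : ℕ) :
    (theta (t + 1))⁻¹ = (1 + √(1 + 4 * (theta t)⁻¹ ^ 2)) / 2 := by
  rw [theta, inv_div, inv_pow, div_eq_mul_inv 4]

/-- The recurrence that drives the acceleration: the coefficient left on the old value at step `t +
1` is exactly the one gained at step `t`, so the weighted gaps telescope. -/
theorem inv_theta_succ_sq (t : ℕ) :
    (theta (t + 1))⁻¹ ^ 2 - (theta (t + 1))⁻¹ = (theta t)⁻¹ ^ 2 := by
  rw [inv_theta_succ]
  have := Real.sq_sqrt (show 0 ≤ 1 + 4 * (theta t)⁻¹ ^ 2 by positivity)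
  linear_combination this / 4

theorem one_le_inv_theta (t : ℕ) : 1 ≤ (theta t)⁻¹ :=
  (one_le_inv₀ (theta_pos t)).2 (theta_le_one t)

/-- Completing the square, `(a_{t+1} - 1/2)² = a_t² + 1/4` lies between `a_t²` and `(a_t + 1/2)²`.
This gives both this bound and the next one. -/
theorem inv_theta_succ_le (t : ℕ) : (theta (t + 1))⁻¹ ≤ (theta t)⁻¹ + 1 := by
  have h1 := inv_theta_succ_sq t
  have h2 := one_le_inv_theta t
  have h3 := one_le_inv_theta (t + 1)
  nlinarith

theorem le_inv_theta_succ (t : ℕ) : (theta t)⁻¹ + 1 / 2 ≤ (theta (t + 1))⁻¹ := by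
  have h1 := inv_theta_succ_sq t
  have h2 := one_le_inv_theta t
  have h3 := one_le_inv_theta (t + 1)
  nlinarith

theorem inv_theta_mono : Monotone fun t => (theta t)⁻¹ :=
  monotone_nat_of_le_succ fun t => by linarith [le_inv_theta_succ t]

theorem inv_theta_le (t : ℕ) : (theta t)⁻¹ ≤ t + 1 := by
  induction t with
  | zero => simp [theta]
  | succ t ih => push_cast; linarith [inv_theta_succ_le t]

theorem le_inv_theta (t : ℕ) : ((t : ℝ) + 2) / 2 ≤ (theta t)⁻¹ := by
  induction t with
  | zero => simp [theta]
  | succ t ih => push_cast; linarith [le_inv_theta_succ t]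

/-- The weights put on the comparison point add up to the coefficient of the final value, so the
bound becomes one on the gap. -/
theorem sum_inv_theta (n : ℕ) :
    ∑ t ∈ Finset.range (n + 1), (theta t)⁻¹ = (theta n)⁻¹ ^ 2 := by
  induction n with
  | zero => simp [theta]
  | succ n ih => rw [Finset.sum_range_succ, ih]; linarith [inv_theta_succ_sq n]

/-! ### Strong convexity -/

section
variable {E : Type*} [NormedAddCommGroup E] [InnerProductSpace ℝ E]

/-- The exact convexity defect of the squared norm, which is the source of all quadratic growth
below. -/
theorem norm_sq_segment (z x : E) (s : ℝ) :
    ‖(1 - s) • z + s • x‖ ^ 2 = (1 - s) * ‖z‖ ^ 2 + s * ‖x‖ ^ 2 - s * (1 - s) * ‖x - z‖ ^ 2 := by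
  rw [norm_add_sq_real, norm_sub_sq_real, norm_smul, norm_smul, mul_pow, mul_pow,
    inner_smul_left, inner_smul_right, real_inner_comm z x]
  simp only [Real.norm_eq_abs, sq_abs, conj_trivial]
  ring

/-- Quadratic growth of a strongly convex function at its minimizer. -/
theorem quadratic_growth_of_isMinOn {X : Set E} {h : E → ℝ} (hh : ConvexOn ℝ X h) {b : ℝ}
    {z : E} (hz : z ∈ X) (hmin : IsMinOn (fun v => h v + b * (1 / 2 * ‖v‖ ^ 2)) X z)
    {x : E} (hx : x ∈ X) :
    h z + b * (1 / 2 * ‖z‖ ^ 2) + b / 2 * ‖x - z‖ ^ 2 ≤ h x + b * (1 / 2 * ‖x‖ ^ 2) := by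
  -- Minimality is tested at `(1 - s) z + s x`. After division by `s` the convexity defect survives
  -- with factor `1 - s`, and `s → 0` recovers the full constant.
  have key : ∀ s : ℝ, s ∈ Set.Ioo (0 : ℝ) 1 →
      (1 - s) * (b / 2 * ‖x - z‖ ^ 2)
        ≤ h x + b * (1 / 2 * ‖x‖ ^ 2) - (h z + b * (1 / 2 * ‖z‖ ^ 2)) := by
    intro s hs
    have h0 : 0 ≤ 1 - s := by linarith [hs.2]
    have hm := hmin (hh.1 hz hx h0 hs.1.le (by ring))
    have hc := hh.2 hz hx h0 hs.1.le (by ring)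
    simp only [Set.mem_ofPred_eq, norm_sq_segment, smul_eq_mul] at hm hc
    have : s * ((1 - s) * (b / 2 * ‖x - z‖ ^ 2))
        ≤ s * (h x + b * (1 / 2 * ‖x‖ ^ 2) - (h z + b * (1 / 2 * ‖z‖ ^ 2))) := by
      nlinarith
    exact le_of_mul_le_mul_left this hs.1
  have lim : Filter.Tendsto (fun s : ℝ => (1 - s) * (b / 2 * ‖x - z‖ ^ 2))
      (nhdsWithin 0 (Set.Ioi 0)) (nhds ((1 - 0) * (b / 2 * ‖x - z‖ ^ 2))) := by
    apply Filter.Tendsto.mono_left _ nhdsWithin_le_nhds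
    exact Continuous.tendsto (by fun_prop) 0
  have := le_of_tendsto lim (Filter.eventually_of_mem (Ioo_mem_nhdsGT one_pos) key)
  linarith

/-! ### The deterministic analysis of accelerated dual averaging -/

/-- Separates the convex part from the quadratic, the shape required by
`quadratic_growth_of_isMinOn`. -/
theorem dualAveragingObjective_eq {φ ψ : E → ℝ} (hψ : ∀ v, ψ v = 1 / 2 * ‖v‖ ^ 2)
    (L η : ℕ → ℝ) (G : ℕ → E) (t : ℕ) (v : E) :
    dualAveragingObjective φ ψ L η G t v =
      ∑ τ ∈ Finset.range (t + 1), (theta τ)⁻¹ * (inner ℝ (G τ) v + φ v)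
        + (L (t + 1) + η (t + 1) * (theta (t + 1))⁻¹) * (1 / 2 * ‖v‖ ^ 2) := by
  simp only [dualAveragingObjective, hψ, mul_add, Finset.sum_add_distrib, div_eq_mul_inv, one_mul]
  ring

theorem convexOn_linearized {X : Set E} {φ : E → ℝ} (hφ : ConvexOn ℝ X φ) (G : ℕ → E) (n : ℕ) :
    ConvexOn ℝ X fun v => ∑ τ ∈ Finset.range n, (theta τ)⁻¹ * (inner ℝ (G τ) v + φ v) := by
  induction n with
  | zero => simpa using convexOn_const (0 : ℝ) hφ.1
  | succ n ih =>
    simp only [Finset.sum_range_succ]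
    refine ih.add (ConvexOn.smul (inv_nonneg.2 (theta_pos n).le) (ConvexOn.add ?_ hφ))
    exact (innerSL ℝ (G n)).toLinearMap.convexOn hφ.1

/-- The decrease achieved by a single step, in terms of the error `e` of the gradient estimate. -/
theorem inner_error_le (e w : E) {a η : ℝ} (ha : 0 < a) (hη : 0 < η) :
    -(a * inner ℝ e w) - η * a / 2 * ‖w‖ ^ 2 ≤ a / (2 * η) * ‖e‖ ^ 2 := by
  have h1 : |inner ℝ e w| ≤ ‖e‖ * ‖w‖ := abs_real_inner_le_norm e w
  have h2 := neg_abs_le (inner ℝ e w)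
  have h3 : ‖e‖ * ‖w‖ ≤ ‖e‖ ^ 2 / (2 * η) + η / 2 * ‖w‖ ^ 2 := by
    rw [← sub_nonneg]
    have : ‖e‖ ^ 2 / (2 * η) + η / 2 * ‖w‖ ^ 2 - ‖e‖ * ‖w‖
        = (‖e‖ - η * ‖w‖) ^ 2 / (2 * η) := by field_simp; ring
    rw [this]; positivity
  have h4 : -(inner ℝ e w) ≤ ‖e‖ ^ 2 / (2 * η) + η / 2 * ‖w‖ ^ 2 := by linarith
  calc _ = a * (-(inner ℝ e w)) - η * a / 2 * ‖w‖ ^ 2 := by ring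
    _ ≤ a * (‖e‖ ^ 2 / (2 * η) + η / 2 * ‖w‖ ^ 2) - η * a / 2 * ‖w‖ ^ 2 := by gcongr
    _ = _ := by field_simp; ring

/-- The gap of accelerated dual averaging for a decreasing sequence of smooth convex functions
`fs t`, with gradients `Gb t` at `y t` of which `G t` are estimates. -/
theorem accelerated_gap_le {X : Set E} {φ ψ : E → ℝ} (hφ : ConvexOn ℝ X φ)
    (hψ : ∀ v, ψ v = 1 / 2 * ‖v‖ ^ 2) {L η : ℕ → ℝ} {G Gb x y z : ℕ → E} {fs : ℕ → E → ℝ}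
    (hL : ∀ t, 0 ≤ L t) (hη : ∀ t, 0 < η t)
    (hmono : Monotone fun t => L t + η t * (theta t)⁻¹)
    (hx0 : x 0 ∈ X) (hz : ∀ t, z t ∈ X)
    (hy : ∀ t, y t = (1 - theta t) • x t + theta t • z t)
    (hxs : ∀ t, x (t + 1) = (1 - theta t) • x t + theta t • z (t + 1))
    (hmin : ∀ t, IsMinOn (dualAveragingObjective φ ψ L η G t) X (z (t + 1)))
    (hlow : ∀ t, ∀ w ∈ X, fs t (y t) + inner ℝ (Gb t) (w - y t) ≤ fs t w)
    (hup : ∀ t, ∀ w ∈ X,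
      fs t w ≤ fs t (y t) + inner ℝ (Gb t) (w - y t) + L t / 2 * ‖w - y t‖ ^ 2)
    (hdec : ∀ t, ∀ w ∈ X, fs (t + 1) w ≤ fs t w)
    {R : ℝ} (hz0 : ‖z 1 - z 0‖ ≤ 2 * R) {xs : E} (hxsX : xs ∈ X) (n : ℕ) :
    (theta n)⁻¹ ^ 2 * (fs n (x (n + 1)) + φ (x (n + 1))) ≤
      (L (n + 1) + η (n + 1) * (theta (n + 1))⁻¹) * ψ xs + 2 * (L 0 + η 0) * R ^ 2
      + ∑ t ∈ Finset.range (n + 1), (theta t)⁻¹ * (fs t xs + φ xs)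
      + ∑ t ∈ Finset.range (n + 1), (theta t)⁻¹ * inner ℝ (G t - Gb t) (xs - z t)
      + ∑ t ∈ Finset.range (n + 1), (theta t)⁻¹ / (2 * η t) * ‖G t - Gb t‖ ^ 2 := by
  have hxX : ∀ t, x t ∈ X := by
    intro t
    induction t with
    | zero => exact hx0
    | succ t ih =>
      rw [hxs]
      exact hφ.1 ih (hz _) (by linarith [theta_le_one t]) (theta_pos t).le (by ring)
  set a : ℕ → ℝ := fun t => (theta t)⁻¹ with ha
  have ha1 : ∀ t, a t * theta t = 1 := fun t => inv_mul_cancel₀ (theta_pos t).ne'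
  have hapos : ∀ t, 0 < a t := fun t => inv_pos.2 (theta_pos t)
  -- one step on the function values
  have step : ∀ t, a t ^ 2 * (fs t (x (t + 1)) + φ (x (t + 1))) ≤
      (a t ^ 2 - a t) * (fs t (x t) + φ (x t))
      + a t * (fs t (y t) + inner ℝ (Gb t) (z (t + 1) - y t) + φ (z (t + 1)))
      + L t / 2 * ‖z (t + 1) - z t‖ ^ 2 := by
    intro t
    -- The coupling of `x`, `y`, `z` is designed for this identity: the quadratic term carries
    -- `θ_t²`, which cancels against the weight `a_t²`.
    have e1 : x (t + 1) - y t = theta t • (z (t + 1) - z t) := by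
      rw [hxs, hy]; module
    have e2 : x (t + 1) - y t = (1 - theta t) • (x t - y t) + theta t • (z (t + 1) - y t) := by
      rw [hxs]; module
    have e3 : inner ℝ (Gb t) (x (t + 1) - y t) = (1 - theta t) * inner ℝ (Gb t) (x t - y t)
        + theta t * inner ℝ (Gb t) (z (t + 1) - y t) := by
      rw [e2, inner_add_right, inner_smul_right, inner_smul_right]
    have e4 : ‖x (t + 1) - y t‖ ^ 2 = theta t ^ 2 * ‖z (t + 1) - z t‖ ^ 2 := by
      rw [e1, norm_smul, mul_pow, Real.norm_eq_abs, sq_abs]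
    have h1 := hup t _ (hxX (t + 1))
    have h2 := hlow t _ (hxX t)
    have h3 : φ (x (t + 1)) ≤ (1 - theta t) * φ (x t) + theta t * φ (z (t + 1)) := by
      rw [hxs]
      exact hφ.2 (hxX t) (hz _) (by linarith [theta_le_one t]) (theta_pos t).le (by ring)
    have h4 : 0 ≤ 1 - theta t := by linarith [theta_le_one t]
    have h5 := mul_le_mul_of_nonneg_left h2 h4
    rw [e3, e4] at h1
    have h6 : fs t (x (t + 1)) + φ (x (t + 1)) ≤ (1 - theta t) * (fs t (x t) + φ (x t))
        + theta t * (fs t (y t) + inner ℝ (Gb t) (z (t + 1) - y t) + φ (z (t + 1)))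
        + L t / 2 * (theta t ^ 2 * ‖z (t + 1) - z t‖ ^ 2) := by linarith
    have h7 := mul_le_mul_of_nonneg_left h6 (sq_nonneg (a t))
    refine h7.trans (le_of_eq ?_)
    have := ha1 t
    have k1 : a t ^ 2 * (1 - theta t) = a t ^ 2 - a t := by
      linear_combination (-a t) * this
    have k2 : a t ^ 2 * theta t = a t := by linear_combination (a t) * this
    have k3 : a t ^ 2 * theta t ^ 2 = 1 := by
      linear_combination (a t * theta t + 1) * this
    linear_combination (fs t (x t) + φ (x t)) * k1
      + (fs t (y t) + inner ℝ (Gb t) (z (t + 1) - y t) + φ (z (t + 1))) * k2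
      + (L t / 2 * ‖z (t + 1) - z t‖ ^ 2) * k3
  -- `z (t + 1)` depends on the current noise. Writing it as `z t` plus an increment leaves the
  -- noise paired with a past iterate; Young's inequality absorbs the increment at the price of `‖G
  -- t - Gb t‖²`.
  have err : ∀ t, a t * (inner ℝ (Gb t) (z (t + 1) - y t)) - η t * a t / 2 * ‖z (t + 1) - z t‖ ^ 2
      ≤ a t * inner ℝ (G t) (z (t + 1)) - a t * inner ℝ (Gb t) (y t)
        - a t * inner ℝ (G t - Gb t) (z t) + a t / (2 * η t) * ‖G t - Gb t‖ ^ 2 := by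
    intro t
    have := inner_error_le (G t - Gb t) (z (t + 1) - z t) (hapos t) (hη t)
    simp only [inner_sub_left, inner_sub_right] at this ⊢
    linarith
  set Φ := fun t => dualAveragingObjective φ ψ L η G t
  have hΦ : ∀ t v, Φ t v = _ := dualAveragingObjective_eq hψ L η G
  -- The minimal value of the dual averaging objective serves as the potential; the comparison point
  -- enters only after the induction.
  have main : ∀ n, a n ^ 2 * (fs n (x (n + 1)) + φ (x (n + 1))) ≤
      Φ n (z (n + 1)) + 2 * (L 0 + η 0) * R ^ 2
      + ∑ t ∈ Finset.range (n + 1), (a t * fs t (y t) - a t * inner ℝ (Gb t) (y t)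
        - a t * inner ℝ (G t - Gb t) (z t) + a t / (2 * η t) * ‖G t - Gb t‖ ^ 2) := by
    intro n
    induction n with
    | zero =>
      have h1 := step 0
      have h2 := err 0
      have a0 : a 0 = 1 := by simp [ha, theta]
      -- `z 0` is arbitrary in `X` and minimizes nothing, so the first increment is paid for by the
      -- diameter. This is the origin of `2 * (L 0 + η 0) * R ^ 2`.
      have hR : ‖z 1 - z 0‖ ^ 2 ≤ 4 * R ^ 2 := by
        have := pow_le_pow_left₀ (norm_nonneg _) hz0 2
        nlinarith
      rw [hΦ]
      have b1 : 0 ≤ (L 1 + η 1 * (theta 1)⁻¹) * (1 / 2 * ‖z 1‖ ^ 2) :=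
        mul_nonneg (add_nonneg (hL 1) (mul_nonneg (hη 1).le (hapos 1).le)) (by positivity)
      have b2 : (L 0 + η 0) / 2 * ‖z 1 - z 0‖ ^ 2 ≤ (L 0 + η 0) / 2 * (4 * R ^ 2) :=
        mul_le_mul_of_nonneg_left hR (by linarith [hL 0, hη 0])
      have a0' : (theta 0)⁻¹ = 1 := a0
      simp only [zero_add, Finset.range_one, Finset.sum_singleton, a0, a0'] at h1 h2 ⊢
      linarith
    | succ n ih =>
      have h1 := step (n + 1)
      have h2 := err (n + 1)
      have h3 := hdec n _ (hxX (n + 1))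
      have h4 : (a (n + 1) ^ 2 - a (n + 1)) = a n ^ 2 := inv_theta_succ_sq n
      have h5 : a n ^ 2 * (fs (n + 1) (x (n + 1)) + φ (x (n + 1)))
          ≤ a n ^ 2 * (fs n (x (n + 1)) + φ (x (n + 1))) := by gcongr
      -- Growth of the previous objective around its minimizer `z (n + 1)`, tested at `z (n + 2)`.
      -- The gain has exactly the coefficient spent by `step` and `err` together.
      have h6 := quadratic_growth_of_isMinOn (convexOn_linearized hφ G (n + 1)) (hz (n + 1))
        (b := L (n + 1) + η (n + 1) * (theta (n + 1))⁻¹)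
        (by
          have := hmin n
          simp only [dualAveragingObjective_eq hψ, IsMinOn, IsMinFilter] at this ⊢
          exact this) (hz (n + 2))
      have h7 := mul_le_mul_of_nonneg_right (hmono (Nat.le_succ (n + 1)))
        (show 0 ≤ 1 / 2 * ‖z (n + 2)‖ ^ 2 by positivity)
      rw [hΦ] at ih ⊢
      rw [h4] at h1
      rw [Finset.sum_range_succ _ (n + 1), Finset.sum_range_succ _ (n + 1)]
      simp only [Nat.succ_eq_add_one] at h7
      change _ ≤ _ at h6
      have e : (theta (n + 1))⁻¹ = a (n + 1) := rfl
      have e' : (theta (n + 1 + 1))⁻¹ = a (n + 1 + 1) := rfl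
      simp only [show n + 2 = n + 1 + 1 from rfl, e, e'] at h1 h2 h6 h7 ih ⊢
      linarith
  have hm := main n
  have hopt : Φ n (z (n + 1)) ≤ Φ n xs := hmin n hxsX
  rw [hΦ n xs] at hopt
  -- After replacing the minimizer by `xs`, the linearizations at `y t` are bounded above by `fs t
  -- xs`, and the noise recombines into its pairing with `xs - z t`.
  have hsum : ∑ t ∈ Finset.range (n + 1), (a t * fs t (y t) - a t * inner ℝ (Gb t) (y t)
        - a t * inner ℝ (G t - Gb t) (z t) + a t / (2 * η t) * ‖G t - Gb t‖ ^ 2)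
      + ∑ t ∈ Finset.range (n + 1), a t * (inner ℝ (G t) xs + φ xs)
      ≤ ∑ t ∈ Finset.range (n + 1), a t * (fs t xs + φ xs)
      + ∑ t ∈ Finset.range (n + 1), a t * inner ℝ (G t - Gb t) (xs - z t)
      + ∑ t ∈ Finset.range (n + 1), a t / (2 * η t) * ‖G t - Gb t‖ ^ 2 := by
    rw [← Finset.sum_add_distrib, ← Finset.sum_add_distrib, ← Finset.sum_add_distrib]
    apply Finset.sum_le_sum
    intro t _
    have := mul_le_mul_of_nonneg_left (hlow t xs hxsX) (hapos t).le
    simp only [inner_sub_left, inner_sub_right] at this ⊢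
    linarith
  rw [hψ xs]
  linarith

end

/-! ### Integration over the unit ball -/

section
variable {d : ℕ}

local notation "𝔼" => EuclideanSpace ℝ (Fin d)

theorem volume_closedBall_ne_zero : volume (Metric.closedBall (0 : 𝔼) 1) ≠ 0 :=
  (Metric.measure_closedBall_pos volume _ one_pos).ne'

theorem volume_closedBall_ne_top : volume (Metric.closedBall (0 : 𝔼) 1) ≠ ⊤ :=
  (isCompact_closedBall _ _).measure_lt_top.ne

instance isProbabilityMeasure_uniformBall : IsProbabilityMeasure (uniformBall d) :=
  cond_isProbabilityMeasure_of_finite volume_closedBall_ne_zero volume_closedBall_ne_top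

theorem uniformBall_absolutelyContinuous : uniformBall d ≪ volume := by
  rw [uniformBall, ProbabilityTheory.cond]
  exact (Measure.smul_absolutelyContinuous).trans Measure.restrict_le_self.absolutelyContinuous

theorem ae_uniformBall_mem : ∀ᵐ z ∂uniformBall d, z ∈ Metric.closedBall (0 : 𝔼) 1 :=
  ae_cond_mem Metric.isClosed_closedBall.measurableSet

/-- The strict inequality puts the sampled points in the interior of `D`, where subgradients can be
tested in all directions. -/
theorem ae_uniformBall_norm_lt : ∀ᵐ z ∂uniformBall d, ‖z‖ < 1 := by
  have h : ∀ᵐ z ∂uniformBall d, z ∉ Metric.sphere (0 : 𝔼) 1 := by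
    refine uniformBall_absolutelyContinuous.ae_le ?_
    exact measure_eq_zero_iff_ae_notMem.1 (Measure.addHaar_sphere_of_ne_zero _ _ one_ne_zero)
  filter_upwards [h, ae_uniformBall_mem] with z h1 h2
  simp only [mem_sphere_iff_norm, sub_zero, Metric.mem_closedBall, dist_zero_right] at h1 h2
  exact lt_of_le_of_ne h2 h1

theorem integral_uniformBall (g : 𝔼 → ℝ) :
    ∫ z, g z ∂uniformBall d = (volume.real (Metric.closedBall (0 : 𝔼) 1))⁻¹ *
      ∫ z in Metric.closedBall 0 1, g z := by
  rw [uniformBall, ProbabilityTheory.cond, integral_smul_measure, ENNReal.toReal_inv]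
  rfl

theorem _root_.Continuous.integrable_uniformBall {g : 𝔼 → ℝ} (hg : Continuous g) :
    Integrable g (uniformBall d) := by
  rw [uniformBall, ProbabilityTheory.cond]
  exact (hg.continuousOn.integrableOn_compact (isCompact_closedBall _ _)).smul_measure
    (ENNReal.inv_ne_top.2 volume_closedBall_ne_zero)

theorem integral_uniformBall_neg (g : 𝔼 → ℝ) :
    ∫ z, g (-z) ∂uniformBall d = ∫ z, g z ∂uniformBall d := by
  rw [integral_uniformBall, integral_uniformBall]
  congr 1
  have := (Measure.measurePreserving_neg (volume : Measure 𝔼)).setIntegral_preimage_emb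
    (MeasurableEquiv.neg 𝔼).measurableEmbedding g (Metric.closedBall 0 1)
  simpa using this

/-! ### The spherical cutoff -/

/-- The radial function which is `1` on the ball of radius `1 - ε`, vanishes outside the unit ball
and is affine in the radius in between. -/
noncomputable def cutoff (ε : ℝ) (z : 𝔼) : ℝ := max 0 (min 1 (ε⁻¹ * (1 - ‖z‖)))

theorem cutoff_nonneg (ε : ℝ) (z : 𝔼) : 0 ≤ cutoff ε z := le_max_left _ _

theorem cutoff_le_one (ε : ℝ) (z : 𝔼) : cutoff ε z ≤ 1 := max_le zero_le_one (min_le_left _ _)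

theorem cutoff_eq_zero {ε : ℝ} (hε : 0 < ε) {z : 𝔼} (hz : 1 ≤ ‖z‖) : cutoff ε z = 0 := by
  refine max_eq_left ((min_le_right _ _).trans ?_)
  exact mul_nonpos_of_nonneg_of_nonpos (by positivity) (by linarith)

theorem cutoff_eq_one {ε : ℝ} (hε : 0 < ε) {z : 𝔼} (hz : ‖z‖ ≤ 1 - ε) : cutoff ε z = 1 := by
  have : 1 ≤ ε⁻¹ * (1 - ‖z‖) := by
    rw [← div_eq_inv_mul, le_div_iff₀ hε]; linarith
  rw [cutoff, min_eq_left this, max_eq_right zero_le_one]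

theorem cutoff_eq {ε : ℝ} (hε : 0 < ε) {z : 𝔼} (h1 : 1 - ε ≤ ‖z‖) (h2 : ‖z‖ ≤ 1) :
    cutoff ε z = ε⁻¹ * (1 - ‖z‖) := by
  have h3 : ε⁻¹ * (1 - ‖z‖) ≤ 1 := by
    rw [← div_eq_inv_mul, div_le_iff₀ hε]; linarith
  rw [cutoff, min_eq_right h3, max_eq_right]
  exact mul_nonneg (by positivity) (by linarith)

theorem lipschitzWith_cutoff {ε : ℝ} (hε : 0 < ε) :
    LipschitzWith (Real.toNNReal ε⁻¹) (cutoff ε : 𝔼 → ℝ) := by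
  have h : LipschitzWith (Real.toNNReal ε⁻¹) (fun z : 𝔼 => ε⁻¹ * (1 - ‖z‖)) := by
    refine LipschitzWith.of_dist_le_mul fun z w => ?_
    rw [Real.coe_toNNReal _ (by positivity), Real.dist_eq, ← mul_sub, abs_mul,
      abs_of_pos (inv_pos.2 hε), dist_eq_norm]
    gcongr
    rw [sub_sub_sub_cancel_left, abs_sub_comm]
    exact abs_norm_sub_norm_le z w
  exact (h.const_min 1).const_max 0

theorem hasCompactSupport_cutoff {ε : ℝ} (hε : 0 < ε) :
    HasCompactSupport (cutoff ε : 𝔼 → ℝ) := by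
  refine HasCompactSupport.intro (isCompact_closedBall (0 : 𝔼) 1) fun z hz => ?_
  simp only [Metric.mem_closedBall, dist_zero_right, not_le] at hz
  exact cutoff_eq_zero hε hz.le

theorem hasLineDerivAt_norm {z : 𝔼} (hz : z ≠ 0) (v : 𝔼) :
    HasLineDerivAt ℝ (fun w : 𝔼 => ‖w‖) (inner ℝ z v / ‖z‖) z v := by
  have h1 : HasDerivAt (fun t : ℝ => z + t • v) v 0 := by
    simpa using ((hasDerivAt_id (0 : ℝ)).smul_const v).const_add z
  have h2 := h1.norm_sq
  have h3 := h2.sqrt (by simpa using hz)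
  simp only [zero_smul, add_zero, Real.sqrt_sq (norm_nonneg _)] at h3
  rwa [mul_div_mul_left _ _ two_ne_zero] at h3

/-- The cutoff is locally constant off the annulus and has radial slope `-ε⁻¹` on it. The two
excluded spheres, where the formulas meet, are null sets. -/
theorem abs_lineDeriv_cutoff_le {ε : ℝ} (hε : 0 < ε) (hε1 : ε < 1) {z : 𝔼} (v : 𝔼)
    (h1 : ‖z‖ ≠ 1) (h2 : ‖z‖ ≠ 1 - ε) :
    |lineDeriv ℝ (cutoff ε) z v| ≤ ε⁻¹ *
      (Metric.closedBall 0 1 \ Metric.closedBall 0 (1 - ε)).indicator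
      (fun z : 𝔼 => |inner ℝ z v| / ‖z‖) z := by
  have hnorm : Filter.Tendsto (fun w : 𝔼 => ‖w‖) (nhds z) (nhds ‖z‖) := continuous_norm.tendsto z
  have hnn : 0 ≤ (Metric.closedBall 0 1 \ Metric.closedBall 0 (1 - ε)).indicator
      (fun z : 𝔼 => |inner ℝ z v| / ‖z‖) z :=
    Set.indicator_nonneg (fun _ _ => by positivity) _
  rcases lt_or_gt_of_ne h1 with h1 | h1
  · rcases lt_or_gt_of_ne h2 with h2 | h2
    · have : cutoff ε =ᶠ[nhds z] fun _ : 𝔼 => (1 : ℝ) := by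
        filter_upwards [hnorm.eventually (gt_mem_nhds h2)] with w hw using cutoff_eq_one hε hw.le
      rw [this.lineDeriv_eq]
      simpa [lineDeriv] using mul_nonneg (inv_pos.2 hε).le hnn
    · have hz0 : z ≠ 0 := by
        rintro rfl
        simp at h2; linarith
      have : cutoff ε =ᶠ[nhds z] fun w : 𝔼 => ε⁻¹ * (1 - ‖w‖) := by
        filter_upwards [hnorm.eventually (lt_mem_nhds h2), hnorm.eventually (gt_mem_nhds h1)]
          with w hw hw' using cutoff_eq hε hw.le hw'.le
      have hd : HasLineDerivAt ℝ (fun w : 𝔼 => ε⁻¹ * (1 - ‖w‖))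
          (ε⁻¹ * (-(inner ℝ z v / ‖z‖))) z v :=
        HasDerivAt.const_mul ε⁻¹ (HasDerivAt.const_sub 1 (hasLineDerivAt_norm hz0 v))
      rw [this.lineDeriv_eq, hd.lineDeriv, Set.indicator_of_mem, abs_mul, abs_neg, abs_div,
        abs_norm,
        abs_of_pos (inv_pos.2 hε)]
      simp [h1.le, h2]
  · have : cutoff ε =ᶠ[nhds z] fun _ : 𝔼 => (0 : ℝ) := by
      filter_upwards [hnorm.eventually (lt_mem_nhds h1)] with w hw using cutoff_eq_zero hε hw.le
    rw [this.lineDeriv_eq]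
    simpa [lineDeriv] using mul_nonneg (inv_pos.2 hε).le hnn

theorem measurable_inner_div_norm (v : 𝔼) : Measurable fun z : 𝔼 => inner ℝ z v / ‖z‖ := by
  fun_prop

theorem abs_inner_div_norm_le (z v : 𝔼) : |inner ℝ z v / ‖z‖| ≤ ‖v‖ := by
  rw [abs_div, abs_norm]
  rcases eq_or_ne z 0 with rfl | hz
  · simp
  · rw [div_le_iff₀ (norm_pos_iff.2 hz), mul_comm]
    exact abs_real_inner_le_norm z v

theorem integrableOn_of_abs_le {A : Set 𝔼} (hA : volume A ≠ ⊤) {h : 𝔼 → ℝ} (hm : Measurable h)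
    {C : ℝ} (hC : ∀ z, |h z| ≤ C) : IntegrableOn h A :=
  Measure.integrableOn_of_bounded hA hm.aestronglyMeasurable
    (Filter.Eventually.of_forall hC)

/-- Rotation invariance: the mean square of a coordinate of the direction is `1 / d`. -/
theorem integral_inner_div_norm_sq {A : Set 𝔼} (hAm : MeasurableSet A) (hA : volume A ≠ ⊤)
    (hA0 : (0 : 𝔼) ∉ A) (hrot : ∀ f : 𝔼 ≃ₗᵢ[ℝ] 𝔼, f ⁻¹' A = A) {e : 𝔼} (he : ‖e‖ = 1) :
    (d : ℝ) * ∫ z in A, (inner ℝ z e / ‖z‖) ^ 2 = volume.real A := by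
  have hint : ∀ e : 𝔼, IntegrableOn (fun z => (inner ℝ z e / ‖z‖) ^ 2) A := fun e =>
    integrableOn_of_abs_le hA ((measurable_inner_div_norm e).pow_const 2) (C := ‖e‖ ^ 2) fun z => by
      rw [abs_pow]; gcongr; exact abs_inner_div_norm_le z e
  have hinv : ∀ e' : 𝔼, ‖e'‖ = 1 →
      ∫ z in A, (inner ℝ z e' / ‖z‖) ^ 2 = ∫ z in A, (inner ℝ z e / ‖z‖) ^ 2 := by
    intro e' he'
    -- The reflection that exchanges the unit vectors `e` and `e'` preserves both `A` and volume.
    set ρ := (Submodule.span ℝ {e - e'})ᗮ.reflection with hρ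
    have hρe : ρ e = e' := Submodule.reflection_sub (by rw [he, he'])
    have := ρ.measurePreserving.setIntegral_preimage_emb
      ρ.toHomeomorph.measurableEmbedding (fun z => (inner ℝ z e' / ‖z‖) ^ 2) A
    rw [hrot] at this
    rw [← this]
    refine integral_congr_ae (Filter.Eventually.of_forall fun z => ?_)
    simp only [LinearIsometryEquiv.norm_map]
    rw [← hρe, LinearIsometryEquiv.inner_map_map]
  have hsum : ∑ i : Fin d, ∫ z in A, (inner ℝ z (EuclideanSpace.single i (1 : ℝ)) / ‖z‖) ^ 2
      = ∫ z in A, (1 : ℝ) := by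
    rw [← integral_finsetSum _ fun i _ => hint _]
    refine setIntegral_congr_fun hAm fun z hz => ?_
    have hz0 : z ≠ 0 := by rintro rfl; exact hA0 hz
    simp only [div_pow, ← Finset.sum_div]
    rw [div_eq_one_iff_eq (by positivity), EuclideanSpace.norm_sq_eq]
    refine Finset.sum_congr rfl fun i _ => ?_
    simp [EuclideanSpace.inner_single_right]
  rw [Finset.sum_congr rfl fun i _ => hinv _ (by simp)] at hsum
  simpa [Measure.real] using hsum

/-- Cauchy–Schwarz in pointwise form: `|w| ≤ (√d / 2) w² + 1 / (2 √d)`, balanced for a mean square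
of `1 / d`. -/
theorem integral_abs_inner_div_norm_le (hd : 1 ≤ d) {A : Set 𝔼} (hAm : MeasurableSet A)
    (hA : volume A ≠ ⊤) (hA0 : (0 : 𝔼) ∉ A) (hrot : ∀ f : 𝔼 ≃ₗᵢ[ℝ] 𝔼, f ⁻¹' A = A) (v : 𝔼) :
    ∫ z in A, |inner ℝ z v| / ‖z‖ ≤ ‖v‖ * volume.real A / √d := by
  rcases eq_or_ne v 0 with rfl | hv
  · simp
  have hvn : 0 < ‖v‖ := norm_pos_iff.2 hv
  have hd0 : (0 : ℝ) < √d := Real.sqrt_pos.2 (by exact_mod_cast hd)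
  have hdd : √(d : ℝ) * √d = d := Real.mul_self_sqrt (Nat.cast_nonneg d)
  set e : 𝔼 := ‖v‖⁻¹ • v with he_def
  have he : ‖e‖ = 1 := by rw [he_def, norm_smul, norm_inv, norm_norm, inv_mul_cancel₀ hvn.ne']
  have hsq := integral_inner_div_norm_sq hAm hA hA0 hrot he
  have hve : v = ‖v‖ • e := by rw [he_def, smul_smul, mul_inv_cancel₀ hvn.ne', one_smul]
  have hpt : ∀ z : 𝔼, |inner ℝ z v| / ‖z‖
      ≤ ‖v‖ * (√d / 2 * (inner ℝ z e / ‖z‖) ^ 2 + 1 / (2 * √d)) := by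
    intro z
    have h1 : |inner ℝ z v| / ‖z‖ = ‖v‖ * |inner ℝ z e / ‖z‖| := by
      conv_lhs => rw [hve]
      rw [inner_smul_right, abs_mul, abs_div, abs_norm, abs_norm]
      ring
    rw [h1]
    gcongr
    set w := inner ℝ z e / ‖z‖
    rw [← sq_abs w, ← sub_nonneg]
    have : √d / 2 * |w| ^ 2 + 1 / (2 * √d) - |w| = (√d * |w| - 1) ^ 2 / (2 * √d) := by
      field_simp; ring
    rw [this]; positivity
  have hint2 : IntegrableOn (fun z => (inner ℝ z e / ‖z‖) ^ 2) A :=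
    integrableOn_of_abs_le hA ((measurable_inner_div_norm e).pow_const 2) (C := ‖e‖ ^ 2) fun z => by
      rw [abs_pow]; gcongr; exact abs_inner_div_norm_le z e
  have hint1 : IntegrableOn (fun z : 𝔼 => |inner ℝ z v| / ‖z‖) A :=
    integrableOn_of_abs_le hA (by fun_prop) (C := ‖v‖) fun z => by
      simpa only [abs_div, abs_norm, abs_abs] using abs_inner_div_norm_le z v
  have hconst : IntegrableOn (fun _ : 𝔼 => 1 / (2 * √(d : ℝ))) A := integrableOn_const hA
  calc ∫ z in A, |inner ℝ z v| / ‖z‖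
      ≤ ∫ z in A, ‖v‖ * (√d / 2 * (inner ℝ z e / ‖z‖) ^ 2 + 1 / (2 * √d)) :=
        integral_mono hint1 (((hint2.const_mul _).add hconst).const_mul _) hpt
    _ = ‖v‖ * (√d / 2 * ∫ z in A, (inner ℝ z e / ‖z‖) ^ 2) + ‖v‖ * (volume.real A / (2 * √d)) := by
        rw [integral_const_mul, integral_add (hint2.const_mul _) hconst, integral_const_mul]
        simp [Measure.real]
        ring
    _ = ‖v‖ * volume.real A / √d := by
        rw [← hsq]
        generalize (∫ z in A, (inner ℝ z e / ‖z‖) ^ 2) = I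
        field_simp
        rw [show √(d : ℝ) ^ 2 = d by rw [sq, hdd]]
        ring

/-- Bernoulli's inequality `(1 - ε)^d ≥ 1 - d ε`. -/
theorem volume_annulus_le {ε : ℝ} (hε : 0 < ε) (hε1 : ε < 1) :
    volume.real (Metric.closedBall (0 : 𝔼) 1 \ Metric.closedBall 0 (1 - ε))
      ≤ ε * d * volume.real (Metric.closedBall (0 : 𝔼) 1) := by
  rw [measureReal_sdiff (Metric.closedBall_subset_closedBall (by linarith))
    Metric.isClosed_closedBall.measurableSet (isCompact_closedBall _ _).measure_lt_top.ne,
    Measure.addHaar_real_closedBall' _ _ (by linarith : 0 ≤ 1 - ε), finrank_euclideanSpace_fin]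
  have h := one_add_mul_le_pow (show (-2 : ℝ) ≤ -ε by linarith) d
  have h2 : 0 ≤ volume.real (Metric.closedBall (0 : 𝔼) 1) := measureReal_nonneg
  rw [← sub_eq_add_neg] at h
  nlinarith

/-- The slope `ε⁻¹` cancels the thickness `ε` of the annulus, and `d / √d = √d` remains, uniformly
in `ε`. This uniformity allows the cutoff to tend to the indicator of the ball. -/
theorem integral_abs_lineDeriv_cutoff_le (hd : 1 ≤ d) {ε : ℝ} (hε : 0 < ε) (hε1 : ε < 1) (v : 𝔼) :
    ∫ z, |lineDeriv ℝ (cutoff ε) z v| ≤ √d * ‖v‖ * volume.real (Metric.closedBall (0 : 𝔼) 1) := by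
  set A : Set 𝔼 := Metric.closedBall 0 1 \ Metric.closedBall 0 (1 - ε) with hA
  have hAm : MeasurableSet A :=
    Metric.isClosed_closedBall.measurableSet.diff Metric.isClosed_closedBall.measurableSet
  have hAt : volume A ≠ ⊤ := measure_ne_top_of_subset Set.sdiff_subset volume_closedBall_ne_top
  have hint : IntegrableOn (fun z : 𝔼 => |inner ℝ z v| / ‖z‖) A :=
    integrableOn_of_abs_le hAt (by fun_prop) (C := ‖v‖) fun z => by
      simpa only [abs_div, abs_norm, abs_abs] using abs_inner_div_norm_le z v
  have hae : ∀ᵐ z : 𝔼, |lineDeriv ℝ (cutoff ε) z v|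
      ≤ ε⁻¹ * A.indicator (fun z : 𝔼 => |inner ℝ z v| / ‖z‖) z := by
    have s1 : ∀ᵐ z : 𝔼, z ∉ Metric.sphere (0 : 𝔼) 1 :=
      measure_eq_zero_iff_ae_notMem.1 (Measure.addHaar_sphere_of_ne_zero _ _ one_ne_zero)
    have s2 : ∀ᵐ z : 𝔼, z ∉ Metric.sphere (0 : 𝔼) (1 - ε) :=
      measure_eq_zero_iff_ae_notMem.1 (Measure.addHaar_sphere_of_ne_zero _ _ (by linarith))
    filter_upwards [s1, s2] with z h1 h2
    exact abs_lineDeriv_cutoff_le hε hε1 v (by simpa using h1) (by simpa using h2)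
  have hd0 : (0 : ℝ) < √d := Real.sqrt_pos.2 (by exact_mod_cast hd)
  calc ∫ z, |lineDeriv ℝ (cutoff ε) z v|
      ≤ ∫ z, ε⁻¹ * A.indicator (fun z : 𝔼 => |inner ℝ z v| / ‖z‖) z := by
        refine integral_mono_of_nonneg (Filter.Eventually.of_forall fun _ => abs_nonneg _) ?_ hae
        exact ((integrable_indicator_iff hAm).2 hint).const_mul _
    _ = ε⁻¹ * ∫ z in A, |inner ℝ z v| / ‖z‖ := by
        rw [integral_const_mul, integral_indicator hAm]
    _ ≤ ε⁻¹ * (‖v‖ * volume.real A / √d) := by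
        gcongr
        refine integral_abs_inner_div_norm_le hd hAm hAt ?_ ?_ v
        · simp [hA]; linarith
        · intro f; ext z; simp [hA]
    _ ≤ ε⁻¹ * (‖v‖ * (ε * d * volume.real (Metric.closedBall (0 : 𝔼) 1)) / √d) := by
        gcongr
        exact volume_annulus_le hε hε1
    _ = _ := by
        have hdd : √(d : ℝ) ^ 2 = d := Real.sq_sqrt (Nat.cast_nonneg d)
        field_simp
        rw [hdd]
        ring

end

/-! ### Randomized smoothing of Lipschitz functions -/

section
variable {d : ℕ}

local notation "𝔼" => EuclideanSpace ℝ (Fin d)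

/-- The mean directional derivative of a bounded Lipschitz function over the unit ball is
controlled by the sup norm of the function. -/
theorem abs_integral_lineDeriv_le (hd : 1 ≤ d) {q : 𝔼 → ℝ} {K : NNReal} (hq : LipschitzWith K q)
    {M : ℝ} (hM : ∀ z, |q z| ≤ M) (v : 𝔼) :
    |∫ z, lineDeriv ℝ q z v ∂uniformBall d| ≤ M * (√d * ‖v‖) := by
  set V := volume.real (Metric.closedBall (0 : 𝔼) 1) with hV
  have hVpos : 0 < V :=
    ENNReal.toReal_pos volume_closedBall_ne_zero volume_closedBall_ne_top
  have hM0 : 0 ≤ M := (abs_nonneg _).trans (hM 0)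
  set ε : ℕ → ℝ := fun n => 1 / ((n : ℝ) + 2) with hε
  have hε0 : ∀ n, 0 < ε n := fun n => by positivity
  have hε1 : ∀ n, ε n < 1 := fun n => by
    rw [hε, div_lt_one (by positivity)]
    have : (0 : ℝ) ≤ n := Nat.cast_nonneg n
    linarith
  have hεlim : Filter.Tendsto ε Filter.atTop (nhds 0) := by
    have := (tendsto_one_div_add_atTop_nhds_zero_nat (𝕜 := ℝ)).comp (Filter.tendsto_add_atTop_nat 1)
    refine this.congr fun n => ?_
    simp only [hε, Function.comp]
    push_cast
    ring_nf
  -- Integration by parts moves the derivative onto the cutoff, so only the sup norm of `q` enters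
  -- and not its Lipschitz constant.
  have hbound : ∀ n, |∫ z, lineDeriv ℝ q z v * cutoff (ε n) z| ≤ M * (√d * ‖v‖) * V := by
    intro n
    have hL := lipschitzWith_cutoff (d := d) (hε0 n)
    rw [hq.integral_lineDeriv_mul_eq hL (hasCompactSupport_cutoff (hε0 n)) v]
    have hint : Integrable (fun z : 𝔼 => |lineDeriv ℝ (cutoff (ε n)) z (-v)|) := by
      refine Integrable.abs ?_
      have h1 : IntegrableOn (fun z : 𝔼 => lineDeriv ℝ (cutoff (ε n)) z (-v))
          (Metric.closedBall 0 1) :=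
        (hL.locallyIntegrable_lineDeriv (-v)).integrableOn_isCompact (isCompact_closedBall _ _)
      rw [← integrableOn_univ]
      refine (integrableOn_iff_integrable_of_support_subset ?_).1 h1 |>.integrableOn
      intro z hz
      by_contra hz'
      apply hz
      simp only [Metric.mem_closedBall, dist_zero_right, not_le] at hz'
      have : cutoff (ε n) =ᶠ[nhds z] fun _ : 𝔼 => (0 : ℝ) := by
        filter_upwards [(continuous_norm.tendsto z).eventually (lt_mem_nhds hz')] with w hw
          using cutoff_eq_zero (hε0 n) hw.le
      change lineDeriv ℝ (cutoff (ε n)) z (-v) = 0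
      rw [this.lineDeriv_eq]
      simp [lineDeriv]
    calc |∫ z, lineDeriv ℝ (cutoff (ε n)) z (-v) * q z|
        ≤ ∫ z, |lineDeriv ℝ (cutoff (ε n)) z (-v) * q z| := abs_integral_le_integral_abs
      _ ≤ ∫ z, |lineDeriv ℝ (cutoff (ε n)) z (-v)| * M := by
          refine integral_mono_of_nonneg (Filter.Eventually.of_forall fun _ => abs_nonneg _)
            (hint.mul_const _) (Filter.Eventually.of_forall fun z => ?_)
          simp only [abs_mul]
          gcongr
          exact hM z
      _ = (∫ z, |lineDeriv ℝ (cutoff (ε n)) z (-v)|) * M := integral_mul_const _ _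
      _ ≤ (√d * ‖-v‖ * V) * M := by
          gcongr
          exact integral_abs_lineDeriv_cutoff_le hd (hε0 n) (hε1 n) (-v)
      _ = _ := by rw [norm_neg]; ring
  -- Every cutoff vanishes on the unit sphere, so the pointwise limit is the indicator of the open
  -- ball; it differs from the closed one by a null set.
  have hlim : Filter.Tendsto (fun n => ∫ z, lineDeriv ℝ q z v * cutoff (ε n) z) Filter.atTop
      (nhds (∫ z, lineDeriv ℝ q z v * (Metric.ball (0 : 𝔼) 1).indicator 1 z)) := by
    refine tendsto_integral_of_dominated_convergence
      (fun z => (K * ‖v‖) * (Metric.closedBall (0 : 𝔼) 1).indicator 1 z) ?_ ?_ ?_ ?_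
    · intro n
      exact (aestronglyMeasurable_lineDeriv hq.continuous _).mul
        (lipschitzWith_cutoff (hε0 n)).continuous.aestronglyMeasurable
    · refine Integrable.const_mul ?_ _
      exact (integrable_indicator_iff Metric.isClosed_closedBall.measurableSet).2
        (integrableOn_const volume_closedBall_ne_top)
    · intro n
      refine Filter.Eventually.of_forall fun z => ?_
      rw [norm_mul]
      refine mul_le_mul (norm_lineDeriv_le_of_lipschitz ℝ hq) ?_ (norm_nonneg _) (by positivity)
      rw [Real.norm_of_nonneg (cutoff_nonneg _ _)]
      by_cases hz : z ∈ Metric.closedBall (0 : 𝔼) 1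
      · rw [Set.indicator_of_mem hz]; exact cutoff_le_one _ _
      · rw [Set.indicator_of_notMem hz, cutoff_eq_zero (hε0 n)]
        simp only [Metric.mem_closedBall, dist_zero_right, not_le] at hz
        exact hz.le
    · refine Filter.Eventually.of_forall fun z => Filter.Tendsto.const_mul _ ?_
      by_cases hz : z ∈ Metric.ball (0 : 𝔼) 1
      · rw [Set.indicator_of_mem hz]
        refine tendsto_const_nhds.congr' ?_
        have hz' : ‖z‖ < 1 := by simpa using hz
        filter_upwards [hεlim.eventually (gt_mem_nhds (show 0 < 1 - ‖z‖ by linarith))] with n hn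
        rw [cutoff_eq_one (hε0 n) (by linarith)]
        rfl
      · rw [Set.indicator_of_notMem hz]
        have hz' : 1 ≤ ‖z‖ := by simpa using hz
        simp only [cutoff_eq_zero (hε0 _) hz']
        exact tendsto_const_nhds
  have hfin := le_of_tendsto hlim.abs (Filter.Eventually.of_forall hbound)
  have heq : ∫ z, lineDeriv ℝ q z v * (Metric.ball (0 : 𝔼) 1).indicator 1 z
      = ∫ z in Metric.closedBall 0 1, lineDeriv ℝ q z v := by
    have h1 : ∀ z, lineDeriv ℝ q z v * (Metric.ball (0 : 𝔼) 1).indicator 1 z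
        = (Metric.ball (0 : 𝔼) 1).indicator (fun z => lineDeriv ℝ q z v) z := by
      intro z
      by_cases hz : z ∈ Metric.ball (0 : 𝔼) 1
      · simp only [Set.indicator_of_mem hz, Pi.one_apply, mul_one]
      · simp only [Set.indicator_of_notMem hz, mul_zero]
    simp only [h1]
    rw [integral_indicator Metric.isOpen_ball.measurableSet]
    refine setIntegral_congr_set ?_
    have := Measure.addHaar_sphere_of_ne_zero volume (0 : 𝔼) one_ne_zero
    rw [← Metric.ball_union_sphere]
    exact (union_ae_eq_left_of_ae_eq_empty (ae_eq_empty.2 this)).symm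
  rw [heq] at hfin
  rw [integral_uniformBall, abs_mul, abs_of_pos (inv_pos.2 hVpos), ← div_eq_inv_mul,
    div_le_iff₀ hVpos]
  exact hfin

/-- The smoothed function `x ↦ E[f(x + u Z)]`, where `Z` is uniform on the unit ball. -/
noncomputable def smoothed (f : 𝔼 → ℝ) (u : ℝ) (x : 𝔼) : ℝ :=
  ∫ z, f (x + u • z) ∂uniformBall d

/-- The directional derivative of the smoothed function. -/
noncomputable def smoothedDeriv (f : 𝔼 → ℝ) (u : ℝ) (x v : 𝔼) : ℝ :=
  ∫ z, lineDeriv ℝ f (x + u • z) v ∂uniformBall d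

theorem integrable_comp_add_smul {f : 𝔼 → ℝ} (hf : Continuous f) (u : ℝ) (x : 𝔼) :
    Integrable (fun z => f (x + u • z)) (uniformBall d) :=
  Continuous.integrable_uniformBall (by fun_prop)

theorem ae_comp_add_smul {p : 𝔼 → Prop} (hp : ∀ᵐ w : 𝔼, p w) {u : ℝ} (hu : u ≠ 0) (x : 𝔼) :
    ∀ᵐ z ∂uniformBall d, p (x + u • z) := by
  refine uniformBall_absolutelyContinuous.ae_le ?_
  have h1 : Measure.QuasiMeasurePreserving (fun z : 𝔼 => u • z) :=
    Measure.quasiMeasurePreserving_smul volume hu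
  have h2 : Measure.QuasiMeasurePreserving (fun z : 𝔼 => x + z) :=
    (measurePreserving_add_left volume x).quasiMeasurePreserving
  exact (h2.comp h1).ae hp

/-- The point `x + u z` is a convex combination of `x ± u' z` with weights `(1 ± u/u')/2`, and `z`,
`-z` have the same law. The value `u = 0` is allowed and yields `f ≤ smoothed f u'`. -/
theorem le_smoothed_of_convexOn {f : 𝔼 → ℝ} (hf : Continuous f) {X : Set 𝔼} {u u' : ℝ}
    (hu : 0 ≤ u) (huu : u ≤ u') (hu' : 0 < u')
    (hconv : ConvexOn ℝ (X + Metric.closedBall 0 u') f) {x : 𝔼} (hx : x ∈ X) :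
    smoothed f u x ≤ smoothed f u' x := by
  set c := (1 + u / u') / 2 with hc
  have hr : u / u' ≤ 1 := (div_le_one hu').2 huu
  have hr0 : 0 ≤ u / u' := by positivity
  have h2 : smoothed f u' x = ∫ z, c * f (x + u' • z) + (1 - c) * f (x + u' • (-z))
      ∂uniformBall d := by
    rw [integral_add ((integrable_comp_add_smul hf u' x).const_mul _)
      (Integrable.const_mul (Continuous.integrable_uniformBall (by fun_prop)) _),
      integral_const_mul, integral_const_mul,
      integral_uniformBall_neg (fun z => f (x + u' • z)), smoothed]
    ring
  rw [h2, smoothed]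
  refine integral_mono_ae (integrable_comp_add_smul hf u x)
    (((integrable_comp_add_smul hf u' x).const_mul _).add
      (Integrable.const_mul (Continuous.integrable_uniformBall (by fun_prop)) _)) ?_
  filter_upwards [ae_uniformBall_mem] with z hz
  simp only [Metric.mem_closedBall, dist_zero_right] at hz
  have hm : ‖u' • z‖ ≤ u' := by
    rw [norm_smul, Real.norm_of_nonneg hu'.le]; nlinarith
  have m1 : x + u' • z ∈ X + Metric.closedBall 0 u' :=
    Set.add_mem_add hx (by simpa using hm)
  have m2 : x + u' • (-z) ∈ X + Metric.closedBall 0 u' :=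
    Set.add_mem_add hx (by simpa using hm)
  have := hconv.2 m1 m2 (show 0 ≤ c by positivity) (show 0 ≤ 1 - c by rw [hc]; linarith) (by ring)
  have e : c • (x + u' • z) + (1 - c) • (x + u' • (-z)) = x + u • z := by
    have : (2 * c - 1) * u' = u := by rw [hc]; field_simp; ring
    rw [← this]; module
  rw [e] at this
  exact this

theorem smoothed_zero (f : 𝔼 → ℝ) (x : 𝔼) : smoothed f 0 x = f x := by
  simp [smoothed]

theorem smoothed_le_add {f : 𝔼 → ℝ} {K : NNReal} (hf : LipschitzWith K f) {u : ℝ} (hu : 0 ≤ u)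
    (x : 𝔼) : smoothed f u x ≤ f x + K * u := by
  have : smoothed f u x ≤ ∫ _ : 𝔼, f x + K * u ∂uniformBall d := by
    refine integral_mono_ae (integrable_comp_add_smul hf.continuous u x) (integrable_const _) ?_
    filter_upwards [ae_uniformBall_mem] with z hz
    simp only [Metric.mem_closedBall, dist_zero_right] at hz
    have h1 := hf.dist_le_mul (x + u • z) x
    rw [Real.dist_eq, dist_eq_norm, add_sub_cancel_left, norm_smul, Real.norm_of_nonneg hu] at h1
    have h2 : (K : ℝ) * (u * ‖z‖) ≤ K * u := by
      refine mul_le_mul_of_nonneg_left ?_ K.2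
      nlinarith
    linarith [le_abs_self (f (x + u • z) - f x)]
  simpa using this

theorem convexOn_smoothed {f : 𝔼 → ℝ} (hf : Continuous f) {X : Set 𝔼} {u : ℝ} (hu : 0 ≤ u)
    (hX : Convex ℝ X) (hconv : ConvexOn ℝ (X + Metric.closedBall 0 u) f) :
    ConvexOn ℝ X (smoothed f u) := by
  refine ⟨hX, fun x hx y hy a b ha hb hab => ?_⟩
  simp only [smoothed, smul_eq_mul]
  rw [← integral_const_mul, ← integral_const_mul, ← integral_add
    ((integrable_comp_add_smul hf u x).const_mul _) ((integrable_comp_add_smul hf u y).const_mul _)]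
  refine integral_mono_ae (integrable_comp_add_smul hf u _)
    (((integrable_comp_add_smul hf u x).const_mul _).add
      ((integrable_comp_add_smul hf u y).const_mul _)) ?_
  filter_upwards [ae_uniformBall_mem] with z hz
  simp only [Metric.mem_closedBall, dist_zero_right] at hz
  have hm : u • z ∈ Metric.closedBall (0 : 𝔼) u := by
    rw [Metric.mem_closedBall, dist_zero_right, norm_smul, Real.norm_of_nonneg hu]; nlinarith
  have := hconv.2 (Set.add_mem_add hx hm) (Set.add_mem_add hy hm) ha hb hab
  have e : a • (x + u • z) + b • (y + u • z) = a • x + b • y + u • z := by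
    obtain rfl : b = 1 - a := by linarith
    module
  rw [e] at this
  exact this

/-- Differentiation under the integral, dominated by `K ‖v‖`. For `u ≠ 0` the shifted and scaled
ball misses the null set where the line derivative of `f` fails to exist. -/
theorem hasLineDerivAt_smoothed {f : 𝔼 → ℝ} {K : NNReal} (hf : LipschitzWith K f) {u : ℝ}
    (hu : u ≠ 0) (x v : 𝔼) :
    HasLineDerivAt ℝ (smoothed f u) (smoothedDeriv f u x v) x v := by
  have h := hasDerivAt_integral_of_dominated_loc_of_lip (μ := uniformBall d) (𝕜 := ℝ)
    (F := fun (t : ℝ) z => f (x + t • v + u • z)) (F' := fun z => lineDeriv ℝ f (x + u • z) v)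
    (x₀ := 0) (bound := fun _ => (K : ℝ) * ‖v‖) Filter.univ_mem ?_ ?_ ?_ ?_ ?_ ?_
  · exact h.2
  · exact Filter.Eventually.of_forall fun t =>
      (integrable_comp_add_smul hf.continuous u _).aestronglyMeasurable
  · exact integrable_comp_add_smul hf.continuous u _
  · exact ((measurable_lineDeriv hf.continuous).comp (by fun_prop)).aestronglyMeasurable
  · refine Filter.Eventually.of_forall fun z => LipschitzOnWith.of_dist_le_mul fun s _ t _ => ?_
    refine (hf.dist_le_mul _ _).trans (le_of_eq ?_)
    rw [dist_add_right, dist_add_left, dist_eq_norm, ← sub_smul, norm_smul, Real.coe_nnabs,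
      abs_of_nonneg (by positivity), ← dist_eq_norm]
    ring
  · exact integrable_const _
  · filter_upwards [ae_comp_add_smul (hf.ae_lineDifferentiableAt (μ := volume) v) hu x] with z hz
    have := hz.hasLineDerivAt
    simp only [HasLineDerivAt] at this
    refine this.congr_of_eventuallyEq (Filter.Eventually.of_forall fun t => ?_)
    simp only [add_right_comm]

/-- The difference of derivatives is itself the mean derivative, in the noise variable, of `q z = (f
(x + u z) - f (y + u z)) / u`, which is bounded by `K ‖x - y‖ / u`. -/
theorem abs_smoothedDeriv_sub_le (hd : 1 ≤ d) {f : 𝔼 → ℝ} {K : NNReal} (hf : LipschitzWith K f)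
    {u : ℝ} (hu : 0 < u) (x y v : 𝔼) :
    |smoothedDeriv f u x v - smoothedDeriv f u y v| ≤ K * √d / u * (‖x - y‖ * ‖v‖) := by
  set q : 𝔼 → ℝ := fun z => u⁻¹ * (f (x + u • z) - f (y + u • z)) with hq
  have hsc : ∀ x : 𝔼, LipschitzWith (K * Real.toNNReal u) fun z : 𝔼 => f (x + u • z) := by
    intro x
    refine LipschitzWith.of_dist_le_mul fun z w => (hf.dist_le_mul _ _).trans (le_of_eq ?_)
    rw [dist_add_left, dist_eq_norm, dist_eq_norm, ← smul_sub, norm_smul, Real.norm_of_nonneg hu.le,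
      NNReal.coe_mul, Real.coe_toNNReal _ hu.le]
    ring
  obtain ⟨C, hqL⟩ : ∃ C, LipschitzWith C q :=
    ⟨_, (lipschitzWith_smul u⁻¹).comp ((hsc x).sub (hsc y))⟩
  have hM : ∀ z, |q z| ≤ u⁻¹ * (K * ‖x - y‖) := by
    intro z
    rw [hq, abs_mul, abs_of_pos (inv_pos.2 hu)]
    gcongr
    have := hf.dist_le_mul (x + u • z) (y + u • z)
    rwa [dist_add_right, dist_eq_norm x y, Real.dist_eq] at this
  have hder : ∀ᵐ z ∂uniformBall d, lineDeriv ℝ q z v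
      = lineDeriv ℝ f (x + u • z) v - lineDeriv ℝ f (y + u • z) v := by
    filter_upwards [ae_comp_add_smul (hf.ae_lineDifferentiableAt (μ := volume) v) hu.ne' x,
      ae_comp_add_smul (hf.ae_lineDifferentiableAt (μ := volume) v) hu.ne' y] with z hx hy
    have hs : ∀ x : 𝔼, LineDifferentiableAt ℝ f (x + u • z) v →
        HasDerivAt (fun t : ℝ => f (x + u • (z + t • v))) (u * lineDeriv ℝ f (x + u • z) v) 0 := by
      intro x hx
      have h1 : HasDerivAt (fun t : ℝ => f (x + u • z + t • v)) (lineDeriv ℝ f (x + u • z) v)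
          (u * 0) := by rw [mul_zero]; exact hx.hasLineDerivAt
      have h2 : HasDerivAt (fun t : ℝ => u * t) u 0 := by
        simpa using (hasDerivAt_id (0 : ℝ)).const_mul u
      have h3 := h1.comp (0 : ℝ) h2
      rw [mul_comm] at h3
      refine h3.congr_of_eventuallyEq (Filter.Eventually.of_forall fun t => ?_)
      simp only [Function.comp, smul_add, smul_smul, add_assoc]
    have h4 := ((hs x hx).sub (hs y hy)).const_mul u⁻¹
    have h5 : HasLineDerivAt ℝ q
        (u⁻¹ * (u * lineDeriv ℝ f (x + u • z) v - u * lineDeriv ℝ f (y + u • z) v)) z v := h4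
    rw [h5.lineDeriv, ← mul_sub, inv_mul_cancel_left₀ hu.ne']
  have hint : ∀ x : 𝔼, Integrable (fun z => lineDeriv ℝ f (x + u • z) v) (uniformBall d) := by
    intro x
    refine Integrable.of_bound
      ((measurable_lineDeriv hf.continuous).comp (by fun_prop)).aestronglyMeasurable (K * ‖v‖) ?_
    exact Filter.Eventually.of_forall fun z => norm_lineDeriv_le_of_lipschitz ℝ hf
  have := abs_integral_lineDeriv_le hd hqL hM v
  rw [integral_congr_ae hder, integral_sub (hint x) (hint y)] at this
  refine this.trans (le_of_eq ?_)
  ring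

/-- The smoothed function has a Lipschitz gradient, with constant `K √d / u`. -/
theorem smoothed_add_le (hd : 1 ≤ d) {f : 𝔼 → ℝ} {K : NNReal} (hf : LipschitzWith K f)
    {u : ℝ} (hu : 0 < u) (x v : 𝔼) :
    smoothed f u (x + v)
      ≤ smoothed f u x + smoothedDeriv f u x v + K * √d / u / 2 * ‖v‖ ^ 2 := by
  set b := K * √d / u with hb
  set h : ℝ → ℝ := fun t => smoothed f u (x + t • v) - t * smoothedDeriv f u x v
    - b / 2 * ‖v‖ ^ 2 * t ^ 2 with hh
  have hder : ∀ t, HasDerivAt h (smoothedDeriv f u (x + t • v) v - smoothedDeriv f u x v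
      - b / 2 * ‖v‖ ^ 2 * (2 * t)) t := by
    intro t
    have h1 : HasDerivAt (fun t : ℝ => smoothed f u (x + t • v))
        (smoothedDeriv f u (x + t • v) v) t := by
      have h0 := hasLineDerivAt_smoothed hf hu.ne' (x + t • v) v
      have h2 : HasDerivAt (fun s : ℝ => smoothed f u (x + t • v + s • v))
        (smoothedDeriv f u (x + t • v) v) (t - t) := by rw [sub_self]; exact h0
      have h3 := h2.comp_sub_const t t
      refine h3.congr_of_eventuallyEq (Filter.Eventually.of_forall fun s => ?_)
      simp only [show x + t • v + (s - t) • v = x + s • v by module]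
    have h4 := (h1.sub ((hasDerivAt_id t).mul_const (smoothedDeriv f u x v))).sub
      ((hasDerivAt_pow 2 t).const_mul (b / 2 * ‖v‖ ^ 2))
    exact h4.congr_deriv (by simp)
  -- `h` is the Taylor remainder along the segment; its derivative at `t` is at most `b t ‖v‖² - b t
  -- ‖v‖² = 0`.
  have hanti : AntitoneOn h (Set.Icc 0 1) := by
    refine antitoneOn_of_deriv_nonpos (convex_Icc 0 1)
      (fun t _ => (hder t).continuousAt.continuousWithinAt)
      (fun t _ => (hder t).differentiableAt.differentiableWithinAt) fun t ht => ?_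
    rw [interior_Icc] at ht
    rw [(hder t).deriv]
    have := abs_smoothedDeriv_sub_le hd hf hu (x + t • v) x v
    rw [add_sub_cancel_left, norm_smul, Real.norm_of_nonneg ht.1.le, ← hb] at this
    have h6 := le_abs_self (smoothedDeriv f u (x + t • v) v - smoothedDeriv f u x v)
    nlinarith
  have := hanti (Set.left_mem_Icc.2 zero_le_one) (Set.right_mem_Icc.2 zero_le_one) zero_le_one
  simp only [hh, one_smul, zero_smul, add_zero] at this
  linarith

/-- The first-order lower bound for the smoothed function. -/
theorem smoothed_add_smoothedDeriv_le {f : 𝔼 → ℝ} {K : NNReal} (hf : LipschitzWith K f)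
    {X : Set 𝔼} {u : ℝ} (hu : 0 < u) (hX : Convex ℝ X)
    (hconv : ConvexOn ℝ (X + Metric.closedBall 0 u) f) {x y : 𝔼} (hx : x ∈ X) (hy : y ∈ X) :
    smoothed f u y + smoothedDeriv f u y (x - y) ≤ smoothed f u x := by
  have hc := convexOn_smoothed hf.continuous hu.le hX hconv
  have ht := (hasLineDerivAt_smoothed hf hu.ne' y (x - y)).tendsto_slope_zero_right
  have : smoothedDeriv f u y (x - y) ≤ smoothed f u x - smoothed f u y := by
    refine le_of_tendsto ht ?_
    filter_upwards [Ioo_mem_nhdsGT (zero_lt_one (α := ℝ))] with t ht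
    have h1 := hc.2 hy hx (show 0 ≤ 1 - t by linarith [ht.2]) ht.1.le (by ring)
    have e : (1 - t) • y + t • x = y + t • (x - y) := by module
    rw [e] at h1
    simp only [smul_eq_mul] at h1 ⊢
    rw [← div_eq_inv_mul, div_le_iff₀ ht.1]
    linarith
  linarith

end

/-! ### Jointly measurable Lipschitz extensions and their gradients -/

section
variable {Ξ : Type*} [MeasurableSpace Ξ]

/-- A random function that is Lipschitz on a set agrees almost surely with a jointly measurable
one that is Lipschitz on the whole space. -/
theorem exists_lipschitzWith_extension {E : Type*} [NormedAddCommGroup E]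
    [SecondCountableTopology E] {P : Measure Ξ} {D : Set E}
    (hD : D.Nonempty) {F : E → Ξ → ℝ} {K : NNReal}
    (hFm : ∀ x ∈ D, AEStronglyMeasurable (F x) P)
    (hFlip : ∀ᵐ s ∂P, ∀ x ∈ D, ∀ y ∈ D, |F x s - F y s| ≤ K * ‖x - y‖) :
    ∃ F' : E → Ξ → ℝ, (∀ x, Measurable (F' x)) ∧ (∀ s, LipschitzWith K fun x => F' x s) ∧
      ∀ᵐ s ∂P, ∀ x ∈ D, F' x s = F x s := by
  classical
  have : Nonempty D := hD.to_subtype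
  set q : ℕ → D := TopologicalSpace.denseSeq D with hq
  have hqd : DenseRange q := TopologicalSpace.denseRange_denseSeq D
  set h : ℕ → Ξ → ℝ := fun n => (hFm (q n) (q n).2).mk (F (q n)) with hh
  have hhm : ∀ n, Measurable (h n) := fun n => (hFm (q n) (q n).2).stronglyMeasurable_mk.measurable
  have hhF : ∀ᵐ s ∂P, ∀ n, F (q n) s = h n s :=
    ae_all_iff.2 fun n => (hFm (q n) (q n).2).ae_eq_mk
  -- Countably many conditions on measurable representatives: a measurable set of full measure.
  set S : Set Ξ := {s | ∀ n k, |h n s - h k s| ≤ K * ‖(q n : E) - q k‖} with hS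
  have hSm : MeasurableSet S := by
    have : S = ⋂ n, ⋂ k, {s | |h n s - h k s| ≤ K * ‖(q n : E) - q k‖} := by
      ext s; simp [hS]
    rw [this]
    exact MeasurableSet.iInter fun n => MeasurableSet.iInter fun k =>
      measurableSet_le (by have := hhm n; have := hhm k; fun_prop) measurable_const
  have hSae : ∀ᵐ s ∂P, s ∈ S := by
    filter_upwards [hhF, hFlip] with s h1 h2 n k
    rw [← h1, ← h1]
    exact h2 _ (q n).2 _ (q k).2
  have hbdd : ∀ s ∈ S, ∀ p : E, ∀ n, h 0 s - K * ‖p - q 0‖ ≤ h n s + K * ‖p - q n‖ := by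
    intro s hs p n
    have h1 := hs 0 n
    have h2 : ‖(q 0 : E) - q n‖ ≤ ‖p - q 0‖ + ‖p - q n‖ := by
      rw [← norm_sub_rev (q 0 : E) p]
      exact norm_sub_le_norm_sub_add_norm_sub _ _ _
    have h3 := mul_le_mul_of_nonneg_left h2 K.2
    have := le_abs_self (h 0 s - h n s)
    have e : (K : ℝ) = K.1 := rfl
    rw [← e, mul_add] at h3
    linarith
  have hBB : ∀ s ∈ S, ∀ p : E, BddBelow (Set.range fun n => h n s + K * ‖p - q n‖) := by
    rintro s hs p
    refine ⟨h 0 s - K * ‖p - q 0‖, ?_⟩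
    rintro _ ⟨n, rfl⟩
    exact hbdd s hs p n
  -- McShane's extension from a dense sequence of `D`: a countable infimum stays measurable in `s`.
  -- The value `0` off `S` makes the Lipschitz bound hold for every `s`.
  set F' : E → Ξ → ℝ := fun p s => if s ∈ S then ⨅ n, (h n s + K * ‖p - q n‖) else 0 with hF'
  have hlip : ∀ s, LipschitzWith K fun x => F' x s := by
    intro s
    by_cases hs : s ∈ S
    · simp only [hF', if_pos hs]
      refine LipschitzWith.of_le_add_mul K fun x y => ?_
      rw [← sub_le_iff_le_add]
      refine le_ciInf fun n => ?_
      rw [sub_le_iff_le_add]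
      refine (ciInf_le (hBB s hs x) n).trans ?_
      have : ‖x - q n‖ ≤ ‖y - q n‖ + dist x y := by
        rw [dist_eq_norm, add_comm]; exact norm_sub_le_norm_sub_add_norm_sub _ _ _
      have := mul_le_mul_of_nonneg_left this K.2
      have e : (K : ℝ) = K.1 := rfl
      rw [← e, mul_add] at this
      linarith
    · simp only [hF', if_neg hs]
      exact LipschitzWith.const' 0
  have hq' : ∀ s ∈ S, ∀ k, F' (q k) s = h k s := by
    intro s hs k
    simp only [hF', if_pos hs]
    refine le_antisymm ((ciInf_le (hBB s hs _) k).trans (by simp)) (le_ciInf fun n => ?_)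
    have := hs k n
    linarith [le_abs_self (h k s - h n s)]
  refine ⟨F', fun x => ?_, hlip, ?_⟩
  · refine Measurable.ite hSm (Measurable.iInf fun n => ?_) measurable_const
    exact (hhm n).add_const _
  · filter_upwards [hSae, hhF, hFlip] with s h1 h2 h3 x hx
    have c1 : Continuous fun x : D => F' x s := (hlip s).continuous.comp continuous_subtype_val
    have c2 : Continuous fun x : D => F x s := by
      refine LipschitzWith.continuous (K := K) (LipschitzWith.of_dist_le_mul fun x y => ?_)
      rw [Subtype.dist_eq, dist_eq_norm, dist_eq_norm]
      exact h3 _ x.2 _ y.2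
    have := hqd.equalizer c1 c2 (by
      ext n
      simp only [Function.comp]
      rw [h2 n, hq' s h1])
    exact congrFun this ⟨x, hx⟩

variable {d : ℕ}

local notation "𝔼" => EuclideanSpace ℝ (Fin d)

/-- The difference quotients of `F (·; s)` at `p` in the direction `v`. -/
noncomputable def diffQuot (F : 𝔼 → Ξ → ℝ) (v : 𝔼) (n : ℕ) (w : 𝔼 × Ξ) : ℝ :=
  ((n : ℝ) + 1) * (F (w.1 + ((n : ℝ) + 1)⁻¹ • v) w.2 - F w.1 w.2)

/-- `G` is a gradient of `F (·; s)` at almost every point. -/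
structure IsAEGradient (F : 𝔼 → Ξ → ℝ) (K : NNReal) (G : 𝔼 × Ξ → 𝔼) : Prop where
  meas : ∀ x, Measurable (F x)
  lip : ∀ s, LipschitzWith K fun x => F x s
  meas_grad : Measurable G
  norm_le : ∀ w, ‖G w‖ ≤ K
  tendsto : ∀ s v, ∀ᵐ p, Filter.Tendsto (fun n => diffQuot F v n (p, s)) Filter.atTop
    (nhds (inner ℝ (G (p, s)) v))

theorem measurable_uncurry_of_lipschitzWith {F : 𝔼 → Ξ → ℝ} {K : NNReal}
    (hm : ∀ x, Measurable (F x)) (hl : ∀ s, LipschitzWith K fun x => F x s) :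
    Measurable fun w : 𝔼 × Ξ => F w.1 w.2 :=
  measurable_uncurry_of_continuous_of_measurable (u := F) (fun s => (hl s).continuous) hm

theorem measurable_diffQuot {F : 𝔼 → Ξ → ℝ} {K : NNReal}
    (hm : ∀ x, Measurable (F x)) (hl : ∀ s, LipschitzWith K fun x => F x s) (v : 𝔼) (n : ℕ) :
    Measurable (diffQuot F v n) := by
  have h := measurable_uncurry_of_lipschitzWith hm hl
  have h2 : Measurable fun w : 𝔼 × Ξ => (w.1 + ((n : ℝ) + 1)⁻¹ • v, w.2) := by fun_prop
  exact ((h.comp h2).sub h).const_mul _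

theorem abs_diffQuot_le {Ξ : Type*} {F : 𝔼 → Ξ → ℝ} {K : NNReal}
    (hl : ∀ s, LipschitzWith K fun x => F x s)
    (v : 𝔼) (n : ℕ) (w : 𝔼 × Ξ) : |diffQuot F v n w| ≤ K * ‖v‖ := by
  have h := (hl w.2).dist_le_mul (w.1 + ((n : ℝ) + 1)⁻¹ • v) w.1
  have hn : (0 : ℝ) < (n : ℝ) + 1 := by positivity
  rw [Real.dist_eq, dist_eq_norm, add_sub_cancel_left, norm_smul, Real.norm_of_nonneg
    (inv_nonneg.2 hn.le)] at h
  rw [diffQuot, abs_mul, abs_of_pos hn]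
  calc _ ≤ ((n : ℝ) + 1) * (K * (((n : ℝ) + 1)⁻¹ * ‖v‖)) := by gcongr
    _ = _ := by field_simp

theorem tendsto_diffQuot_of_hasLineDerivAt {f : 𝔼 → ℝ} {f' : ℝ} {p v : 𝔼}
    (h : HasLineDerivAt ℝ f f' p v) :
    Filter.Tendsto (fun n : ℕ => ((n : ℝ) + 1) * (f (p + ((n : ℝ) + 1)⁻¹ • v) - f p)) Filter.atTop
      (nhds f') := by
  have h0 : Filter.Tendsto (fun n : ℕ => ((n : ℝ) + 1)⁻¹) Filter.atTop
      (nhdsWithin 0 (Set.Ioi 0)) := by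
    refine tendsto_nhdsWithin_iff.2 ⟨?_, Filter.Eventually.of_forall fun n => ?_⟩
    · simpa using tendsto_one_div_add_atTop_nhds_zero_nat (𝕜 := ℝ)
    · exact inv_pos.2 (show (0 : ℝ) < (n : ℝ) + 1 by positivity)
  simpa [Function.comp_def] using h.tendsto_slope_zero_right.comp h0

/-- Coordinatewise limits of difference quotients are jointly measurable in the point and the
sample. They agree with the gradient at points of differentiability, which are almost all by
Rademacher's theorem. Resetting the field to `0` where its norm exceeds `K` makes the bound hold
everywhere without altering it there. -/
theorem exists_isAEGradient {F : 𝔼 → Ξ → ℝ} {K : NNReal}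
    (hm : ∀ x, Measurable (F x)) (hl : ∀ s, LipschitzWith K fun x => F x s) :
    ∃ G, IsAEGradient F K G := by
  classical
  set e : Fin d → 𝔼 := fun j => EuclideanSpace.single j 1
  set c : Fin d → 𝔼 × Ξ → ℝ := fun j w =>
    Filter.limUnder Filter.atTop fun n => diffQuot F (e j) n w
  set W : 𝔼 × Ξ → 𝔼 := fun w => ∑ j, c j w • e j with hW
  have hc : ∀ j, Measurable (c j) := fun j =>
    (StronglyMeasurable.limUnder fun n =>
      (measurable_diffQuot hm hl (e j) n).stronglyMeasurable).measurable
  have hWm : Measurable W := Finset.measurable_sum _ fun j _ => (hc j).smul_const _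
  refine ⟨fun w => if ‖W w‖ ≤ K then W w else 0, hm, hl, ?_, ?_, ?_⟩
  · exact Measurable.ite (measurableSet_le hWm.norm measurable_const) hWm measurable_const
  · intro w
    split_ifs with h
    · exact h
    · simp
  · intro s v
    filter_upwards [(hl s).ae_differentiableAt (μ := volume)] with p hp
    have hlim : ∀ v, Filter.Tendsto (fun n => diffQuot F v n (p, s)) Filter.atTop
        (nhds (fderiv ℝ (fun x => F x s) p v)) := fun v =>
      tendsto_diffQuot_of_hasLineDerivAt (hp.hasFDerivAt.hasLineDerivAt v)
    have hWg : W (p, s) = gradient (fun x => F x s) p := by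
      ext j
      have h1 : c j (p, s) = fderiv ℝ (fun x => F x s) p (e j) := (hlim (e j)).limUnder_eq
      have h2 : inner ℝ (gradient (fun x => F x s) p) (e j) = fderiv ℝ (fun x => F x s) p (e j) :=
        InnerProductSpace.toDual_symm_apply
      rw [EuclideanSpace.inner_single_right] at h2
      have h3 : W (p, s) j = c j (p, s) := by
        simp [hW, e, Finset.sum_apply, Pi.single_apply]
      rw [h3, h1, ← h2]
      simp
    have hnorm : ‖W (p, s)‖ ≤ K := by
      rw [hWg, gradient, LinearIsometryEquiv.norm_map]
      exact norm_fderiv_le_of_lipschitz ℝ (hl s)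
    rw [if_pos hnorm, hWg]
    have : inner ℝ (gradient (fun x => F x s) p) v = fderiv ℝ (fun x => F x s) p v :=
      InnerProductSpace.toDual_symm_apply
    rw [this]
    exact hlim v

/-- The mean of the gradient over the smoothing ball and the samples. -/
noncomputable def meanGradient (P : Measure Ξ) (G : 𝔼 × Ξ → 𝔼) (u : ℝ) (y : 𝔼) : 𝔼 :=
  ∫ w, G (y + u • w.1, w.2) ∂(uniformBall d).prod P

namespace IsAEGradient

variable {F : EuclideanSpace ℝ (Fin d) → Ξ → ℝ} {K : NNReal}
  {G : EuclideanSpace ℝ (Fin d) × Ξ → EuclideanSpace ℝ (Fin d)} {P : Measure Ξ}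
  [IsProbabilityMeasure P]

/-- The exceptional null set depends on `s`; Fubini, applicable because the convergence set is
measurable, makes it null for the product law. -/
theorem ae_tendsto (h : IsAEGradient F K G) {u : ℝ} (hu : u ≠ 0) (y v : 𝔼) :
    ∀ᵐ w ∂(uniformBall d).prod P, Filter.Tendsto
      (fun n => diffQuot F v n (y + u • w.1, w.2)) Filter.atTop
      (nhds (inner ℝ (G (y + u • w.1, w.2)) v)) := by
  have hms : MeasurableSet {w : 𝔼 × Ξ | Filter.Tendsto
      (fun n => diffQuot F v n (y + u • w.1, w.2)) Filter.atTop
      (nhds (inner ℝ (G (y + u • w.1, w.2)) v))} := by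
    have hsh : Measurable fun w : 𝔼 × Ξ => (y + u • w.1, w.2) := by fun_prop
    have hg := h.meas_grad.comp hsh
    refine measurableSet_tendsto_fun
      (fun n => (measurable_diffQuot h.meas h.lip v n).comp hsh) ?_
    exact Measurable.inner hg measurable_const
  refine (Measure.ae_prod_iff_ae_ae hms).2 ?_
  refine (Measure.ae_ae_comm hms).2 (Filter.Eventually.of_forall fun s => ?_)
  exact ae_comp_add_smul (p := fun p => Filter.Tendsto (fun n => diffQuot F v n (p, s)) Filter.atTop
    (nhds (inner ℝ (G (p, s)) v))) (h.tendsto s v) hu y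

theorem lipschitzWith_expectedObjective (h : IsAEGradient F K G)
    (hint : ∀ x, Integrable (F x) P) : LipschitzWith K (expectedObjective P F) := by
  refine LipschitzWith.of_dist_le_mul fun x y => ?_
  rw [expectedObjective, expectedObjective, dist_eq_norm, ← integral_sub (hint x) (hint y)]
  refine (norm_integral_le_of_norm_le_const (C := K * dist x y)
    (Filter.Eventually.of_forall fun s => ?_)).trans (by simp)
  exact ((h.lip s).dist_le_mul x y)

theorem integrable_prod (h : IsAEGradient F K G) (hint : ∀ x, Integrable (F x) P) (u : ℝ) (x : 𝔼) :
    Integrable (fun w : 𝔼 × Ξ => F (x + u • w.1) w.2) ((uniformBall d).prod P) := by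
  have hb : Integrable (fun w : 𝔼 × Ξ => |F x w.2| + K * (|u| * 1)) ((uniformBall d).prod P) :=
    ((hint x).abs.comp_snd _).add (integrable_const _)
  refine hb.mono' ?_ ?_
  · have := measurable_uncurry_of_lipschitzWith h.meas h.lip
    exact (this.comp (show Measurable fun w : 𝔼 × Ξ => (x + u • w.1, w.2) by fun_prop))
      |>.aestronglyMeasurable
  · have : ∀ᵐ w ∂(uniformBall d).prod P, w.1 ∈ Metric.closedBall (0 : 𝔼) 1 :=
      Measure.quasiMeasurePreserving_fst.ae ae_uniformBall_mem
    filter_upwards [this] with w hw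
    simp only [Metric.mem_closedBall, dist_zero_right] at hw
    have h1 := (h.lip w.2).dist_le_mul (x + u • w.1) x
    rw [Real.dist_eq, dist_eq_norm, add_sub_cancel_left, norm_smul, Real.norm_eq_abs] at h1
    have h2 : (K : ℝ) * (|u| * ‖w.1‖) ≤ K * (|u| * 1) := by gcongr
    have h3 := abs_sub_abs_le_abs_sub (F (x + u • w.1) w.2) (F x w.2)
    rw [Real.norm_eq_abs]
    linarith

theorem smoothed_eq (h : IsAEGradient F K G) (hint : ∀ x, Integrable (F x) P) (u : ℝ) (x : 𝔼) :
    smoothed (expectedObjective P F) u x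
      = ∫ w, F (x + u • w.1) w.2 ∂(uniformBall d).prod P := by
  rw [integral_prod _ (h.integrable_prod hint u x)]
  rfl

theorem integrable_comp (h : IsAEGradient F K G) (u : ℝ) (y : 𝔼) :
    Integrable (fun w : 𝔼 × Ξ => G (y + u • w.1, w.2)) ((uniformBall d).prod P) := by
  refine Integrable.of_bound (C := K) ?_ (Filter.Eventually.of_forall fun w => h.norm_le _)
  exact (h.meas_grad.comp (by fun_prop)).aestronglyMeasurable

theorem norm_meanGradient_le (h : IsAEGradient F K G) (u : ℝ) (y : 𝔼) :
    ‖meanGradient P G u y‖ ≤ K := by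
  refine (norm_integral_le_of_norm_le_const (C := K)
    (Filter.Eventually.of_forall fun w => h.norm_le _)).trans (by simp)

theorem measurable_meanGradient (h : IsAEGradient F K G) (u : ℝ) :
    Measurable (meanGradient P G u) := by
  have : StronglyMeasurable fun p : 𝔼 × (𝔼 × Ξ) => G (p.1 + u • p.2.1, p.2.2) :=
    (h.meas_grad.comp (by fun_prop)).stronglyMeasurable
  exact this.integral_prod_right.measurable

/-- Unbiasedness of the oracle: both sides are limits of the same difference quotients of the
smoothed objective, one by dominated convergence and one by its differentiability. -/
theorem inner_meanGradient (h : IsAEGradient F K G) (hint : ∀ x, Integrable (F x) P) {u : ℝ}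
    (hu : u ≠ 0) (y v : 𝔼) :
    inner ℝ (meanGradient P G u y) v = smoothedDeriv (expectedObjective P F) u y v := by
  have h1 := tendsto_diffQuot_of_hasLineDerivAt
    (hasLineDerivAt_smoothed (h.lipschitzWith_expectedObjective hint) hu y v)
  have h2 : Filter.Tendsto
      (fun n => ∫ w, diffQuot F v n (y + u • w.1, w.2) ∂(uniformBall d).prod P) Filter.atTop
      (nhds (∫ w, inner ℝ (G (y + u • w.1, w.2)) v ∂(uniformBall d).prod P)) := by
    refine tendsto_integral_of_dominated_convergence (fun _ => K * ‖v‖) (fun n => ?_)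
      (integrable_const _) (fun n => ?_) (h.ae_tendsto hu y v)
    · exact ((measurable_diffQuot h.meas h.lip v n).comp
        (show Measurable fun w : 𝔼 × Ξ => (y + u • w.1, w.2) by fun_prop)).aestronglyMeasurable
    · exact Filter.Eventually.of_forall fun w => abs_diffQuot_le h.lip v n _
  have h3 : ∀ n : ℕ, ∫ w, diffQuot F v n (y + u • w.1, w.2) ∂(uniformBall d).prod P
      = ((n : ℝ) + 1) * (smoothed (expectedObjective P F) u (y + ((n : ℝ) + 1)⁻¹ • v)
        - smoothed (expectedObjective P F) u y) := by
    intro n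
    rw [h.smoothed_eq hint, h.smoothed_eq hint, ← integral_sub (h.integrable_prod hint u _)
      (h.integrable_prod hint u _), ← integral_const_mul]
    simp only [diffQuot, add_right_comm]
  simp only [h3] at h2
  rw [← tendsto_nhds_unique h2 h1, meanGradient, real_inner_comm,
    ← integral_inner (h.integrable_comp u y)]
  simp only [real_inner_comm]

end IsAEGradient

end

/-! ### The minimizer of the dual averaging objective -/

section
variable {E : Type*} [NormedAddCommGroup E] [InnerProductSpace ℝ E]

theorem convexOn_inner_add {X : Set E} {φ : E → ℝ} (hφ : ConvexOn ℝ X φ) {c : ℝ} (hc : 0 ≤ c)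
    (w : E) : ConvexOn ℝ X fun v => inner ℝ w v + c * φ v :=
  ((innerSL ℝ w).toLinearMap.convexOn hφ.1).add (hφ.smul hc)

/-- Stability of the minimizers of a strongly convex function under linear perturbations. -/
theorem norm_sub_le_of_isMinOn {X : Set E} {φ : E → ℝ} (hφ : ConvexOn ℝ X φ) {b c : ℝ}
    (hc : 0 ≤ c) {w w' z z' : E} (hz : z ∈ X) (hz' : z' ∈ X)
    (hm : IsMinOn (fun v => inner ℝ w v + c * φ v + b * (1 / 2 * ‖v‖ ^ 2)) X z)
    (hm' : IsMinOn (fun v => inner ℝ w' v + c * φ v + b * (1 / 2 * ‖v‖ ^ 2)) X z') :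
    b * ‖z - z'‖ ≤ ‖w - w'‖ := by
  have h1 := quadratic_growth_of_isMinOn (convexOn_inner_add hφ hc w) hz hm hz'
  have h2 := quadratic_growth_of_isMinOn (convexOn_inner_add hφ hc w') hz' hm' hz
  rw [norm_sub_rev z' z] at h1
  have h3 : inner ℝ (w - w') (z' - z) ≤ ‖w - w'‖ * ‖z - z'‖ := by
    rw [norm_sub_rev z z']; exact real_inner_le_norm _ _
  simp only [inner_sub_left, inner_sub_right] at h3
  rcases (norm_nonneg (z - z')).eq_or_lt with h0 | h0
  · rw [← h0, mul_zero]; exact norm_nonneg _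
  · refine le_of_mul_le_mul_right ?_ h0
    nlinarith

/-- Exhibits `z_{t+1}` as a continuous function of the accumulated gradients, so that it inherits
their measurability with respect to the past. -/
theorem exists_continuous_argmin {X : Set E} (hX : IsCompact X)
    (hne : X.Nonempty) {φ : E → ℝ} (hφ : ConvexOn ℝ X φ) (hφc : LowerSemicontinuousOn φ X)
    {b c : ℝ} (hb : 0 < b) (hc : 0 ≤ c) :
    ∃ A : E → E, Continuous A ∧ ∀ w z, z ∈ X →
      IsMinOn (fun v => inner ℝ w v + c * φ v + b * (1 / 2 * ‖v‖ ^ 2)) X z → z = A w := by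
  have hex : ∀ w : E, ∃ z ∈ X,
      IsMinOn (fun v => inner ℝ w v + c * φ v + b * (1 / 2 * ‖v‖ ^ 2)) X z := by
    intro w
    refine LowerSemicontinuousOn.exists_isMinOn hne hX ?_
    have h1 : LowerSemicontinuousOn (fun v => c * φ v) X := by
      have hcont : Continuous fun r : ℝ => c * r := by fun_prop
      exact hcont.comp_lowerSemicontinuousOn hφc
        (fun _ _ h => mul_le_mul_of_nonneg_left h hc)
    have h2 : LowerSemicontinuousOn (fun v : E => inner ℝ w v) X :=
      (show Continuous fun v : E => inner ℝ w v by fun_prop).lowerSemicontinuous.lowerSemicontinuousOn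
          _
    have h3 : LowerSemicontinuousOn (fun v : E => b * (1 / 2 * ‖v‖ ^ 2)) X :=
      (show Continuous fun v : E => b * (1 / 2 * ‖v‖ ^ 2) by fun_prop).lowerSemicontinuous.lowerSemicontinuousOn
          _
    exact (h2.add h1).add h3
  choose A hAX hAm using hex
  refine ⟨A, ?_, fun w z hz hm => ?_⟩
  · refine LipschitzWith.continuous (K := Real.toNNReal b⁻¹) (LipschitzWith.of_dist_le_mul ?_)
    intro w w'
    rw [Real.coe_toNNReal _ (inv_pos.2 hb).le, dist_eq_norm, dist_eq_norm, ← div_eq_inv_mul,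
      le_div_iff₀ hb, mul_comm]
    exact norm_sub_le_of_isMinOn hφ hc (hAX w) (hAX w') (hAm w) (hAm w')
  · have := norm_sub_le_of_isMinOn hφ hc hz (hAX w) hm (hAm w)
    rw [sub_self, norm_zero] at this
    have h0 : ‖z - A w‖ = 0 := le_antisymm (by nlinarith [norm_nonneg (z - A w)]) (norm_nonneg _)
    exact sub_eq_zero.1 (norm_eq_zero.1 h0)

end

/-! ### Subgradients at points of differentiability -/

section
variable {d : ℕ} {Ξ : Type*} [MeasurableSpace Ξ]

local notation "𝔼" => EuclideanSpace ℝ (Fin d)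

/-- The coordinate directions, with both signs. -/
noncomputable def signedBasis (j : Fin d × Bool) : 𝔼 :=
  (if j.2 then (1 : ℝ) else -1) • EuclideanSpace.single j.1 1

/-- The subgradient inequality along `e_j` and `-e_j` squeezes each coordinate of `g`. Finitely many
directions suffice, so almost sure convergence may be asked for one direction at a time. -/
theorem eq_of_isSubgradientOn {Ξ : Type*} {F F' : 𝔼 → Ξ → ℝ} {D : Set 𝔼} {p g a : 𝔼} {s : Ξ}
    (hF : ∀ x ∈ D, F' x s = F x s) (hg : IsSubgradientOn (fun p => F p s) D p g)
    (hp : D ∈ nhds p)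
    (ha : ∀ j, Filter.Tendsto (fun n => diffQuot F' (signedBasis j) n (p, s)) Filter.atTop
      (nhds (inner ℝ a (signedBasis j)))) : g = a := by
  have key : ∀ j : Fin d × Bool, inner ℝ g (signedBasis j) ≤ inner ℝ a (signedBasis j) := by
    intro j
    refine ge_of_tendsto (ha j) ?_
    have h0 : Filter.Tendsto (fun n : ℕ => p + ((n : ℝ) + 1)⁻¹ • signedBasis j) Filter.atTop
        (nhds (p + (0 : ℝ) • signedBasis j)) := by
      refine tendsto_const_nhds.add (Filter.Tendsto.smul_const ?_ _)
      simpa using tendsto_one_div_add_atTop_nhds_zero_nat (𝕜 := ℝ)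
    rw [zero_smul, add_zero] at h0
    filter_upwards [h0.eventually hp] with n hn
    have h1 := hg.2 _ hn
    have hn0 : (0 : ℝ) < (n : ℝ) + 1 := by positivity
    simp only [add_sub_cancel_left, inner_smul_right] at h1
    simp only [diffQuot]
    rw [hF _ hn, hF _ hg.1]
    have h2 : ((n : ℝ) + 1)⁻¹ * inner ℝ g (signedBasis j)
        ≤ F (p + ((n : ℝ) + 1)⁻¹ • signedBasis j) s - F p s := by linarith
    rwa [inv_mul_le_iff₀ hn0] at h2
  ext j
  have h1 := key (j, true)
  have h2 := key (j, false)
  simp [signedBasis, inner_smul_right, EuclideanSpace.inner_single_right, -neg_smul] at h1 h2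
  exact le_antisymm h1 h2

end

/-! ### The history of an independent family -/

section
variable {Ω ι α : Type*} [MeasurableSpace α]

/-- The `σ`-algebra generated by the inputs with indices in `S`. -/
@[reducible] def history (W : ι → Ω → α) (S : Set ι) : MeasurableSpace Ω :=
  ⨆ j ∈ S, MeasurableSpace.comap (W j) inferInstance

theorem history_mono (W : ι → Ω → α) {S T : Set ι} (h : S ⊆ T) : history W S ≤ history W T :=
  biSup_mono h

theorem measurable_history (W : ι → Ω → α) {S : Set ι} {j : ι} (hj : j ∈ S) :
    Measurable[history W S] (W j) :=
  Measurable.mono (comap_measurable (W j)) (le_iSup₂ (f := fun j (_ : j ∈ S) =>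
    MeasurableSpace.comap (W j) inferInstance) j hj) le_rfl

variable [mΩ : MeasurableSpace Ω]

theorem history_le {W : ι → Ω → α} (hW : ∀ j, Measurable (W j)) (S : Set ι) :
    history W S ≤ mΩ :=
  iSup₂_le fun j _ => (hW j).comap_le

variable {Pr : Measure Ω} {W : ι → Ω → α} {β : Type*} [MeasurableSpace β]

theorem indepFun_history (hW : ∀ j, Measurable (W j)) (hi : iIndepFun W Pr) {S : Set ι} {j : ι}
    (hj : j ∉ S) {A : Ω → β} (hA : Measurable[history W S] A) : IndepFun A (W j) Pr := by
  have h := indep_iSup_of_disjoint (fun j => (hW j).comap_le) hi.iIndep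
    (Set.disjoint_singleton_right.2 hj)
  rw [IndepFun_iff_Indep]
  refine indep_of_indep_of_le_left (indep_of_indep_of_le_right h ?_) hA.comap_le
  exact le_iSup₂ (f := fun i (_ : i ∈ ({j} : Set ι)) =>
    MeasurableSpace.comap (W i) inferInstance) j rfl

variable [IsProbabilityMeasure Pr]

theorem map_history_prod (hW : ∀ j, Measurable (W j)) (hi : iIndepFun W Pr) {S : Set ι} {j : ι}
    (hj : j ∉ S) {ν : Measure α} (hν : Pr.map (W j) = ν) {A : Ω → β}
    (hA : Measurable[history W S] A) :
    Pr.map (fun ω => (A ω, W j ω)) = (Pr.map A).prod ν := by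
  have hA' : Measurable A := hA.mono (history_le hW S) le_rfl
  rw [(indepFun_iff_map_prod_eq_prod_map_map hA'.aemeasurable (hW j).aemeasurable).1
    (indepFun_history hW hi hj hA), hν]

/-- The freezing lemma, in place of conditional expectations: a quantity `A` of the past is held
constant while the fresh input is averaged. With `ENNReal` values no integrability is needed. -/
theorem lintegral_history (hW : ∀ j, Measurable (W j)) (hi : iIndepFun W Pr) {S : Set ι} {j : ι}
    (hj : j ∉ S) {ν : Measure α} [SFinite ν] (hν : Pr.map (W j) = ν) {A : Ω → β}
    (hA : Measurable[history W S] A) {H : β × α → ENNReal} (hH : Measurable H) :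
    ∫⁻ ω, H (A ω, W j ω) ∂Pr = ∫⁻ ω, ∫⁻ w, H (A ω, w) ∂ν ∂Pr := by
  have hA' : Measurable A := hA.mono (history_le hW S) le_rfl
  rw [← lintegral_map hH (hA'.prodMk (hW j)), map_history_prod hW hi hj hν hA,
    lintegral_prod _ hH.aemeasurable, lintegral_map hH.lintegral_prod_right' hA']

theorem ae_history (hW : ∀ j, Measurable (W j)) (hi : iIndepFun W Pr) {S : Set ι} {j : ι}
    (hj : j ∉ S) {ν : Measure α} [SFinite ν] (hν : Pr.map (W j) = ν) {A : Ω → β}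
    (hA : Measurable[history W S] A) {p : β × α → Prop} (hp : MeasurableSet {x | p x})
    (h : ∀ a, ∀ᵐ w ∂ν, p (a, w)) : ∀ᵐ ω ∂Pr, p (A ω, W j ω) := by
  have hA' : Measurable A := hA.mono (history_le hW S) le_rfl
  have : ∀ᵐ x ∂Pr.map (fun ω => (A ω, W j ω)), p x := by
    rw [map_history_prod hW hi hj hν hA, Measure.ae_prod_iff_ae_ae hp]
    exact Filter.Eventually.of_forall h
  exact ae_of_ae_map (hA'.prodMk (hW j)).aemeasurable this

end

/-! ### Exponential moments of the gradient noise -/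

section
variable {d : ℕ} {Ξ : Type*} [MeasurableSpace Ξ]

local notation "𝔼" => EuclideanSpace ℝ (Fin d)

/-- The deviation of a sampled gradient from its mean. -/
noncomputable def gradNoise (P : Measure Ξ) (G : 𝔼 × Ξ → 𝔼) (u : ℝ) (y : 𝔼) (w : 𝔼 × Ξ) : 𝔼 :=
  G (y + u • w.1, w.2) - meanGradient P G u y

namespace IsAEGradient

variable {F : EuclideanSpace ℝ (Fin d) → Ξ → ℝ} {K : NNReal}
  {G : EuclideanSpace ℝ (Fin d) × Ξ → EuclideanSpace ℝ (Fin d)} {P : Measure Ξ}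
  [IsProbabilityMeasure P]

theorem norm_gradNoise_le (h : IsAEGradient F K G) (u : ℝ) (y : 𝔼) (w : 𝔼 × Ξ) :
    ‖gradNoise P G u y w‖ ≤ 2 * K := by
  refine (norm_sub_le _ _).trans ?_
  linarith [h.norm_le (y + u • w.1, w.2), h.norm_meanGradient_le (P := P) u y]

theorem measurable_gradNoise (h : IsAEGradient F K G) (u : ℝ) :
    Measurable fun p : 𝔼 × (𝔼 × Ξ) => gradNoise P G u p.1 p.2 := by
  have h1 : Measurable fun p : 𝔼 × (𝔼 × Ξ) => G (p.1 + u • p.2.1, p.2.2) :=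
    h.meas_grad.comp (by fun_prop)
  exact h1.sub ((h.measurable_meanGradient u).comp measurable_fst)

/-- Hoeffding's lemma for the gradient noise in a given direction. -/
theorem lintegral_exp_gradNoise_le (h : IsAEGradient F K G) (u : ℝ) (y v : 𝔼) :
    ∫⁻ w, ENNReal.ofReal (Real.exp (inner ℝ (gradNoise P G u y w) v)) ∂(uniformBall d).prod P
      ≤ ENNReal.ofReal (Real.exp ((2 * K) ^ 2 * ‖v‖ ^ 2 / 2)) := by
  set N : 𝔼 × Ξ → ℝ := fun w => inner ℝ (gradNoise P G u y w) v with hN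
  have hNm : Measurable N :=
    ((h.measurable_gradNoise u).comp (by fun_prop : Measurable fun w : 𝔼 × Ξ => (y, w))).inner
      measurable_const
  have hb : ∀ w, N w ∈ Set.Icc (-(2 * K * ‖v‖)) (2 * K * ‖v‖) := fun w =>
    abs_le.1 ((abs_real_inner_le_norm _ _).trans (by gcongr; exact h.norm_gradNoise_le u y w))
  have h0 : ∫ w, N w ∂(uniformBall d).prod P = 0 := by
    have hi := h.integrable_comp (P := P) u y
    have : ∫ w, gradNoise P G u y w ∂(uniformBall d).prod P = 0 := by
      simp only [gradNoise]
      rw [integral_sub hi (integrable_const _)]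
      simp [meanGradient]
    simp only [hN, real_inner_comm v]
    have hni : Integrable (gradNoise P G u y) ((uniformBall d).prod P) :=
      hi.sub (integrable_const _)
    rw [integral_inner hni, this, inner_zero_right]
  -- The range has length `4 K ‖v‖`, hence the variance proxy `(2 K ‖v‖)²`.
  have hsg := hasSubgaussianMGF_of_mem_Icc_of_integral_eq_zero hNm.aemeasurable
    (Filter.Eventually.of_forall hb) h0
  have h1 := hsg.mgf_le 1
  have h2 := hsg.integrable_exp_mul 1
  simp only [one_mul, mgf] at h1 h2
  rw [← ofReal_integral_eq_lintegral_ofReal h2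
    (Filter.Eventually.of_forall fun _ => (Real.exp_pos _).le)]
  refine ENNReal.ofReal_le_ofReal (h1.trans (le_of_eq ?_))
  congr 1
  have : (2 * (K : ℝ) * ‖v‖ - -(2 * K * ‖v‖)) = 4 * K * ‖v‖ := by ring
  push_cast
  rw [this, Real.norm_of_nonneg (by positivity)]
  ring

end IsAEGradient

end

/-! ### Exponential moments of minibatch noise -/

section
variable {d : ℕ} {Ξ Ω ι : Type*} [MeasurableSpace Ξ] [MeasurableSpace Ω]
  {F : EuclideanSpace ℝ (Fin d) → Ξ → ℝ} {K : NNReal}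
  {G : EuclideanSpace ℝ (Fin d) × Ξ → EuclideanSpace ℝ (Fin d)} {P : Measure Ξ}
  [IsProbabilityMeasure P] {Pr : Measure Ω} [IsProbabilityMeasure Pr]
  {W : ι → Ω → EuclideanSpace ℝ (Fin d) × Ξ}

local notation "𝔼" => EuclideanSpace ℝ (Fin d)

theorem ofReal_exp_mul_ofReal_exp (a b : ℝ) :
    ENNReal.ofReal (Real.exp a) * ENNReal.ofReal (Real.exp b)
      = ENNReal.ofReal (Real.exp (a + b)) := by
  rw [← ENNReal.ofReal_mul (Real.exp_pos a).le, Real.exp_add]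

theorem _root_.Measurable.ofReal_exp {β : Type*} {mβ : MeasurableSpace β} {f : β → ℝ}
    (hf : Measurable f) : Measurable fun x => ENNReal.ofReal (Real.exp (f x)) :=
  (Real.measurable_exp.comp hf).ennreal_ofReal

/-- Closes the induction in `lintegral_exp_norm_sq_sum_le`: the substitution `x ↦ x / (1 - 2 x)`
turns `1 - 2 k x` into `(1 - 2 (k + 1) x) / (1 - 2 x)`. -/
theorem add_div_le_of_two_mul_lt_one {k x : ℝ} (hk : 0 ≤ k) (hx : 0 ≤ x)
    (h : 2 * (k + 1) * x < 1) :
    x + k * (x / (1 - 2 * x)) / (1 - 2 * k * (x / (1 - 2 * x)))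
      ≤ (k + 1) * x / (1 - 2 * (k + 1) * x) := by
  have hA : 0 < 1 - 2 * x := by nlinarith
  have hB : 0 < 1 - 2 * (k + 1) * x := by linarith
  have e1 : 1 - 2 * k * (x / (1 - 2 * x)) = (1 - 2 * (k + 1) * x) / (1 - 2 * x) := by
    rw [eq_div_iff hA.ne', sub_mul, mul_assoc (2 * k), div_mul_cancel₀ _ hA.ne']
    ring
  have e2 : k * (x / (1 - 2 * x)) / ((1 - 2 * (k + 1) * x) / (1 - 2 * x))
      = k * x / (1 - 2 * (k + 1) * x) := by
    rw [← mul_div_assoc, div_div_div_cancel_right₀ hA.ne']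
  rw [e1, e2, ← le_sub_iff_add_le, ← sub_div, le_div_iff₀ hB]
  nlinarith [mul_nonneg (mul_nonneg hx hx) (show 0 ≤ k + 1 by linarith)]

namespace IsAEGradient

theorem lintegral_exp_inner_gradNoise_le (h : IsAEGradient F K G) (hW : ∀ j, Measurable (W j))
    (hi : iIndepFun W Pr) (hlaw : ∀ j, Pr.map (W j) = (uniformBall d).prod P) {S : Set ι} {j : ι}
    (hj : j ∉ S) {y v : Ω → 𝔼} {Γ : Ω → ENNReal} (hy : Measurable[history W S] y)
    (hv : Measurable[history W S] v) (hΓ : Measurable[history W S] Γ) (u : ℝ) :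
    ∫⁻ ω, Γ ω * ENNReal.ofReal (Real.exp (inner ℝ (gradNoise P G u (y ω) (W j ω)) (v ω))) ∂Pr
      ≤ ∫⁻ ω, Γ ω * ENNReal.ofReal (Real.exp ((2 * K) ^ 2 * ‖v ω‖ ^ 2 / 2)) ∂Pr := by
  have hA : Measurable[history W S] fun ω => (Γ ω, y ω, v ω) := hΓ.prodMk (hy.prodMk hv)
  set H : (ENNReal × 𝔼 × 𝔼) × (𝔼 × Ξ) → ENNReal := fun p =>
    p.1.1 * ENNReal.ofReal (Real.exp (inner ℝ (gradNoise P G u p.1.2.1 p.2) p.1.2.2)) with hHdef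
  have hn : Measurable fun p : (ENNReal × 𝔼 × 𝔼) × (𝔼 × Ξ) => gradNoise P G u p.1.2.1 p.2 :=
    (h.measurable_gradNoise u).comp
      (show Measurable fun p : (ENNReal × 𝔼 × 𝔼) × (𝔼 × Ξ) => (p.1.2.1, p.2) by fun_prop)
  have hH : Measurable H :=
    Measurable.mul (by fun_prop) (Measurable.ofReal_exp (hn.inner (by fun_prop)))
  have := lintegral_history hW hi hj (hlaw j) hA hH
  rw [this]
  refine lintegral_mono fun ω => ?_
  simp only [hHdef]
  rw [lintegral_const_mul]
  · gcongr
    exact h.lintegral_exp_gradNoise_le u (y ω) (v ω)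
  · refine Measurable.ofReal_exp (Measurable.inner ?_ measurable_const)
    exact (h.measurable_gradNoise u).comp (by fun_prop : Measurable fun w : 𝔼 × Ξ => (y ω, w))

variable {κ : Type*} [DecidableEq κ] {S : Set ι} {idx : κ → ι}

theorem measurable_sum_gradNoise {Ω κ : Type*} {W : ι → Ω → 𝔼 × Ξ} {idx : κ → ι}
    (h : IsAEGradient F K G) {y : Ω → 𝔼}
    (hy : Measurable[history W S] y) (u : ℝ) (I : Finset κ) :
    Measurable[history W (S ∪ idx '' I)]
      fun ω => ∑ i ∈ I, gradNoise P G u (y ω) (W (idx i) ω) := by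
  refine Finset.measurable_sum _ fun i hiI => ?_
  have h1 : Measurable[history W (S ∪ idx '' I)] y :=
    hy.mono (history_mono W Set.subset_union_left) le_rfl
  have h2 : Measurable[history W (S ∪ idx '' I)] (W (idx i)) :=
    measurable_history W (Set.mem_union_right _ (Set.mem_image_of_mem _ hiI))
  exact (h.measurable_gradNoise u).comp (h1.prodMk h2)

/-- The samples of a batch are peeled off one at a time, the exponential of the others joining the
past factor `Γ`. -/
theorem lintegral_exp_inner_sum_le (h : IsAEGradient F K G) (hW : ∀ j, Measurable (W j))
    (hi : iIndepFun W Pr) (hlaw : ∀ j, Pr.map (W j) = (uniformBall d).prod P)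
    (hidx : Function.Injective idx) (hidS : ∀ i, idx i ∉ S) {y v : Ω → 𝔼} {Γ : Ω → ENNReal}
    (hy : Measurable[history W S] y) (hv : Measurable[history W S] v)
    (hΓ : Measurable[history W S] Γ) (u : ℝ) {ρ : ℝ} (hρ : ∀ᵐ ω ∂Pr, ‖v ω‖ ≤ ρ) (I : Finset κ) :
    ∫⁻ ω, Γ ω * ENNReal.ofReal
        (Real.exp (inner ℝ (∑ i ∈ I, gradNoise P G u (y ω) (W (idx i) ω)) (v ω))) ∂Pr
      ≤ (∫⁻ ω, Γ ω ∂Pr) * ENNReal.ofReal (Real.exp (I.card * ((2 * K) ^ 2 * ρ ^ 2 / 2))) := by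
  induction I using Finset.induction_on with
  | empty => simp
  | insert a I ha ih =>
    set T := S ∪ idx '' I with hT
    have hle : history W S ≤ history W T := history_mono W Set.subset_union_left
    have haT : idx a ∉ T := by
      rintro (h1 | ⟨b, hb, hba⟩)
      · exact hidS a h1
      · exact ha (hidx hba ▸ hb)
    have hs : Measurable[history W T] fun ω => ∑ i ∈ I, gradNoise P G u (y ω) (W (idx i) ω) :=
      h.measurable_sum_gradNoise hy u I
    have hv' := hv.mono hle le_rfl
    have key := h.lintegral_exp_inner_gradNoise_le hW hi hlaw haT (hy.mono hle le_rfl) hv'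
      (Γ := fun ω => Γ ω * ENNReal.ofReal
        (Real.exp (inner ℝ (∑ i ∈ I, gradNoise P G u (y ω) (W (idx i) ω)) (v ω))))
      (Measurable.mul (hΓ.mono hle le_rfl) (Measurable.ofReal_exp (hs.inner hv'))) u
    calc _ = _ := by
          refine lintegral_congr fun ω => ?_
          rw [Finset.sum_insert ha, inner_add_left, add_comm, ← ofReal_exp_mul_ofReal_exp,
            ← mul_assoc]
      _ ≤ _ := key
      _ ≤ ∫⁻ ω, Γ ω * ENNReal.ofReal
            (Real.exp (inner ℝ (∑ i ∈ I, gradNoise P G u (y ω) (W (idx i) ω)) (v ω)))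
            * ENNReal.ofReal (Real.exp ((2 * K) ^ 2 * ρ ^ 2 / 2)) ∂Pr := by
          refine lintegral_mono_ae ?_
          filter_upwards [hρ] with ω hω
          gcongr
      _ ≤ _ := by
          rw [lintegral_mul_const' _ _ ENNReal.ofReal_ne_top]
          refine (mul_le_mul_left ih _).trans (le_of_eq ?_)
          rw [mul_assoc, ofReal_exp_mul_ofReal_exp, Finset.card_insert_of_notMem ha]
          push_cast
          ring_nf

/-- Expand `‖N + S‖²` for a fresh sample `N`: `‖N‖²` is bounded by `(2 K)²`, and Hoeffding's lemma
in direction `2 r S` turns the cross term into another multiple of `‖S‖²`. Only the rate `r` grows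
from sample to sample, so the dimension never enters. -/
theorem lintegral_exp_norm_sq_sum_le (h : IsAEGradient F K G) (hW : ∀ j, Measurable (W j))
    (hi : iIndepFun W Pr) (hlaw : ∀ j, Pr.map (W j) = (uniformBall d).prod P)
    (hidx : Function.Injective idx) (hidS : ∀ i, idx i ∉ S) {y : Ω → 𝔼} {Γ : Ω → ENNReal}
    (hy : Measurable[history W S] y) (hΓ : Measurable[history W S] Γ) (u : ℝ) (I : Finset κ) :
    ∀ r : ℝ, 0 ≤ r → 2 * I.card * (r * (2 * K) ^ 2) < 1 →
    ∫⁻ ω, Γ ω * ENNReal.ofReal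
        (Real.exp (r * ‖∑ i ∈ I, gradNoise P G u (y ω) (W (idx i) ω)‖ ^ 2)) ∂Pr
      ≤ (∫⁻ ω, Γ ω ∂Pr) * ENNReal.ofReal (Real.exp
          (I.card * (r * (2 * K) ^ 2) / (1 - 2 * I.card * (r * (2 * K) ^ 2)))) := by
  induction I using Finset.induction_on with
  | empty => intro r hr hr1; simp
  | insert a I ha ih =>
    intro r hr hr1
    rw [Finset.card_insert_of_notMem ha] at hr1 ⊢
    push_cast at hr1 ⊢
    set T := S ∪ idx '' I with hT
    have hle : history W S ≤ history W T := history_mono W Set.subset_union_left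
    have haT : idx a ∉ T := by
      rintro (h1 | ⟨b, hb, hba⟩)
      · exact hidS a h1
      · exact ha (hidx hba ▸ hb)
    have hs : Measurable[history W T] fun ω => ∑ i ∈ I, gradNoise P G u (y ω) (W (idx i) ω) :=
      h.measurable_sum_gradNoise hy u I
    have hv : Measurable[history W T]
        fun ω => (2 * r) • ∑ i ∈ I, gradNoise P G u (y ω) (W (idx i) ω) := hs.const_smul (2 * r)
    have hsq : Measurable[history W T]
        fun ω => r * ‖∑ i ∈ I, gradNoise P G u (y ω) (W (idx i) ω)‖ ^ 2 + r * (2 * K) ^ 2 :=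
      (show Measurable fun s : 𝔼 => r * ‖s‖ ^ 2 + r * (2 * K) ^ 2 by fun_prop).comp hs
    have key := h.lintegral_exp_inner_gradNoise_le hW hi hlaw haT (hy.mono hle le_rfl) hv
      (Γ := fun ω => Γ ω * ENNReal.ofReal (Real.exp
        (r * ‖∑ i ∈ I, gradNoise P G u (y ω) (W (idx i) ω)‖ ^ 2 + r * (2 * K) ^ 2)))
      (Measurable.mul (hΓ.mono hle le_rfl) (Measurable.ofReal_exp hsq)) u
    set c : ℝ := (2 * K) ^ 2 with hc
    have hc0 : 0 ≤ c := by positivity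
    set k : ℝ := (I.card : ℝ) with hk
    have hk0 : 0 ≤ k := Nat.cast_nonneg _
    have hrc : 0 ≤ r * c := by positivity
    have hkrc : 0 ≤ k * (r * c) := by positivity
    have h2 : 0 < 1 - 2 * (r * c) := by nlinarith
    -- Hoeffding replaces `r` by `r + 2 r² c`; the slightly larger `r'` composes exactly over the
    -- induction.
    set r' : ℝ := r / (1 - 2 * (r * c)) with hr'
    have hr'0 : 0 ≤ r' := by positivity
    have hr'c : r' * c = r * c / (1 - 2 * (r * c)) := by rw [hr']; ring
    have h3 : 2 * k * (r' * c) < 1 := by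
      rw [hr'c, mul_div_assoc', div_lt_one h2]; nlinarith
    have h4 : r + 2 * r ^ 2 * c ≤ r' := by
      rw [hr', le_div_iff₀ h2]
      nlinarith [mul_nonneg (mul_nonneg hr hrc) hrc]
    calc _ ≤ _ := by
          refine lintegral_mono fun ω => ?_
          rw [Finset.sum_insert ha]
          dsimp only
          rw [mul_assoc, ofReal_exp_mul_ofReal_exp]
          gcongr
          rw [norm_add_sq_real, inner_smul_right]
          have hb := h.norm_gradNoise_le (P := P) u (y ω) (W (idx a) ω)
          have := pow_le_pow_left₀ (norm_nonneg _) hb 2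
          have := mul_le_mul_of_nonneg_left this hr
          linarith
      _ ≤ _ := key
      _ ≤ ∫⁻ ω, ENNReal.ofReal (Real.exp (r * c)) * (Γ ω * ENNReal.ofReal
            (Real.exp (r' * ‖∑ i ∈ I, gradNoise P G u (y ω) (W (idx i) ω)‖ ^ 2))) ∂Pr := by
          refine lintegral_mono fun ω => ?_
          dsimp only
          rw [mul_assoc, ofReal_exp_mul_ofReal_exp, mul_left_comm, ofReal_exp_mul_ofReal_exp]
          gcongr Γ ω * ENNReal.ofReal (Real.exp ?_)
          rw [norm_smul, mul_pow, Real.norm_eq_abs, sq_abs]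
          have := mul_le_mul_of_nonneg_right h4
            (sq_nonneg ‖∑ i ∈ I, gradNoise P G u (y ω) (W (idx i) ω)‖)
          linarith
      _ ≤ _ := by
          rw [lintegral_const_mul' _ _ ENNReal.ofReal_ne_top]
          refine (mul_le_mul_right (ih r' hr'0 h3) _).trans ?_
          rw [mul_left_comm, ofReal_exp_mul_ofReal_exp]
          gcongr
          rw [hr'c]
          exact add_div_le_of_two_mul_lt_one hk0 hrc hr1

end IsAEGradient

end

/-! ### Concentration of the accumulated noise -/

section
variable {d m : ℕ} {Ξ Ω : Type*} [MeasurableSpace Ξ] [MeasurableSpace Ω]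
  {F : EuclideanSpace ℝ (Fin d) → Ξ → ℝ} {K : NNReal}
  {G : EuclideanSpace ℝ (Fin d) × Ξ → EuclideanSpace ℝ (Fin d)} {P : Measure Ξ}
  [IsProbabilityMeasure P] {Pr : Measure Ω} [IsProbabilityMeasure Pr]
  {W : ℕ × Fin m → Ω → EuclideanSpace ℝ (Fin d) × Ξ}

local notation "𝔼" => EuclideanSpace ℝ (Fin d)

/-- The indices of the inputs that are used before step `t`. -/
def pastIndices (m t : ℕ) : Set (ℕ × Fin m) := {p | p.1 < t}

theorem pastIndices_mono (m : ℕ) {s t : ℕ} (h : s ≤ t) : pastIndices m s ⊆ pastIndices m t :=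
  fun _ hp => lt_of_lt_of_le hp h

theorem notMem_pastIndices (t : ℕ) (i : Fin m) : (t, i) ∉ pastIndices m t := lt_irrefl t

theorem union_image_subset_pastIndices (t : ℕ) (I : Set (Fin m)) :
    pastIndices m t ∪ (fun i => (t, i)) '' I ⊆ pastIndices m (t + 1) := by
  rintro p (hp | ⟨i, _, rfl⟩)
  · exact Nat.lt_succ_of_lt hp
  · exact Nat.lt_succ_self t

/-- The mean noise of the minibatch used at step `t`. -/
noncomputable def batchNoise (P : Measure Ξ) (G : 𝔼 × Ξ → 𝔼) (W : ℕ × Fin m → Ω → 𝔼 × Ξ)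
    (us : ℕ → ℝ) (y : ℕ → Ω → 𝔼) (t : ℕ) (ω : Ω) : 𝔼 :=
  (m : ℝ)⁻¹ • ∑ i, gradNoise P G (us t) (y t ω) (W (t, i) ω)

namespace IsAEGradient

theorem measurable_batchNoise {Ω : Type*} {W : ℕ × Fin m → Ω → 𝔼 × Ξ} (h : IsAEGradient F K G)
    {y : ℕ → Ω → 𝔼} {t : ℕ} (hy : Measurable[history W (pastIndices m t)] (y t)) (us : ℕ → ℝ) :
    Measurable[history W (pastIndices m (t + 1))] (batchNoise P G W us y t) := by
  have h1 := h.measurable_sum_gradNoise (P := P) (idx := fun i : Fin m => (t, i)) hy (us t)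
    Finset.univ
  have h2 := h1.mono (history_mono W (union_image_subset_pastIndices t _)) le_rfl
  exact (show Measurable fun s : 𝔼 => (m : ℝ)⁻¹ • s by fun_prop).comp h2

theorem measurable_sum_batchNoise {Ω : Type*} {W : ℕ × Fin m → Ω → 𝔼 × Ξ}
    (h : IsAEGradient F K G) {y v : ℕ → Ω → 𝔼}
    (hy : ∀ t, Measurable[history W (pastIndices m t)] (y t))
    (hv : ∀ t, Measurable[history W (pastIndices m t)] (v t)) (us : ℕ → ℝ)
    {q : ℕ → 𝔼 → 𝔼 → ℝ} (hq : ∀ t, Measurable fun p : 𝔼 × 𝔼 => q t p.1 p.2) (n : ℕ) :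
    Measurable[history W (pastIndices m n)]
      fun ω => ∑ t ∈ Finset.range n, q t (batchNoise P G W us y t ω) (v t ω) := by
  refine Finset.measurable_sum _ fun t ht => ?_
  have hlt : t + 1 ≤ n := Finset.mem_range.1 ht
  have h1 := (h.measurable_batchNoise (P := P) (hy t) us).mono
    (history_mono W (pastIndices_mono m hlt)) le_rfl
  have h2 := (hv t).mono (history_mono W (pastIndices_mono m ((Nat.le_succ t).trans hlt))) le_rfl
  exact (hq t).comp (h1.prodMk h2)

/-- Each step contributes `m` samples paired with `v / m`, that is `m (2 K)² (ρ / m)² / 2`, whence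
the gain `1 / m`. -/
theorem lintegral_exp_sum_inner_le (h : IsAEGradient F K G) (hm : 1 ≤ m)
    (hW : ∀ j, Measurable (W j)) (hi : iIndepFun W Pr)
    (hlaw : ∀ j, Pr.map (W j) = (uniformBall d).prod P) {y v : ℕ → Ω → 𝔼}
    (hy : ∀ t, Measurable[history W (pastIndices m t)] (y t))
    (hv : ∀ t, Measurable[history W (pastIndices m t)] (v t)) (us : ℕ → ℝ) {ρ : ℕ → ℝ}
    (hρ : ∀ t, ∀ᵐ ω ∂Pr, ‖v t ω‖ ≤ ρ t) (n : ℕ) :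
    ∫⁻ ω, ENNReal.ofReal (Real.exp
        (∑ t ∈ Finset.range n, inner ℝ (batchNoise P G W us y t ω) (v t ω))) ∂Pr
      ≤ ENNReal.ofReal (Real.exp (∑ t ∈ Finset.range n, 2 * K ^ 2 * ρ t ^ 2 / m)) := by
  have hm0 : (0 : ℝ) < m := by exact_mod_cast hm
  induction n with
  | zero => simp
  | succ n ih =>
    have hΓ := Measurable.ofReal_exp (h.measurable_sum_batchNoise (P := P) hy hv us
      (q := fun _ e v => inner ℝ e v) (fun _ => by fun_prop) n)
    have hv' : Measurable[history W (pastIndices m n)] fun ω => (m : ℝ)⁻¹ • v n ω :=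
      (show Measurable fun s : 𝔼 => (m : ℝ)⁻¹ • s by fun_prop).comp (hv n)
    have key := h.lintegral_exp_inner_sum_le hW hi hlaw (idx := fun i : Fin m => (n, i))
      (fun a b hab => (Prod.mk.inj hab).2) (notMem_pastIndices n) (hy n) hv' hΓ (us n)
      (ρ := (m : ℝ)⁻¹ * ρ n) (by
        filter_upwards [hρ n] with ω hω
        rw [norm_smul, Real.norm_of_nonneg (inv_nonneg.2 hm0.le)]
        gcongr) Finset.univ
    calc _ = _ := by
          refine lintegral_congr fun ω => ?_
          rw [Finset.sum_range_succ, ← ofReal_exp_mul_ofReal_exp]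
          simp only [batchNoise, inner_smul_left, inner_smul_right, conj_trivial]
      _ ≤ _ := key
      _ ≤ _ := mul_le_mul_left ih _
      _ = _ := by
          rw [ofReal_exp_mul_ofReal_exp, Finset.sum_range_succ, Finset.card_univ, Fintype.card_fin]
          congr 3
          field_simp

/-- The condition `hrm` keeps the denominator of the single-batch bound above `1/2`, which doubles
`4 K² r / m`. -/
theorem lintegral_exp_sum_norm_sq_le (h : IsAEGradient F K G) (hm : 1 ≤ m)
    (hW : ∀ j, Measurable (W j)) (hi : iIndepFun W Pr)
    (hlaw : ∀ j, Pr.map (W j) = (uniformBall d).prod P) {y : ℕ → Ω → 𝔼}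
    (hy : ∀ t, Measurable[history W (pastIndices m t)] (y t)) (us : ℕ → ℝ) {r : ℕ → ℝ}
    (hr : ∀ t, 0 ≤ r t) (n : ℕ) (hrm : ∀ t < n, 16 * K ^ 2 * r t ≤ m) :
    ∫⁻ ω, ENNReal.ofReal (Real.exp
        (∑ t ∈ Finset.range n, r t * ‖batchNoise P G W us y t ω‖ ^ 2)) ∂Pr
      ≤ ENNReal.ofReal (Real.exp (∑ t ∈ Finset.range n, 8 * K ^ 2 * r t / m)) := by
  have hm0 : (0 : ℝ) < m := by exact_mod_cast hm
  induction n with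
  | zero => simp
  | succ n ih =>
    have hΓ := Measurable.ofReal_exp (h.measurable_sum_batchNoise (P := P) hy hy us
      (q := fun t e _ => r t * ‖e‖ ^ 2) (fun _ => by fun_prop) n)
    have e1 : 2 * ((Finset.univ : Finset (Fin m)).card : ℝ) * (r n / m ^ 2 * (2 * K) ^ 2)
        = 8 * K ^ 2 * r n / m := by
      rw [Finset.card_univ, Fintype.card_fin]
      field_simp
      ring
    have e2 : 8 * K ^ 2 * r n / m ≤ 1 / 2 := by
      rw [div_le_iff₀ hm0]
      linarith [hrm n (Nat.lt_succ_self n)]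
    have e3 : 0 ≤ 8 * K ^ 2 * r n / m := by have := hr n; positivity
    have key := h.lintegral_exp_norm_sq_sum_le hW hi hlaw (idx := fun i : Fin m => (n, i))
      (fun a b hab => (Prod.mk.inj hab).2) (notMem_pastIndices n) (hy n) hΓ (us n) Finset.univ
      (r n / m ^ 2) (by have := hr n; positivity) (by rw [e1]; linarith)
    calc _ = _ := by
          refine lintegral_congr fun ω => ?_
          rw [Finset.sum_range_succ, ← ofReal_exp_mul_ofReal_exp]
          congr 3
          rw [batchNoise, norm_smul, mul_pow, Real.norm_of_nonneg (inv_nonneg.2 hm0.le)]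
          ring
      _ ≤ _ := key
      _ ≤ _ := mul_le_mul_left (ih fun t ht => hrm t (ht.trans (Nat.lt_succ_self n))) _
      _ ≤ _ := by
          rw [ofReal_exp_mul_ofReal_exp, Finset.sum_range_succ, e1]
          gcongr ENNReal.ofReal (Real.exp (_ + ?_))
          rw [div_le_iff₀ (by linarith)]
          have : ((Finset.univ : Finset (Fin m)).card : ℝ) * (r n / m ^ 2 * (2 * K) ^ 2)
            = 8 * K ^ 2 * r n / m / 2 := by rw [← e1]; ring
          rw [this]
          nlinarith

end IsAEGradient

/-- The Chernoff bound. -/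
theorem measure_ge_le_of_lintegral_exp_le {Ω : Type*} [MeasurableSpace Ω] {Pr : Measure Ω}
    {M : Ω → ℝ} (hM : Measurable M) {B δ : ℝ} (hδ : 0 < δ)
    (h : ∫⁻ ω, ENNReal.ofReal (Real.exp (M ω)) ∂Pr ≤ ENNReal.ofReal (Real.exp B)) :
    Pr {ω | B + Real.log (1 / δ) ≤ M ω} ≤ ENNReal.ofReal δ := by
  have h1 := mul_meas_ge_le_lintegral (μ := Pr) hM.ofReal_exp
    (ENNReal.ofReal (Real.exp (B + Real.log (1 / δ))))
  have h2 : {ω | B + Real.log (1 / δ) ≤ M ω} ⊆ {ω | ENNReal.ofReal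
      (Real.exp (B + Real.log (1 / δ))) ≤ ENNReal.ofReal (Real.exp (M ω))} := fun ω hω =>
    ENNReal.ofReal_le_ofReal (Real.exp_le_exp.2 hω)
  have h3 : ENNReal.ofReal (Real.exp B)
      = ENNReal.ofReal (Real.exp (B + Real.log (1 / δ))) * ENNReal.ofReal δ := by
    rw [← ENNReal.ofReal_mul (Real.exp_pos _).le, Real.exp_add, Real.exp_log (by positivity)]
    congr 1
    field_simp
  refine (measure_mono h2).trans ?_
  refine (ENNReal.mul_le_mul_iff_right (a := ENNReal.ofReal (Real.exp (B + Real.log (1 / δ))))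
    ?_ ENNReal.ofReal_ne_top).1 ?_
  · simp [Real.exp_pos]
  · rw [← h3]
    exact h1.trans h

end

/-! ### The iterates depend only on the past -/

theorem aestronglyMeasurable_linearCombination {Ω E : Type*} [NormedAddCommGroup E]
    [NormedSpace ℝ E] {m m₀ : MeasurableSpace Ω} {μ : Measure[m₀] Ω} {f g : Ω → E}
    (hf : AEStronglyMeasurable[m] f μ) (hg : AEStronglyMeasurable[m] g μ) (a b : ℝ) :
    AEStronglyMeasurable[m] (fun ω => a • f ω + b • g ω) μ :=
  (hf.const_smul a).add (hg.const_smul b)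

theorem aestronglyMeasurable_weightedSum {Ω E κ : Type*} [NormedAddCommGroup E]
    [NormedSpace ℝ E] {m m₀ : MeasurableSpace Ω} {μ : Measure[m₀] Ω} {f : κ → Ω → E}
    {I : Finset κ} (hf : ∀ i ∈ I, AEStronglyMeasurable[m] (f i) μ) (a : κ → ℝ) :
    AEStronglyMeasurable[m] (fun ω => ∑ i ∈ I, a i • f i ω) μ := by
  classical
  induction I using Finset.induction_on with
  | empty => simpa using aestronglyMeasurable_const
  | insert i I hi ih =>
    simp only [Finset.sum_insert hi]
    simpa using aestronglyMeasurable_linearCombination (hf i (Finset.mem_insert_self i I))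
      (ih fun j hj => hf j (Finset.mem_insert_of_mem hj)) (a i) 1

theorem aestronglyMeasurable_comp_mk {Ω E α β : Type*} [TopologicalSpace E] [MeasurableSpace E]
    [BorelSpace E] [TopologicalSpace.PseudoMetrizableSpace E]
    [TopologicalSpace β] [MeasurableSpace β] [BorelSpace β]
    [TopologicalSpace.PseudoMetrizableSpace β] [SecondCountableTopology β] [MeasurableSpace α]
    {m m₀ : MeasurableSpace Ω} {μ : Measure[m₀] Ω} {f : Ω → E} {w : Ω → α}
    (hf : AEStronglyMeasurable[m] f μ) (hw : Measurable[m] w) {H : E × α → β} (hH : Measurable H) :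
    AEStronglyMeasurable[m] (fun ω => H (f ω, w ω)) μ := by
  refine ⟨fun ω => H (hf.mk f ω, w ω), ?_, ?_⟩
  · exact (hH.comp (hf.stronglyMeasurable_mk.measurable.prodMk hw)).stronglyMeasurable
  · filter_upwards [hf.ae_eq_mk] with ω hω
    rw [← hω]

section
variable {d : ℕ} {Ξ Ω ι : Type*} [MeasurableSpace Ξ] [MeasurableSpace Ω]
  {F' : EuclideanSpace ℝ (Fin d) → Ξ → ℝ} {K : NNReal}
  {G : EuclideanSpace ℝ (Fin d) × Ξ → EuclideanSpace ℝ (Fin d)} {P : Measure Ξ}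
  [IsProbabilityMeasure P] {Pr : Measure Ω} [IsProbabilityMeasure Pr]
  {W : ι → Ω → EuclideanSpace ℝ (Fin d) × Ξ}

local notation "𝔼" => EuclideanSpace ℝ (Fin d)

/-- At a random point smoothed by an independent uniform perturbation, the subgradient is almost
surely unique. -/
theorem IsAEGradient.ae_eq_of_isSubgradientOn (h : IsAEGradient F' K G)
    (hW : ∀ j, Measurable (W j)) (hi : iIndepFun W Pr)
    (hlaw : ∀ j, Pr.map (W j) = (uniformBall d).prod P) {S : Set ι} {j : ι} (hj : j ∉ S)
    {F : 𝔼 → Ξ → ℝ} {D : Set 𝔼} (hF : ∀ᵐ s ∂P, ∀ x ∈ D, F' x s = F x s) {y g : Ω → 𝔼}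
    (hy : AEStronglyMeasurable[history W S] y Pr) {u : ℝ} (hu : 0 < u)
    (hyD : ∀ ω, Metric.closedBall (y ω) u ⊆ D)
    (hg : ∀ᵐ ω ∂Pr, IsSubgradientOn (fun p => F p (W j ω).2) D (y ω + u • (W j ω).1) (g ω)) :
    g =ᵐ[Pr] fun ω => G (y ω + u • (W j ω).1, (W j ω).2) := by
  -- Independence is applied to a past-measurable representative of `y`, since `y` itself is
  -- measurable only up to a null set.
  have h1 : ∀ᵐ ω ∂Pr, ∀ b : Fin d × Bool, Filter.Tendsto
      (fun n => diffQuot F' (signedBasis b) n (hy.mk y ω + u • (W j ω).1, (W j ω).2)) Filter.atTop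
      (nhds (inner ℝ (G (hy.mk y ω + u • (W j ω).1, (W j ω).2)) (signedBasis b))) := by
    refine ae_all_iff.2 fun b => ?_
    refine ae_history hW hi hj (hlaw j) hy.stronglyMeasurable_mk.measurable
      (p := fun q : 𝔼 × (𝔼 × Ξ) => Filter.Tendsto
      (fun n => diffQuot F' (signedBasis b) n (q.1 + u • q.2.1, q.2.2)) Filter.atTop
      (nhds (inner ℝ (G (q.1 + u • q.2.1, q.2.2)) (signedBasis b)))) ?_
      (fun a => h.ae_tendsto hu.ne' a (signedBasis b))
    have hsh : Measurable fun q : 𝔼 × (𝔼 × Ξ) => (q.1 + u • q.2.1, q.2.2) := by fun_prop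
    exact measurableSet_tendsto_fun
      (fun n => (measurable_diffQuot h.meas h.lip (signedBasis b) n).comp hsh)
      ((h.meas_grad.comp hsh).inner measurable_const)
  have h2 : ∀ᵐ ω ∂Pr, ‖(W j ω).1‖ < 1 ∧ ∀ x ∈ D, F' x (W j ω).2 = F x (W j ω).2 := by
    refine ae_of_ae_map (hW j).aemeasurable (p := fun w => ‖w.1‖ < 1 ∧ ∀ x ∈ D, F' x w.2 = F x w.2)
      ?_
    rw [hlaw j]
    exact (Measure.quasiMeasurePreserving_fst.ae ae_uniformBall_norm_lt).and
      (Measure.quasiMeasurePreserving_snd.ae hF)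
  filter_upwards [h1, h2, hy.ae_eq_mk, hg] with ω h1 h2 h3 hg
  rw [← h3] at h1
  refine eq_of_isSubgradientOn h2.2 hg ?_ h1
  refine Filter.mem_of_superset (Metric.isOpen_ball.mem_nhds ?_)
    (Metric.ball_subset_closedBall.trans (hyD ω))
  rw [Metric.mem_ball, dist_eq_norm, add_sub_cancel_left, norm_smul, Real.norm_of_nonneg hu.le]
  nlinarith [h2.1]

end

section
variable {d m : ℕ} {Ξ Ω : Type*} [MeasurableSpace Ω] {Pr : Measure Ω}
  {Z : ℕ → Fin m → Ω → EuclideanSpace ℝ (Fin d)} {ξ : ℕ → Fin m → Ω → Ξ}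
  {X D : Set (EuclideanSpace ℝ (Fin d))} {F F' : EuclideanSpace ℝ (Fin d) → Ξ → ℝ}
  {φ ψ : EuclideanSpace ℝ (Fin d) → ℝ} {us L η : ℕ → ℝ}
  {g : ℕ → Fin m → Ω → EuclideanSpace ℝ (Fin d)} {x₀ z₀ : EuclideanSpace ℝ (Fin d)}
  {x y z : ℕ → Ω → EuclideanSpace ℝ (Fin d)}

local notation "𝔼" => EuclideanSpace ℝ (Fin d)

theorem IsRun.z_mem' (hr : IsRun Pr X D F φ ψ us L η Z ξ g x₀ z₀ x y z) (t : ℕ) (ω : Ω) :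
    z t ω ∈ X := by
  cases t with
  | zero => rw [hr.z_zero]; exact hr.z₀_mem
  | succ t => exact hr.z_mem t ω

theorem IsRun.x_mem (hr : IsRun Pr X D F φ ψ us L η Z ξ g x₀ z₀ x y z) (hX : Convex ℝ X)
    (t : ℕ) (ω : Ω) : x t ω ∈ X := by
  induction t with
  | zero => rw [hr.x_zero]; exact hr.x₀_mem
  | succ t ih =>
    rw [hr.x_update]
    exact hX ih (hr.z_mem t ω) (by linarith [theta_le_one t]) (theta_pos t).le (by ring)

theorem IsRun.y_mem (hr : IsRun Pr X D F φ ψ us L η Z ξ g x₀ z₀ x y z) (hX : Convex ℝ X)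
    (t : ℕ) (ω : Ω) : y t ω ∈ X := by
  rw [hr.y_update]
  exact hX (hr.x_mem hX t ω) (hr.z_mem' t ω) (by linarith [theta_le_one t]) (theta_pos t).le
    (by ring)

variable [MeasurableSpace Ξ] {P : Measure Ξ}

/-- The inputs of the algorithm, as a single family. -/
def inputs {Ω Ξ : Type*} (Z : ℕ → Fin m → Ω → 𝔼) (ξ : ℕ → Fin m → Ω → Ξ) (p : ℕ × Fin m) (ω : Ω) :
    𝔼 × Ξ :=
  (Z p.1 p.2 ω, ξ p.1 p.2 ω)

theorem IsSampling.measurable_inputs (hs : IsSampling Pr (uniformBall d) P Z ξ) (j : ℕ × Fin m) :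
    Measurable (inputs Z ξ j) :=
  (hs.measurable_Z j.1 j.2).prodMk (hs.measurable_ξ j.1 j.2)

theorem IsSampling.map_inputs (hs : IsSampling Pr (uniformBall d) P Z ξ) (j : ℕ × Fin m) :
    Pr.map (inputs Z ξ j) = (uniformBall d).prod P :=
  (hs.law j.1 j.2).map_eq

theorem IsSampling.iIndepFun_inputs (hs : IsSampling Pr (uniformBall d) P Z ξ) :
    iIndepFun (inputs Z ξ) Pr :=
  hs.indep

variable [IsProbabilityMeasure P] [IsProbabilityMeasure Pr] {K : NNReal}
  {G : EuclideanSpace ℝ (Fin d) × Ξ → EuclideanSpace ℝ (Fin d)}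

/-- The iterates at step `t` are functions of the inputs used before that step, and the oracle
answers are almost surely given by the measurable gradient. -/
theorem IsRun.adapted (hr : IsRun Pr X D F φ ψ us L η Z ξ g x₀ z₀ x y z)
    (hs : IsSampling Pr (uniformBall d) P Z ξ) (hX : IsCompact X) (hXc : Convex ℝ X)
    (hφ : ConvexOn ℝ X φ) (hφc : LowerSemicontinuousOn φ X) (hψ : ∀ v, ψ v = 1 / 2 * ‖v‖ ^ 2)
    (hβ : ∀ t, 0 < L t + η t * (theta t)⁻¹) (hus : ∀ t, 0 < us t)
    (hball : ∀ t, ∀ p ∈ X, Metric.closedBall p (us t) ⊆ D)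
    (h : IsAEGradient F' K G) (hF : ∀ᵐ s ∂P, ∀ x ∈ D, F' x s = F x s) (t : ℕ) :
    AEStronglyMeasurable[history (inputs Z ξ) (pastIndices m t)] (y t) Pr ∧
    AEStronglyMeasurable[history (inputs Z ξ) (pastIndices m t)] (z t) Pr ∧
    ∀ i, g t i =ᵐ[Pr] fun ω => G (y t ω + us t • Z t i ω, ξ t i ω) := by
  set W := inputs Z ξ with hWdef
  have hstep : ∀ t, AEStronglyMeasurable[history W (pastIndices m t)] (x t) Pr →
      AEStronglyMeasurable[history W (pastIndices m t)] (z t) Pr →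
      AEStronglyMeasurable[history W (pastIndices m t)] (y t) Pr ∧
      ∀ i, g t i =ᵐ[Pr] fun ω => G (y t ω + us t • Z t i ω, ξ t i ω) := by
    intro t hx hz
    have hy : AEStronglyMeasurable[history W (pastIndices m t)] (y t) Pr := by
      have : y t = fun ω => (1 - theta t) • x t ω + theta t • z t ω := funext (hr.y_update t)
      rw [this]
      exact aestronglyMeasurable_linearCombination hx hz _ _
    refine ⟨hy, fun i => ?_⟩
    exact h.ae_eq_of_isSubgradientOn (j := (t, i)) hs.measurable_inputs hs.iIndepFun_inputs
      hs.map_inputs (notMem_pastIndices t i) hF hy (hus t)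
      (fun ω => hball t _ (hr.y_mem hXc t ω)) (hr.oracle t i)
  have hmono : ∀ {s t : ℕ}, s ≤ t → ∀ {f : Ω → 𝔼},
      AEStronglyMeasurable[history W (pastIndices m s)] f Pr →
      AEStronglyMeasurable[history W (pastIndices m t)] f Pr := fun hst _ hf =>
    hf.mono (history_mono W (pastIndices_mono m hst))
  -- Identifying the oracle answer at step `t` requires `y t` to be adapted, and adaptedness at `t +
  -- 1` requires the answers up to `t`; the two are proved in one induction.
  have main : ∀ t, AEStronglyMeasurable[history W (pastIndices m t)] (x t) Pr ∧
      AEStronglyMeasurable[history W (pastIndices m t)] (z t) Pr ∧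
      ∀ s < t, ∀ i, AEStronglyMeasurable[history W (pastIndices m t)] (g s i) Pr := by
    intro t
    induction t with
    | zero =>
      refine ⟨?_, ?_, fun s hs => absurd hs (Nat.not_lt_zero s)⟩
      · rw [funext (hr.x_zero)]; exact aestronglyMeasurable_const
      · rw [funext (hr.z_zero)]; exact aestronglyMeasurable_const
    | succ t ih =>
      obtain ⟨hx, hz, hg⟩ := ih
      obtain ⟨hy, hgt⟩ := hstep t hx hz
      have hg' : ∀ s < t + 1, ∀ i,
          AEStronglyMeasurable[history W (pastIndices m (t + 1))] (g s i) Pr := by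
        intro s hst i
        rcases Nat.lt_succ_iff_lt_or_eq.1 hst with hlt | rfl
        · exact hmono (Nat.le_succ t) (hg s hlt i)
        · have hy' := hmono (Nat.le_succ s) hy
          have hWm : Measurable[history W (pastIndices m (s + 1))] (W (s, i)) :=
            measurable_history W (Nat.lt_succ_self s)
          refine AEStronglyMeasurable.congr ?_ (hgt i).symm
          exact aestronglyMeasurable_comp_mk hy' hWm (h.meas_grad.comp
            (show Measurable fun q : 𝔼 × (𝔼 × Ξ) => (q.1 + us s • q.2.1, q.2.2) by fun_prop))
      have hz' : AEStronglyMeasurable[history W (pastIndices m (t + 1))] (z (t + 1)) Pr := by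
        obtain ⟨A, hAc, hA⟩ := exists_continuous_argmin hX ⟨x₀, hr.x₀_mem⟩ hφ hφc (hβ (t + 1))
          (c := ∑ τ ∈ Finset.range (t + 1), (theta τ)⁻¹)
          (Finset.sum_nonneg fun τ _ => inv_nonneg.2 (theta_pos τ).le)
        have hzA : z (t + 1) = fun ω =>
            A (∑ τ ∈ Finset.range (t + 1), (theta τ)⁻¹ • batchMean g τ ω) := by
          funext ω
          refine hA _ _ (hr.z_mem t ω) ?_
          have := hr.z_update t ω
          simp only [IsMinOn, IsMinFilter, dualAveragingObjective_eq hψ] at this ⊢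
          simpa only [mul_add, Finset.sum_add_distrib, ← Finset.sum_mul, sum_inner,
            real_inner_smul_left] using this
        rw [hzA]
        refine hAc.comp_aestronglyMeasurable ?_
        refine aestronglyMeasurable_weightedSum (fun τ hτ => ?_) _
        have := aestronglyMeasurable_weightedSum (I := Finset.univ)
          (fun i _ => hg' τ (Finset.mem_range.1 hτ) i) fun _ => (m : ℝ)⁻¹
        simp only [← Finset.smul_sum] at this
        exact this
      refine ⟨?_, hz', hg'⟩
      rw [funext (hr.x_update t)]
      exact aestronglyMeasurable_linearCombination (hmono (Nat.le_succ t) hx) hz' _ _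
  exact ⟨(hstep t (main t).1 (main t).2.1).1, (main t).2.1, (hstep t (main t).1 (main t).2.1).2⟩

end

/-! ### The gap of the randomized method -/

section
variable {d m : ℕ} {Ξ Ω : Type*} [MeasurableSpace Ξ] [MeasurableSpace Ω]

local notation "𝔼" => EuclideanSpace ℝ (Fin d)

theorem theta_antitone : Antitone theta := fun _ _ hst =>
  (inv_le_inv₀ (theta_pos _) (theta_pos _)).1 (inv_theta_mono hst)

theorem batchMean_sub_eq_batchNoise {Ω : Type*} (hm : 1 ≤ m) {P : Measure Ξ} {G : 𝔼 × Ξ → 𝔼}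
    {Z : ℕ → Fin m → Ω → 𝔼} {ξ : ℕ → Fin m → Ω → Ξ} {g : ℕ → Fin m → Ω → 𝔼} {us : ℕ → ℝ}
    {y y' : ℕ → Ω → 𝔼} {t : ℕ} {ω : Ω} (hy : y t ω = y' t ω)
    (hg : ∀ i, g t i ω = G (y t ω + us t • Z t i ω, ξ t i ω)) :
    batchMean g t ω - meanGradient P G (us t) (y t ω)
      = batchNoise P G (inputs Z ξ) us y' t ω := by
  have hm0 : (m : ℝ) ≠ 0 := by positivity
  simp only [batchMean, batchNoise, gradNoise, inputs, hg, ← hy, Finset.sum_sub_distrib, smul_sub,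
    Finset.sum_const, Finset.card_univ, Fintype.card_fin]
  rw [← Nat.cast_smul_eq_nsmul ℝ, inv_smul_smul₀ hm0]

/-- The bound on the gap along a single trajectory. -/
theorem trajectory_gap_le (hd : 1 ≤ d) {X : Set 𝔼} {φ ψ f : 𝔼 → ℝ} {K : NNReal} {R u : ℝ}
    {us L η : ℕ → ℝ} (hu : 0 < u) (hXc : Convex ℝ X) (hφ : ConvexOn ℝ X φ)
    (hψ : ∀ v, ψ v = 1 / 2 * ‖v‖ ^ 2) (hus : ∀ t, us t = u * theta t)
    (hL : ∀ t, L t = K * √(d : ℝ) / us t) (hη : ∀ t, 0 < η t) (hηm : Monotone η)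
    (hf : LipschitzWith K f) (hconv : ConvexOn ℝ (X + Metric.closedBall 0 u) f)
    {G Gb x y z : ℕ → 𝔼} {xs : 𝔼} (hxs : xs ∈ X) (hrad : ∀ x ∈ X, ‖x - xs‖ ≤ R)
    (hψs : ψ xs ≤ R ^ 2)
    (hGb : ∀ t v, inner ℝ (Gb t) v = smoothedDeriv f (us t) (y t) v)
    (hx0 : x 0 ∈ X) (hz : ∀ t, z t ∈ X)
    (hy : ∀ t, y t = (1 - theta t) • x t + theta t • z t)
    (hxu : ∀ t, x (t + 1) = (1 - theta t) • x t + theta t • z (t + 1))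
    (hmin : ∀ t, IsMinOn (dualAveragingObjective φ ψ L η G t) X (z (t + 1))) (n : ℕ) :
    (theta n)⁻¹ ^ 2 * (f (x (n + 1)) + φ (x (n + 1)) - f xs - φ xs) ≤
      (K * √(d : ℝ) / u * (theta (n + 1))⁻¹ + η (n + 1) * (theta (n + 1))⁻¹) * R ^ 2
      + 2 * (K * √(d : ℝ) / u + η 0) * R ^ 2 + K * u * (n + 1)
      + ∑ t ∈ Finset.range (n + 1), (theta t)⁻¹ * inner ℝ (G t - Gb t) (xs - z t)
      + ∑ t ∈ Finset.range (n + 1), (theta t)⁻¹ / (2 * η t) * ‖G t - Gb t‖ ^ 2 := by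
  have husp : ∀ t, 0 < us t := fun t => by rw [hus]; exact mul_pos hu (theta_pos t)
  have husu : ∀ t, us t ≤ u := fun t => by
    rw [hus]; exact mul_le_of_le_one_right hu.le (theta_le_one t)
  have hLa : ∀ t, L t = K * √(d : ℝ) / u * (theta t)⁻¹ := fun t => by
    rw [hL, hus, ← div_div, div_eq_mul_inv]
  have hL0 : ∀ t, 0 ≤ L t := fun t => by rw [hL]; have := husp t; positivity
  have hconv' : ∀ t, ConvexOn ℝ (X + Metric.closedBall 0 (us t)) f := fun t =>
    hconv.subset (Set.add_subset_add_left (Metric.closedBall_subset_closedBall (husu t)))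
      (hXc.add (convex_closedBall _ _))
  have hxX : ∀ t, x t ∈ X := by
    intro t
    induction t with
    | zero => exact hx0
    | succ t ih =>
      rw [hxu]
      exact hXc ih (hz _) (by linarith [theta_le_one t]) (theta_pos t).le (by ring)
  have hyX : ∀ t, y t ∈ X := fun t => by
    rw [hy]
    exact hXc (hxX t) (hz t) (by linarith [theta_le_one t]) (theta_pos t).le (by ring)
  have key := accelerated_gap_le (fs := fun t => smoothed f (us t)) (R := R) hφ hψ hL0 hη
    (fun s t hst => add_le_add
      (by
        rw [hLa, hLa]
        exact mul_le_mul_of_nonneg_left (inv_theta_mono hst) (by positivity))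
      (mul_le_mul (hηm hst) (inv_theta_mono hst) (inv_pos.2 (theta_pos s)).le (hη t).le))
    hx0 hz hy hxu hmin
    (fun t w hw => by
      rw [hGb]
      exact smoothed_add_smoothedDeriv_le hf (husp t) hXc (hconv' t) hw (hyX t))
    (fun t w hw => by
      have := smoothed_add_le hd hf (husp t) (y t) (w - y t)
      rwa [add_sub_cancel, ← hGb, ← hL] at this)
    (fun t w hw => le_smoothed_of_convexOn hf.continuous (husp _).le (by
      rw [hus, hus]
      exact mul_le_mul_of_nonneg_left (theta_antitone (Nat.le_succ t)) hu.le)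
        (husp t) (hconv' t) hw)
    (by
      have h1 := hrad _ (hz 1)
      have h2 := hrad _ (hz 0)
      have := norm_sub_le_norm_sub_add_norm_sub (z 1) xs (z 0)
      rw [norm_sub_rev xs] at this
      linarith) hxs n
  -- Smoothing only raises a convex function, so the bias is paid at `xs` alone.
  have hlow : f (x (n + 1)) ≤ smoothed f (us n) (x (n + 1)) := by
    have := le_smoothed_of_convexOn hf.continuous le_rfl (husp n).le (husp n) (hconv' n)
      (hxX (n + 1))
    rwa [smoothed_zero] at this
  have hsum : ∑ t ∈ Finset.range (n + 1), (theta t)⁻¹ * (smoothed f (us t) xs + φ xs)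
      ≤ (theta n)⁻¹ ^ 2 * (f xs + φ xs) + K * u * (n + 1) := by
    rw [← sum_inv_theta, Finset.sum_mul]
    have : K * u * ((n : ℝ) + 1) = ∑ t ∈ Finset.range (n + 1), (K : ℝ) * u := by
      simp; ring
    rw [this, ← Finset.sum_add_distrib]
    refine Finset.sum_le_sum fun t _ => ?_
    have h1 := smoothed_le_add hf (husp t).le xs
    -- The radius `u_t = u θ_t` makes the weighted bias the same at every step, so that it totals `K
    -- u (n + 1)`.
    have h2 : (theta t)⁻¹ * (K * us t) = K * u := by
      rw [hus]
      have := (theta_pos t).ne'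
      field_simp
    have h3 := mul_le_mul_of_nonneg_left h1 (inv_pos.2 (theta_pos t)).le
    linarith
  have hlow' := mul_le_mul_of_nonneg_left hlow (sq_nonneg (theta n)⁻¹)
  have hβ : (L (n + 1) + η (n + 1) * (theta (n + 1))⁻¹) * ψ xs
      ≤ (L (n + 1) + η (n + 1) * (theta (n + 1))⁻¹) * R ^ 2 :=
    mul_le_mul_of_nonneg_left hψs (add_nonneg (hL0 _)
      (mul_nonneg (hη _).le (inv_pos.2 (theta_pos _)).le))
  have hL00 : L 0 = K * √(d : ℝ) / u := by rw [hLa]; simp [theta]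
  rw [← hLa, ← hL00]
  linarith

/-- From the weighted gap to the rate. -/
theorem rate_of_weighted_gap_le {A gap w q T s M r l k mx : ℝ} (hw : 0 ≤ w) (hq : 0 ≤ q)
    (hs : 1 ≤ s) (hT : T = s ^ 2) (hM : 0 < M) (hA : T ^ 2 / 4 ≤ A)
    (hr : r ≤ 1 + k) (hk : 0 ≤ k) (hl0 : 0 ≤ l) (hl : l ≤ 2 * mx)
    (h : A * gap ≤ 5 * w * q * T + (10 + 3 * r) * (w * T * s / M) + 8 * (w * s * l / M)) :
    gap ≤ 64 * (w * q / T + w / (s * M) + w * k / (s * M) + w * mx / (T * M)) := by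
  have hs0 : 0 < s := by linarith
  have hT0 : 0 < T := by rw [hT]; positivity
  have hmx : 0 ≤ mx := by linarith
  have hrhs : 0 ≤ 64 * (w * q / T + w / (s * M) + w * k / (s * M) + w * mx / (T * M)) := by
    positivity
  -- Only a lower bound on the weight `A` is known, so the sign of the gap matters.
  rcases le_or_gt gap 0 with hg | hg
  · linarith
  have h1 : T ^ 2 / 4 * gap
      ≤ 5 * w * q * T + (10 + 3 * r) * (w * T * s / M) + 8 * (w * s * l / M) :=
    (mul_le_mul_of_nonneg_right hA hg.le).trans h
  -- Division by `T² / 4` multiplies the constants by four. After `h3` and `h4` they are `20`, `52`,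
  -- `12` and `64`, and the largest is the final constant.
  have h2 : gap ≤
      20 * (w * q / T) + (40 + 12 * r) * (w / (s * M)) + 32 * (w * l / (T * s * M)) := by
    have : 20 * (w * q / T) + (40 + 12 * r) * (w / (s * M)) + 32 * (w * l / (T * s * M))
        = (5 * w * q * T + (10 + 3 * r) * (w * T * s / M) + 8 * (w * s * l / M)) / (T ^ 2 / 4) := by
      rw [hT]; field_simp; ring
    rw [this, le_div_iff₀ (by positivity)]
    linarith
  have h3 : w * l / (T * s * M) ≤ 2 * (w * mx / (T * M)) := by
    have : w * l / (T * s * M) ≤ w * (2 * mx) / (T * 1 * M) := by gcongr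
    refine this.trans (le_of_eq ?_)
    ring
  have h4 : (40 + 12 * r) * (w / (s * M)) ≤ 52 * (w / (s * M)) + 12 * (w * k / (s * M)) := by
    have : (40 + 12 * r) * (w / (s * M)) ≤ (40 + 12 * (1 + k)) * (w / (s * M)) := by gcongr
    refine this.trans (le_of_eq ?_)
    ring
  have p1 : 0 ≤ w * q / T := by positivity
  have p2 : 0 ≤ w / (s * M) := by positivity
  have p3 : 0 ≤ w * k / (s * M) := by positivity
  have p4 : 0 ≤ w * mx / (T * M) := by positivity
  linarith

end

/-! ### The high-probability bound -/

section
variable {d m : ℕ} {Ξ Ω : Type*} [MeasurableSpace Ξ] [MeasurableSpace Ω]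
  {F : EuclideanSpace ℝ (Fin d) → Ξ → ℝ} {K : NNReal}
  {G : EuclideanSpace ℝ (Fin d) × Ξ → EuclideanSpace ℝ (Fin d)} {P : Measure Ξ}
  [IsProbabilityMeasure P] {Pr : Measure Ω} [IsProbabilityMeasure Pr]
  {W : ℕ × Fin m → Ω → EuclideanSpace ℝ (Fin d) × Ξ}

local notation "𝔼" => EuclideanSpace ℝ (Fin d)

theorem IsAEGradient.measure_sum_inner_ge_le (h : IsAEGradient F K G) (hm : 1 ≤ m)
    (hW : ∀ j, Measurable (W j)) (hi : iIndepFun W Pr)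
    (hlaw : ∀ j, Pr.map (W j) = (uniformBall d).prod P) {y z : ℕ → Ω → 𝔼}
    (hy : ∀ t, Measurable[history W (pastIndices m t)] (y t))
    (hz : ∀ t, Measurable[history W (pastIndices m t)] (z t)) (us : ℕ → ℝ) {xs : 𝔼} {R : ℝ}
    (hK : 0 < K) (hR : 0 < R) (hzR : ∀ t, ∀ᵐ ω ∂Pr, ‖xs - z t ω‖ ≤ R) {T : ℕ} (hT : 1 ≤ T)
    {δ : ℝ} (hδ : 0 < δ) (hδ1 : δ < 1) :
    Pr {ω | 3 * √(Real.log (1 / δ)) * (K * R * T * √(T : ℝ) / √(m : ℝ)) ≤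
        ∑ t ∈ Finset.range T, (theta t)⁻¹ * inner ℝ (batchNoise P G W us y t ω) (xs - z t ω)}
      ≤ ENNReal.ofReal δ := by
  have hm0 : (0 : ℝ) < m := by exact_mod_cast hm
  have hT0 : (0 : ℝ) < T := by exact_mod_cast hT
  have hK0 : (0 : ℝ) < K := hK
  set l := Real.log (1 / δ) with hl
  have hl0 : 0 < l := Real.log_pos (by rw [lt_div_iff₀ hδ]; linarith)
  have hll : √l * √l = l := Real.mul_self_sqrt hl0.le
  set w : ℝ := K * R * T * √(T : ℝ) / √(m : ℝ) with hw
  have hw0 : 0 < w := by positivity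
  have hw2 : w ^ 2 = K ^ 2 * R ^ 2 * T ^ 3 / m := by
    rw [hw, div_pow, mul_pow, Real.sq_sqrt hT0.le, Real.sq_sqrt hm0.le]; ring
  -- Scale for Chernoff's bound: the log-moment is at most `2 c² w² = 2 l`, the tail adds `l`, and
  -- `3 l / c = 3 √l w`.
  set c : ℝ := √l / w with hc
  have hc0 : 0 < c := div_pos (Real.sqrt_pos.2 hl0) hw0
  set v : ℕ → Ω → 𝔼 := fun t ω => (c * (theta t)⁻¹) • (xs - z t ω) with hv
  have hvm : ∀ t, Measurable[history W (pastIndices m t)] (v t) := fun t =>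
    (show Measurable fun p : 𝔼 => (c * (theta t)⁻¹) • (xs - p) by fun_prop).comp (hz t)
  have hvb : ∀ t, ∀ᵐ ω ∂Pr, ‖v t ω‖ ≤ c * (theta t)⁻¹ * R := fun t => by
    have := (inv_pos.2 (theta_pos t)).le
    filter_upwards [hzR t] with ω hω
    rw [hv, norm_smul, Real.norm_of_nonneg (by positivity)]
    gcongr
  have hB : ∑ t ∈ Finset.range T, 2 * (K : ℝ) ^ 2 * (c * (theta t)⁻¹ * R) ^ 2 / m ≤ 2 * l := by
    have h1 : ∀ t ∈ Finset.range T, 2 * (K : ℝ) ^ 2 * (c * (theta t)⁻¹ * R) ^ 2 / m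
        ≤ 2 * (K : ℝ) ^ 2 * (c * T * R) ^ 2 / m := by
      intro t ht
      have h2 := inv_theta_le t
      have h3 : (t : ℝ) + 1 ≤ T := by exact_mod_cast Finset.mem_range.1 ht
      have := (inv_pos.2 (theta_pos t)).le
      gcongr
      exact h2.trans h3
    refine (Finset.sum_le_sum h1).trans (le_of_eq ?_)
    rw [Finset.sum_const, Finset.card_range, nsmul_eq_mul]
    have : (T : ℝ) * (2 * (K : ℝ) ^ 2 * (c * T * R) ^ 2 / m)
        = 2 * c ^ 2 * (K ^ 2 * R ^ 2 * T ^ 3 / m) := by ring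
    rw [this, ← hw2, hc, div_pow, mul_assoc, div_mul_cancel₀ _ (by positivity), sq, hll]
  have hM := h.lintegral_exp_sum_inner_le hm hW hi hlaw hy hvm us hvb T
  have hmeas := (h.measurable_sum_batchNoise (P := P) hy hvm us
    (q := fun _ e v => inner ℝ e v) (fun _ => by fun_prop) T).mono (history_le hW _) le_rfl
  have hch := measure_ge_le_of_lintegral_exp_le hmeas hδ
    (hM.trans (ENNReal.ofReal_le_ofReal (Real.exp_le_exp.2 hB)))
  refine (measure_mono fun ω hω => ?_).trans hch
  have hω' : 3 * √l * w ≤ _ := hω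
  have h1 := mul_le_mul_of_nonneg_left hω' hc0.le
  have h2 : c * (3 * √l * w) = 3 * l := by
    rw [hc]
    field_simp
    rw [sq, hll]
  rw [h2, Finset.mul_sum] at h1
  change 2 * l + l ≤ _
  refine le_trans (by linarith) (h1.trans (le_of_eq (Finset.sum_congr rfl fun t _ => ?_)))
  simp only [hv, inner_smul_right]
  ring

theorem IsAEGradient.measure_sum_norm_sq_ge_le (h : IsAEGradient F K G) (hm : 1 ≤ m)
    (hW : ∀ j, Measurable (W j)) (hi : iIndepFun W Pr)
    (hlaw : ∀ j, Pr.map (W j) = (uniformBall d).prod P) {y : ℕ → Ω → 𝔼}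
    (hy : ∀ t, Measurable[history W (pastIndices m t)] (y t)) (us : ℕ → ℝ) {R : ℝ}
    (hK : 0 < K) (hR : 0 < R) {η : ℕ → ℝ} (hη : ∀ t : ℕ, η t = K * √((t : ℝ) + 1) / (R * √(m : ℝ)))
    {T : ℕ} (hT : 1 ≤ T) {δ : ℝ} (hδ : 0 < δ) :
    Pr {ω | 4 * (K * R * T * √(T : ℝ) / √(m : ℝ))
          + 8 * (K * R * √(T : ℝ) * Real.log (1 / δ) / √(m : ℝ)) ≤
        ∑ t ∈ Finset.range T, (theta t)⁻¹ / (2 * η t) * ‖batchNoise P G W us y t ω‖ ^ 2}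
      ≤ ENNReal.ofReal δ := by
  have hm0 : (0 : ℝ) < m := by exact_mod_cast hm
  have hT0 : (0 : ℝ) < T := by exact_mod_cast hT
  have hK0 : (0 : ℝ) < K := hK
  have hmm : √(m : ℝ) * √(m : ℝ) = m := Real.mul_self_sqrt hm0.le
  set l := Real.log (1 / δ) with hl
  -- Chosen so that `16 K² r_t = m a_t / (√(t+1) √T)`, which is at most `m` because `a_t ≤ t + 1 ≤
  -- T`. Dividing `T/2 + log (1/δ)` by `c` gives the two terms of the threshold.
  set c : ℝ := √(m : ℝ) / (8 * R * K * √(T : ℝ)) with hc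
  have hc0 : 0 < c := by positivity
  have hη0 : ∀ t, 0 < η t := fun t => by rw [hη]; positivity
  set r : ℕ → ℝ := fun t => c * ((theta t)⁻¹ / (2 * η t)) with hr
  have hr0 : ∀ t, 0 ≤ r t := fun t => by
    have := (inv_pos.2 (theta_pos t)).le
    have := (hη0 t).le
    positivity
  have hrm : ∀ t < T, 16 * (K : ℝ) ^ 2 * r t ≤ m := by
    intro t ht
    have h1 := inv_theta_le t
    have h3 : √((t : ℝ) + 1) ≤ √(T : ℝ) := Real.sqrt_le_sqrt (by exact_mod_cast ht)
    have h4 : √((t : ℝ) + 1) * √((t : ℝ) + 1) = t + 1 := Real.mul_self_sqrt (by positivity)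
    have h5 : 0 < √((t : ℝ) + 1) := Real.sqrt_pos.2 (by positivity)
    have e : 16 * (K : ℝ) ^ 2 * r t = m * ((theta t)⁻¹ / (√((t : ℝ) + 1) * √(T : ℝ))) := by
      rw [hr, hc]
      simp only [hη]
      have : (m : ℝ) = √(m : ℝ) ^ 2 := by rw [sq, hmm]
      rw [this, Real.sqrt_sq (Real.sqrt_nonneg _)]
      field_simp
      ring
    rw [e]
    refine mul_le_of_le_one_right hm0.le ?_
    rw [div_le_one (by positivity)]
    nlinarith
  have hB : ∑ t ∈ Finset.range T, 8 * (K : ℝ) ^ 2 * r t / m ≤ (T : ℝ) / 2 := by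
    have h1 : ∀ t ∈ Finset.range T, 8 * (K : ℝ) ^ 2 * r t / m ≤ 1 / 2 := by
      intro t ht
      rw [div_le_iff₀ hm0]
      linarith [hrm t (Finset.mem_range.1 ht)]
    refine (Finset.sum_le_sum h1).trans (le_of_eq ?_)
    rw [Finset.sum_const, Finset.card_range, nsmul_eq_mul]
    ring
  have hM := h.lintegral_exp_sum_norm_sq_le hm hW hi hlaw hy us hr0 T hrm
  have hmeas := (h.measurable_sum_batchNoise (P := P) hy hy us
    (q := fun t e _ => r t * ‖e‖ ^ 2) (fun _ => by fun_prop) T).mono (history_le hW _) le_rfl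
  have hch := measure_ge_le_of_lintegral_exp_le hmeas hδ
    (hM.trans (ENNReal.ofReal_le_ofReal (Real.exp_le_exp.2 hB)))
  refine (measure_mono fun ω hω => ?_).trans hch
  have h1 := mul_le_mul_of_nonneg_left (show _ ≤ _ from hω) hc0.le
  have h2 : c * (4 * (K * R * T * √(T : ℝ) / √(m : ℝ)) + 8 * (K * R * √(T : ℝ) * l / √(m : ℝ)))
      = (T : ℝ) / 2 + l := by
    rw [hc]
    field_simp
    ring
  rw [h2, Finset.mul_sum] at h1
  change (T : ℝ) / 2 + l ≤ _
  refine h1.trans (le_of_eq (Finset.sum_congr rfl fun t _ => ?_))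
  simp only [hr]
  ring

end

/-- The weighted gap after `n + 1` steps, outside an event of small probability. -/
theorem highProbability_gap_le {d m : ℕ} (hd : 1 ≤ d) (hm : 1 ≤ m)
    {L₀ R : ℝ} (hL₀ : 0 < L₀) (hR : 0 < R)
    {Ξ : Type*} [MeasurableSpace Ξ] {P : Measure Ξ} [IsProbabilityMeasure P]
    {Ω : Type*} [MeasurableSpace Ω] {Pr : Measure Ω} [IsProbabilityMeasure Pr]
    {X D : Set (EuclideanSpace ℝ (Fin d))}
    {F : EuclideanSpace ℝ (Fin d) → Ξ → ℝ}
    {φ ψ : EuclideanSpace ℝ (Fin d) → ℝ}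
    {xstar : EuclideanSpace ℝ (Fin d)}
    {u : ℝ} {us L η : ℕ → ℝ}
    (hX : IsCompact X) (hXconv : Convex ℝ X)
    (hxstar : xstar ∈ X) (hrad : ∀ x ∈ X, ‖x - xstar‖ ≤ R)
    (hφ : ConvexOn ℝ X φ) (hφ_closed : LowerSemicontinuousOn φ X)
    (hψ : ∀ x, ψ x = 1 / 2 * ‖x‖ ^ 2) (hψstar : ψ xstar ≤ R ^ 2)
    (hu : 0 < u)
    (hus : ∀ t, us t = u * theta t)
    (hL : ∀ t, L t = L₀ * √(d : ℝ) / us t)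
    (hη : ∀ t : ℕ, η t = L₀ * √((t : ℝ) + 1) / (R * √(m : ℝ)))
    (hD : D = X + Metric.closedBall 0 u)
    (hFint : ∀ x ∈ D, Integrable (F x) P)
    (hFlip : ∀ᵐ s ∂P, ∀ x ∈ D, ∀ y ∈ D, |F x s - F y s| ≤ L₀ * ‖x - y‖)
    (hf : ConvexOn ℝ D (expectedObjective P F))
    {Z : ℕ → Fin m → Ω → EuclideanSpace ℝ (Fin d)} {ξ : ℕ → Fin m → Ω → Ξ}
    {g : ℕ → Fin m → Ω → EuclideanSpace ℝ (Fin d)}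
    {x₀ z₀ : EuclideanSpace ℝ (Fin d)}
    {x y z : ℕ → Ω → EuclideanSpace ℝ (Fin d)}
    (hsampling : IsSampling Pr (uniformBall d) P Z ξ)
    (hrun : IsRun Pr X D F φ ψ us L η Z ξ g x₀ z₀ x y z)
    (n : ℕ) {δ : ℝ} (hδ0 : 0 < δ) (hδ1 : δ < 1) :
    ∃ B : Set Ω, Pr B ≤ ENNReal.ofReal δ + ENNReal.ofReal δ ∧ ∀ᵐ ω ∂Pr, ω ∉ B →
      (theta n)⁻¹ ^ 2 * (expectedObjective P F (x (n + 1) ω) + φ (x (n + 1) ω)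
          - expectedObjective P F xstar - φ xstar) ≤
      (L₀ * √(d : ℝ) / u * (theta (n + 1))⁻¹ + η (n + 1) * (theta (n + 1))⁻¹) * R ^ 2
      + 2 * (L₀ * √(d : ℝ) / u + η 0) * R ^ 2 + L₀ * u * (n + 1)
      + 3 * √(Real.log (1 / δ))
        * (L₀ * R * (n + 1 : ℕ) * √((n + 1 : ℕ) : ℝ) / √(m : ℝ))
      + (4 * (L₀ * R * (n + 1 : ℕ) * √((n + 1 : ℕ) : ℝ) / √(m : ℝ))
        + 8 * (L₀ * R * √((n + 1 : ℕ) : ℝ) * Real.log (1 / δ) / √(m : ℝ))) := by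
  obtain ⟨K, rfl⟩ : ∃ K : NNReal, L₀ = K := ⟨⟨L₀, hL₀.le⟩, rfl⟩
  have hK : 0 < K := by exact_mod_cast hL₀
  have hm0 : (0 : ℝ) < m := by exact_mod_cast hm
  have hd0 : (0 : ℝ) < d := by exact_mod_cast hd
  have hXD : X ⊆ D := fun p hp => by
    rw [hD]
    exact ⟨p, hp, 0, Metric.mem_closedBall_self hu.le, add_zero p⟩
  have hxD := hXD hxstar
  have husp : ∀ t, 0 < us t := fun t => by rw [hus]; exact mul_pos hu (theta_pos t)
  have hη0 : ∀ t, 0 < η t := fun t => by rw [hη]; positivity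
  have hηm : Monotone η := fun s t hst => by
    rw [hη, hη]
    gcongr
  have hball : ∀ t, ∀ p ∈ X, Metric.closedBall p (us t) ⊆ D := by
    intro t p hp q hq
    rw [hD]
    refine ⟨p, hp, q - p, ?_, by simp⟩
    rw [Metric.mem_closedBall, dist_zero_right, ← dist_eq_norm]
    refine (Metric.mem_closedBall.1 hq).trans ?_
    rw [hus]
    exact mul_le_of_le_one_right hu.le (theta_le_one t)
  -- the Lipschitz extension and its gradient
  obtain ⟨F', hF'm, hF'l, hF'⟩ := exists_lipschitzWith_extension ⟨xstar, hxD⟩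
    (fun p hp => (hFint p hp).aestronglyMeasurable) hFlip
  obtain ⟨G, h⟩ := exists_isAEGradient hF'm hF'l
  have hint : ∀ p, Integrable (F' p) P := by
    intro p
    have h0 : Integrable (F' xstar) P := (hFint _ hxD).congr (by
      filter_upwards [hF'] with s hs using (hs _ hxD).symm)
    refine (h0.abs.add (integrable_const (K * dist p xstar))).mono' (hF'm p).aestronglyMeasurable
      (Filter.Eventually.of_forall fun s => ?_)
    have h1 := (hF'l s).dist_le_mul p xstar
    rw [Real.dist_eq] at h1
    have h2 := abs_sub_abs_le_abs_sub (F' p s) (F' xstar s)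
    rw [Real.norm_eq_abs]
    simp only [Pi.add_apply]
    linarith
  have hfeq : ∀ p ∈ D, expectedObjective P F' p = expectedObjective P F p := fun p hp =>
    integral_congr_ae (by filter_upwards [hF'] with s hs using hs p hp)
  have hconv : ConvexOn ℝ (X + Metric.closedBall 0 u) (expectedObjective P F') := by
    rw [← hD]
    exact hf.congr fun p hp => (hfeq p hp).symm
  have hlip := h.lipschitzWith_expectedObjective hint
  have hβ : ∀ t, 0 < L t + η t * (theta t)⁻¹ := fun t => by
    have := husp t
    have := hη0 t
    have := inv_pos.2 (theta_pos t)
    rw [hL]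
    positivity
  have had := fun t => hrun.adapted hsampling hX hXconv hφ hφ_closed hψ hβ husp hball h hF' t
  set W := inputs Z ξ with hWdef
  have hW := hsampling.measurable_inputs
  have hi := hsampling.iIndepFun_inputs
  have hlaw := hsampling.map_inputs
  -- The exponential moment bounds require genuinely past-measurable processes; these versions agree
  -- with the run almost surely, simultaneously for all `t`.
  set y' : ℕ → Ω → EuclideanSpace ℝ (Fin d) := fun t => (had t).1.mk (y t)
  set z' : ℕ → Ω → EuclideanSpace ℝ (Fin d) := fun t => (had t).2.1.mk (z t)
  have hy'm : ∀ t, Measurable[history W (pastIndices m t)] (y' t) := fun t =>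
    (had t).1.stronglyMeasurable_mk.measurable
  have hz'm : ∀ t, Measurable[history W (pastIndices m t)] (z' t) := fun t =>
    (had t).2.1.stronglyMeasurable_mk.measurable
  have hyy : ∀ᵐ ω ∂Pr, ∀ t, y t ω = y' t ω := ae_all_iff.2 fun t => (had t).1.ae_eq_mk
  have hzz : ∀ᵐ ω ∂Pr, ∀ t, z t ω = z' t ω := ae_all_iff.2 fun t => (had t).2.1.ae_eq_mk
  have hgg : ∀ᵐ ω ∂Pr, ∀ t i, g t i ω = G (y t ω + us t • Z t i ω, ξ t i ω) :=
    ae_all_iff.2 fun t => ae_all_iff.2 fun i => (had t).2.2 i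
  have hzR : ∀ t, ∀ᵐ ω ∂Pr, ‖xstar - z' t ω‖ ≤ R := fun t => by
    filter_upwards [hzz] with ω hω
    rw [← hω t, norm_sub_rev]
    exact hrad _ (hrun.z_mem' t ω)
  have hN := h.measure_sum_inner_ge_le hm hW hi hlaw hy'm hz'm us hK hR hzR
    (Nat.succ_le_succ (Nat.zero_le n)) hδ0 hδ1
  have hQ := h.measure_sum_norm_sq_ge_le hm hW hi hlaw hy'm us hK hR hη
    (Nat.succ_le_succ (Nat.zero_le n)) hδ0
  refine ⟨_, (measure_union_le _ _).trans (add_le_add hN hQ), ?_⟩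
  filter_upwards [hyy, hzz, hgg] with ω hy hz hg hω
  simp only [Set.mem_union, Set.mem_ofPred_eq, not_or, not_le] at hω
  obtain ⟨hN, hQ⟩ := hω
  have key := trajectory_gap_le hd hu hXconv hφ hψ hus hL hη0 hηm hlip hconv
    (G := fun t => batchMean g t ω) (Gb := fun t => meanGradient P G (us t) (y t ω))
    (x := fun t => x t ω) (y := fun t => y t ω) (z := fun t => z t ω) hxstar hrad hψstar
    (fun t v => h.inner_meanGradient hint (husp t).ne' (y t ω) v)
    (hrun.x_mem hXconv 0 ω) (fun t => hrun.z_mem' t ω) (fun t => hrun.y_update t ω)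
    (fun t => hrun.x_update t ω) (fun t => hrun.z_update t ω) n
  have he : ∀ t, batchMean g t ω - meanGradient P G (us t) (y t ω) = batchNoise P G W us y' t ω :=
    fun t => batchMean_sub_eq_batchNoise hm (hy t) (hg t)
  simp only [he, hz] at key
  rw [hfeq _ (hXD (hrun.x_mem hXconv _ ω)), hfeq _ hxD] at key
  linarith

end RandomizedSmoothing

/-! ### The rate in `T`, `m`, `d` and `δ` -/

theorem corollary4 :
    ∃ C : ℝ, 0 < C ∧
      ∀ (d m : ℕ) (hd : 1 ≤ d) (hm : 1 ≤ m)
        (L₀ R : ℝ) (hL₀ : 0 < L₀) (hR : 0 < R)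
        (Ξ : Type*) [MeasurableSpace Ξ] (P : Measure Ξ) [IsProbabilityMeasure P]
        (Ω : Type*) [MeasurableSpace Ω] (Pr : Measure Ω) [IsProbabilityMeasure Pr]
        (X D : Set (EuclideanSpace ℝ (Fin d)))
        (F : EuclideanSpace ℝ (Fin d) → Ξ → ℝ)
        (φ ψ : EuclideanSpace ℝ (Fin d) → ℝ)
        (xstar : EuclideanSpace ℝ (Fin d))
        (u : ℝ) (us L η : ℕ → ℝ)
        -- the feasible set, the comparison point and the regularizer
        (hX : IsCompact X) (hXconv : Convex ℝ X)
        (hxstar : xstar ∈ X) (hrad : ∀ x ∈ X, ‖x - xstar‖ ≤ R)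
        (hφ : ConvexOn ℝ X φ) (hφ_closed : LowerSemicontinuousOn φ X)
        -- the parameters of the method
        (hψ : ∀ x, ψ x = 1 / 2 * ‖x‖ ^ 2) (hψstar : ψ xstar ≤ R ^ 2)
        (hu : u = R * (d : ℝ) ^ (1 / 4 : ℝ))
        (hus : ∀ t, us t = u * RandomizedSmoothing.theta t)
        (hL : ∀ t, L t = L₀ * √(d : ℝ) / us t)
        (hη : ∀ t : ℕ, η t = L₀ * √((t : ℝ) + 1) / (R * √(m : ℝ)))
        -- the stochastic objective, on the set where it is sampled
        (hD : D = X + Metric.closedBall 0 u)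
        (hFint : ∀ x ∈ D, Integrable (F x) P)
        (hFlip : ∀ᵐ s ∂P, ∀ x ∈ D, ∀ y ∈ D, |F x s - F y s| ≤ L₀ * ‖x - y‖)
        (hf : ConvexOn ℝ D (RandomizedSmoothing.expectedObjective P F))
        -- the random inputs and the run of the method
        (Z : ℕ → Fin m → Ω → EuclideanSpace ℝ (Fin d)) (ξ : ℕ → Fin m → Ω → Ξ)
        (g : ℕ → Fin m → Ω → EuclideanSpace ℝ (Fin d))
        (x₀ z₀ : EuclideanSpace ℝ (Fin d))
        (x y z : ℕ → Ω → EuclideanSpace ℝ (Fin d))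
        (hsampling :
          RandomizedSmoothing.IsSampling Pr (RandomizedSmoothing.uniformBall d) P Z ξ)
        (hrun : RandomizedSmoothing.IsRun Pr X D F φ ψ us L η Z ξ g x₀ z₀ x y z)
        (T : ℕ) (hT : 4 ≤ T) (δ : ℝ) (hδ0 : 0 < δ) (hδ1 : δ < 1),
        1 - δ ≤ Pr.real {ω |
          RandomizedSmoothing.expectedObjective P F (x T ω) + φ (x T ω)
              - RandomizedSmoothing.expectedObjective P F xstar - φ xstar
            ≤ C * (L₀ * R * (d : ℝ) ^ (1 / 4 : ℝ) / T
                + L₀ * R / √((T : ℝ) * m)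
                + L₀ * R * √(Real.log (1 / δ)) / √((T : ℝ) * m)
                + L₀ * R * max (Real.log (1 / δ)) (Real.log T) / (T * √(m : ℝ)))} := by
  refine ⟨64, by norm_num, ?_⟩
  intro d m hd hm L₀ R hL₀ hR Ξ _ P _ Ω _ Pr _ X D F φ ψ xstar u us L η hX hXconv hxstar hrad hφ
    hφ_closed hψ hψstar hu hus hL hη hD hFint hFlip hf Z ξ g x₀ z₀ x y z hsampling hrun T hT δ hδ0
    hδ1
  have hd0 : (0 : ℝ) < d := by exact_mod_cast hd
  have hm0 : (0 : ℝ) < m := by exact_mod_cast hm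
  have hu0 : 0 < u := by rw [hu]; positivity
  obtain ⟨n, rfl⟩ : ∃ n, T = n + 1 := ⟨T - 1, by lia⟩
  obtain ⟨B, hB, hgap⟩ := RandomizedSmoothing.highProbability_gap_le hd hm hL₀ hR hX hXconv
    hxstar hrad hφ hφ_closed hψ
    hψstar hu0 hus hL hη hD hFint hFlip hf hsampling hrun n (half_pos hδ0) (by linarith)
  set S := {ω | RandomizedSmoothing.expectedObjective P F (x (n + 1) ω) + φ (x (n + 1) ω)
              - RandomizedSmoothing.expectedObjective P F xstar - φ xstar
            ≤ 64 * (L₀ * R * (d : ℝ) ^ (1 / 4 : ℝ) / (n + 1 : ℕ)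
                + L₀ * R / √(((n + 1 : ℕ) : ℝ) * m)
                + L₀ * R * √(Real.log (1 / δ)) / √(((n + 1 : ℕ) : ℝ) * m)
                + L₀ * R * max (Real.log (1 / δ)) (Real.log (n + 1 : ℕ))
                  / ((n + 1 : ℕ) * √(m : ℝ)))} with hS
  suffices hBS : ∀ᵐ ω ∂Pr, ω ∉ B → ω ∈ S by
    -- The complement is bounded first and subadditivity then bounds `Pr S` from below, so
    -- measurability of `S` is never needed.
    have h1 : Pr Sᶜ ≤ ENNReal.ofReal δ := by
      refine (measure_mono_ae (t := B) ?_).trans (hB.trans_eq ?_)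
      · filter_upwards [hBS] with ω hω hωS
        by_contra hωB
        exact hωS (hω hωB)
      · rw [← ENNReal.ofReal_add (by positivity) (by positivity), add_halves]
    have h2 : 1 ≤ Pr S + ENNReal.ofReal δ := by
      rw [← measure_univ (μ := Pr), ← Set.union_compl_self S]
      exact (measure_union_le _ _).trans (by gcongr)
    have h3 := ENNReal.toReal_mono (by finiteness) h2
    rw [ENNReal.toReal_add (by finiteness) (by finiteness), ENNReal.toReal_ofReal hδ0.le,
      ENNReal.toReal_one] at h3
    rw [Measure.real]
    linarith
  filter_upwards [hgap] with ω hω hωB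
  have key := hω hωB
  have hn : (3 : ℝ) ≤ n := by exact_mod_cast (by lia : 3 ≤ n)
  have hl1 : 0 < Real.log (1 / δ) := Real.log_pos (by rw [lt_div_iff₀ hδ0]; linarith)
  have hl : Real.log (1 / (δ / 2)) = Real.log 2 + Real.log (1 / δ) := by
    rw [← Real.log_mul two_ne_zero (by positivity)]
    congr 1
    field_simp
  have hlog2 : Real.log 2 ≤ 1 := by linarith [Real.log_two_lt_d9]
  have hlog2' : 0 ≤ Real.log 2 := Real.log_nonneg one_le_two
  -- `T ≥ 4 > e`. Hence `log T` dominates the `log 2` created by splitting `δ` into halves, and `log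
  -- (2/δ)` is at most twice the maximum in the rate.
  have hlogT : 1 ≤ Real.log (n + 1 : ℕ) := by
    rw [Real.le_log_iff_exp_le (by positivity)]
    push_cast
    linarith [Real.exp_one_lt_d9]
  rw [hS, Set.mem_ofPred_eq, Real.sqrt_mul (Nat.cast_nonneg _)]
  have hTs : ((n + 1 : ℕ) : ℝ) = √((n + 1 : ℕ) : ℝ) ^ 2 := (Real.sq_sqrt (Nat.cast_nonneg _)).symm
  have hs1 : 1 ≤ √((n + 1 : ℕ) : ℝ) := Real.one_le_sqrt.2 (by push_cast; linarith)
  have hM0 : 0 < √(m : ℝ) := Real.sqrt_pos.2 hm0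
  have hr : √(Real.log (1 / (δ / 2))) ≤ 1 + √(Real.log (1 / δ)) := by
    rw [Real.sqrt_le_left (by positivity), hl]
    nlinarith [Real.sq_sqrt hl1.le, Real.sqrt_nonneg (Real.log (1 / δ))]
  have ha := RandomizedSmoothing.le_inv_theta n
  have hb := RandomizedSmoothing.inv_theta_le (n + 1)
  have hb0 := RandomizedSmoothing.one_le_inv_theta (n + 1)
  refine RandomizedSmoothing.rate_of_weighted_gap_le
    (A := (RandomizedSmoothing.theta n)⁻¹ ^ 2) (r := √(Real.log (1 / (δ / 2))))
    (l := Real.log (1 / (δ / 2))) (by positivity) (by positivity) hs1 hTs hM0 ?_ hr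
    (Real.sqrt_nonneg _) (by linarith) ?_ (key.trans ?_)
  · push_cast
    nlinarith
  · have h1 := le_max_left (Real.log (1 / δ)) (Real.log (n + 1 : ℕ))
    have h2 := le_max_right (Real.log (1 / δ)) (Real.log (n + 1 : ℕ))
    linarith
  -- The choice `u = R d^(1/4)` balances the smoothness cost `L₀ √d R² / u` against the bias `L₀ u`.
  · have hq : L₀ * √(d : ℝ) / u * R ^ 2 = L₀ * R * (d : ℝ) ^ (1 / 4 : ℝ) := by
      have : √(d : ℝ) = (d : ℝ) ^ (1 / 4 : ℝ) * (d : ℝ) ^ (1 / 4 : ℝ) := by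
        rw [← Real.rpow_add hd0, Real.sqrt_eq_rpow]
        norm_num
      rw [this, hu]
      field_simp
    have hsq : √((n + 1 : ℕ) + 1 : ℝ) ≤ 2 * √((n + 1 : ℕ) : ℝ) := by
      rw [Real.sqrt_le_left (by positivity), mul_pow, ← hTs]
      push_cast
      linarith
    have hη1 : η (n + 1) * (RandomizedSmoothing.theta (n + 1))⁻¹ * R ^ 2
        ≤ 4 * (L₀ * R * (n + 1 : ℕ) * √((n + 1 : ℕ) : ℝ) / √(m : ℝ)) := by
      calc η (n + 1) * (RandomizedSmoothing.theta (n + 1))⁻¹ * R ^ 2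
          = L₀ * R / √(m : ℝ)
            * (√((n + 1 : ℕ) + 1 : ℝ) * (RandomizedSmoothing.theta (n + 1))⁻¹) := by
            rw [hη]
            field_simp
        _ ≤ L₀ * R / √(m : ℝ) * (2 * √((n + 1 : ℕ) : ℝ) * (2 * (n + 1 : ℕ))) := by
            gcongr
            refine hb.trans ?_
            push_cast
            linarith
        _ = _ := by ring
    have hη2 : η 0 * R ^ 2 ≤ L₀ * R * (n + 1 : ℕ) * √((n + 1 : ℕ) : ℝ) / √(m : ℝ) := by
      calc η 0 * R ^ 2 = L₀ * R * 1 * 1 / √(m : ℝ) := by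
            rw [hη]
            simp
            field_simp
        _ ≤ _ := by
            gcongr
            push_cast
            linarith
    have hw : 0 < L₀ * R * (d : ℝ) ^ (1 / 4 : ℝ) := by positivity
    have hL1 : L₀ * R * (d : ℝ) ^ (1 / 4 : ℝ) * (RandomizedSmoothing.theta (n + 1))⁻¹
        ≤ L₀ * R * (d : ℝ) ^ (1 / 4 : ℝ) * (2 * (n + 1 : ℕ)) := by
      gcongr
      refine hb.trans ?_
      push_cast
      linarith
    have hL2 : L₀ * R * (d : ℝ) ^ (1 / 4 : ℝ) * 1
        ≤ L₀ * R * (d : ℝ) ^ (1 / 4 : ℝ) * (n + 1 : ℕ) := by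
      gcongr
      push_cast
      linarith
    have hL3 : L₀ * u * (n + 1) = L₀ * R * (d : ℝ) ^ (1 / 4 : ℝ) * (n + 1 : ℕ) := by
      rw [hu]
      push_cast
      ring
    have e : (L₀ * √(d : ℝ) / u * (RandomizedSmoothing.theta (n + 1))⁻¹
          + η (n + 1) * (RandomizedSmoothing.theta (n + 1))⁻¹) * R ^ 2
        + 2 * (L₀ * √(d : ℝ) / u + η 0) * R ^ 2
        = L₀ * √(d : ℝ) / u * R ^ 2 * (RandomizedSmoothing.theta (n + 1))⁻¹
          + η (n + 1) * (RandomizedSmoothing.theta (n + 1))⁻¹ * R ^ 2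
          + 2 * (L₀ * √(d : ℝ) / u * R ^ 2) + 2 * (η 0 * R ^ 2) := by ring
    -- The smoothing terms add up to `2 + 2 + 1 = 5`, and the terms in `η` with the squared noise to
    -- `4 + 2 + 4 = 10`; the martingale contributes `3 r`.
    rw [e, hq, hL3]
    linarith
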